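/- Let $\Omega\subset\mathbb R^2$ be a convex polygon with $m\ge 3$ sides (no three vertices collinear), given by the array of its vertices in counterclockwise order, and let $p\neq q$ be points of $\operatorname{int}\Omega$. For distinct $a,b\in\operatorname{int}\Omega$ let $a',b'$ be the endpoints of the chord of $\Omega$ through $a,b$, in the order $a',a,b,b'$, let $$d_\Omega(a,b)=\tfrac12\ln\Big(\frac{\|b-a'\|}{\|a-a'\|}\cdot\frac{\|a-b'\|}{\|b-b'\|}\Big),\qquad d_\Omega(a,a)=0,$$ and let the $(p,q)$-bisector be $\{x\in\operatorname{int}\Omega : d_\Omega(x,p)=d_\Omega(x,q)\}$. Its limit points on $\partial\Omega$ are the points of $\partial\Omega$ that lie in its closure. There is a single real-RAM program (field operations and exact comparisons on reals; addition, subtraction, halving and comparison on indices; each at unit cost) that, given any such $\Omega$, $p$ and $q$, computes in $O(\log^2 m)$ time two points $x,y\in\partial\Omega$, where $x$ lies strictly to the left and $y$ strictly to the right of the directed line from $p$ to $q$, and both are limit points of the $(p,q)$-bisector. If no two distinct side lines of $\Omega$ are concurrent with the line $pq$ (three lines being concurrent if they have a common point or are all parallel), then $x$ and $y$ are the only limit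 points of the bisector on $\partial\Omega$, that is, they are its two endpoints. -/

import Mathlib

/-! ### Real RAM: a structured program language with unit-cost semantics -/

namespace RealRAM

/-- A machine state: index registers, real registers, and a random-access memory of reals. -/
structure State where
  idx : ℕ → ℕ
  reg : ℕ → ℝ
  mem : ℕ → ℝ

/-- Index expressions: natural-number literals, registers, addition, truncated subtraction,
and halving (rounded down). -/
inductive IExp where
  | lit (n : ℕ)
  | var (i : ℕ)
  | add (a b : IExp)
  | sub (a b : IExp)
  | half (a : IExp)

namespace IExp

def eval (s : State) : IExp → ℕ
  | lit n => n
  | var i => s.idx i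
  | add a b => a.eval s + b.eval s
  | sub a b => a.eval s - b.eval s
  | half a => a.eval s / 2

/-- Every node of an expression costs one unit of time. -/
def cost : IExp → ℕ
  | lit _ => 1
  | var _ => 1
  | add a b => a.cost + b.cost + 1
  | sub a b => a.cost + b.cost + 1
  | half a => a.cost + 1

end IExp

/-- Real expressions: integer literals, registers, memory reads at a computed address, and the
four field operations. Division by zero yields zero. -/
inductive RExp where
  | lit (z : ℤ)
  | var (i : ℕ)
  | load (a : IExp)
  | add (a b : RExp)
  | sub (a b : RExp)
  | mul (a b : RExp)
  | div (a b : RExp)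

namespace RExp

noncomputable def eval (s : State) : RExp → ℝ
  | lit z => (z : ℝ)
  | var i => s.reg i
  | load a => s.mem (a.eval s)
  | add a b => a.eval s + b.eval s
  | sub a b => a.eval s - b.eval s
  | mul a b => a.eval s * b.eval s
  | div a b => a.eval s / b.eval s

def cost : RExp → ℕ
  | lit _ => 1
  | var _ => 1
  | load a => a.cost + 1
  | add a b => a.cost + b.cost + 1
  | sub a b => a.cost + b.cost + 1
  | mul a b => a.cost + b.cost + 1
  | div a b => a.cost + b.cost + 1

end RExp

/-- Tests: comparisons of indices, exact comparisons of reals, and Boolean combinations. -/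
inductive BExp where
  | ltI (a b : IExp)
  | ltR (a b : RExp)
  | not (a : BExp)
  | and (a b : BExp)

namespace BExp

def Holds (s : State) : BExp → Prop
  | ltI a b => a.eval s < b.eval s
  | ltR a b => a.eval s < b.eval s
  | not a => ¬ a.Holds s
  | and a b => a.Holds s ∧ b.Holds s

def cost : BExp → ℕ
  | ltI a b => a.cost + b.cost + 1
  | ltR a b => a.cost + b.cost + 1
  | not a => a.cost + 1
  | and a b => a.cost + b.cost + 1

end BExp

/-- Programs. A program is a finite object that does not depend on the input. -/
inductive Prog where
  | skip
  | setI (i : ℕ) (e : IExp)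
  | setR (i : ℕ) (e : RExp)
  | store (a : IExp) (e : RExp)
  | seq (c d : Prog)
  | ite (b : BExp) (c d : Prog)
  | loop (b : BExp) (c : Prog)

/-- `Exec c s t s'`: the program `c`, started in the state `s`, halts after exactly `t` units of
time in the state `s'`. The program `loop b c` repeats `c` while `b` holds. -/
inductive Exec : Prog → State → ℕ → State → Prop
  | skip (s : State) : Exec Prog.skip s 1 s
  | setI (s : State) (i : ℕ) (e : IExp) :
      Exec (Prog.setI i e) s (e.cost + 1) { s with idx := Function.update s.idx i (e.eval s) }
  | setR (s : State) (i : ℕ) (e : RExp) :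
      Exec (Prog.setR i e) s (e.cost + 1) { s with reg := Function.update s.reg i (e.eval s) }
  | store (s : State) (a : IExp) (e : RExp) :
      Exec (Prog.store a e) s (a.cost + e.cost + 1)
        { s with mem := Function.update s.mem (a.eval s) (e.eval s) }
  | seq {c d : Prog} {s s₁ s₂ : State} {t₁ t₂ : ℕ} :
      Exec c s t₁ s₁ → Exec d s₁ t₂ s₂ → Exec (Prog.seq c d) s (t₁ + t₂) s₂
  | iteTrue {b : BExp} {c d : Prog} {s s₁ : State} {t : ℕ} :
      b.Holds s → Exec c s t s₁ → Exec (Prog.ite b c d) s (b.cost + t + 1) s₁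
  | iteFalse {b : BExp} {c d : Prog} {s s₁ : State} {t : ℕ} :
      ¬ b.Holds s → Exec d s t s₁ → Exec (Prog.ite b c d) s (b.cost + t + 1) s₁
  | loopTrue {b : BExp} {c : Prog} {s s₁ s₂ : State} {t₁ t₂ : ℕ} :
      b.Holds s → Exec c s t₁ s₁ → Exec (Prog.loop b c) s₁ t₂ s₂ →
        Exec (Prog.loop b c) s (b.cost + t₁ + t₂ + 1) s₂
  | loopFalse {b : BExp} {c : Prog} {s : State} :
      ¬ b.Holds s → Exec (Prog.loop b c) s (b.cost + 1) s

end RealRAM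

/-! ### Convex polygons and the Hilbert metric -/

namespace HilbertPlane

/-- The Euclidean plane. -/
abbrev Plane : Type := EuclideanSpace ℝ (Fin 2)

/-- Twice the signed area of the triangle `a b c`; it is positive if and only if `c` lies strictly
to the left of the directed line from `a` to `b`. -/
def orient (a b c : Plane) : ℝ :=
  (b 0 - a 0) * (c 1 - a 1) - (b 1 - a 1) * (c 0 - a 0)

/-- `v` lists the vertices of a (strictly) convex polygon with `m` sides in counterclockwise
order. -/
def IsConvexPolygon {m : ℕ} (v : Fin m → Plane) : Prop :=
  3 ≤ m ∧ ∀ i j k : Fin m, i < j → j < k → 0 < orient (v i) (v j) (v k)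

/-- The closed region bounded by the polygon. -/
def region {m : ℕ} (v : Fin m → Plane) : Set Plane := convexHull ℝ (Set.range v)

/-- The line through the `i`-th side of the polygon, which joins the `i`-th vertex to the
(cyclically) next one. -/
noncomputable def sideLine {m : ℕ} (v : Fin m → Plane) (i : Fin m) : AffineSubspace ℝ Plane :=
  line[ℝ, v i, v (finRotate m i)]

/-- Three lines are concurrent if they have a common point or are parallel. -/
def Concurrent (L₁ L₂ L₃ : AffineSubspace ℝ Plane) : Prop :=
  (∃ z : Plane, z ∈ L₁ ∧ z ∈ L₂ ∧ z ∈ L₃) ∨ (L₁.Parallel L₂ ∧ L₂.Parallel L₃)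

/-- The endpoint, beyond `q`, of the chord of the convex body `K` through `p` and `q`. -/
noncomputable def chordEnd (K : Set Plane) (p q : Plane) : Plane :=
  AffineMap.lineMap p q (sSup {t : ℝ | AffineMap.lineMap p q t ∈ K})

open Classical in
/-- The Hilbert distance in the convex body `K`. -/
noncomputable def hilbertDist (K : Set Plane) (p q : Plane) : ℝ :=
  if p = q then 0
  else (1 / 2) * Real.log
    (dist q (chordEnd K q p) / dist p (chordEnd K q p) *
      (dist p (chordEnd K p q) / dist q (chordEnd K p q)))

/-- The `(p,q)`-bisector: the interior points that are Hilbert equidistant from `p` and `q`. -/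
def bisector (K : Set Plane) (p q : Plane) : Set Plane :=
  {x | x ∈ interior K ∧ hilbertDist K x p = hilbertDist K x q}

/-- The points of the boundary of `K` that are limit points of the `(p,q)`-bisector. -/
def bisectorEnds (K : Set Plane) (p q : Plane) : Set Plane :=
  closure (bisector K p q) ∩ frontier K

/-- The state `s` holds the input `(v, p, q)`: the number of vertices in index register `0`, the
coordinates of `p` and `q` in the real registers `0, 1, 2, 3`, and the coordinates of the vertices
in consecutive memory cells. All other cells are arbitrary. -/
def HoldsInput {m : ℕ} (s : RealRAM.State) (v : Fin m → Plane) (p q : Plane) : Prop :=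
  s.idx 0 = m ∧ s.reg 0 = p 0 ∧ s.reg 1 = p 1 ∧ s.reg 2 = q 0 ∧ s.reg 3 = q 1 ∧
    ∀ i : Fin m, s.mem (2 * (i : ℕ)) = v i 0 ∧ s.mem (2 * (i : ℕ) + 1) = v i 1

/-- The state `s` holds the output `(x, y)` in the real registers `0, 1, 2, 3`. -/
def HoldsOutput (s : RealRAM.State) (x y : Plane) : Prop :=
  s.reg 0 = x 0 ∧ s.reg 1 = x 1 ∧ s.reg 2 = y 0 ∧ s.reg 3 = y 1

end HilbertPlane

/-!
For an affine function `sⱼ` vanishing on the side `j` and positive inside, the Hilbert distance is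
`d(a, b) = ½ log (F(a, b) F(b, a))` with `F(a, b) = maxⱼ sⱼ(a) / sⱼ(b)`. When `x` tends to a point
`z` of the side `i`, the factor `F(p, x)` is eventually `sᵢ(p) / sᵢ(x)`, so the sign of
`d(x, p) - d(x, q)` is governed by the balance `sᵢ(p) F(z, p) - sᵢ(q) F(z, q)`. On the part of the
boundary to the left of `pq`, traversed counterclockwise, the balance is positive at the start and
negative at the end, so a binary search over the vertices finds a side that contains a limit point.
Evaluating the balance means finding the sides where the rays from `z` through `p` and `q` leave the
polygon, which is a binary search of its own; hence the time `O(log² m)`. Further binary searches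
shrink the side to a segment on which these far sides are constant. There the balance is an affine
function, and its root is found by a division.

Along the left part both `sᵢ(p) / sᵢ(q)` and `F(z, p) / F(z, q)` are nonincreasing, the former
strictly from side to side. If two limit points lay on the same side `i`, it would have the same
ratio `sᵢ(p) / sᵢ(q)` as one of the far sides, and the lines through both would be concurrent
with `pq`.
-/

namespace HilbertPlane

/-! ### Signed areas -/

theorem orient_rotate (a b c : Plane) : orient b c a = orient a b c := by
  simp only [orient]; ring

theorem orient_swap (a b c : Plane) : orient b a c = -orient a b c := by
  simp only [orient]; ring

theorem orient_swap_right (a b c : Plane) : orient a c b = -orient a b c := by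
  simp only [orient]; ring

@[simp] theorem orient_self_left (a b : Plane) : orient a b a = 0 := by
  simp only [orient]; ring

@[simp] theorem orient_self_right (a b : Plane) : orient a b b = 0 := by
  simp only [orient]; ring

@[simp] theorem orient_self (a b : Plane) : orient a a b = 0 := by
  simp only [orient]; ring

theorem lineMap_coord (a b : Plane) (t : ℝ) (i : Fin 2) :
    (AffineMap.lineMap a b t : Plane) i = a i + t * (b i - a i) := by
  simp only [AffineMap.lineMap_apply, vsub_eq_sub, vadd_eq_add, PiLp.add_apply, PiLp.smul_apply,
    PiLp.sub_apply, smul_eq_mul]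
  ring

theorem orient_lineMap (a b c d : Plane) (t : ℝ) :
    orient a b (AffineMap.lineMap c d t) = (1 - t) * orient a b c + t * orient a b d := by
  simp only [orient, lineMap_coord]; ring

theorem orient_lineMap_left (a b c d : Plane) (t : ℝ) :
    orient (AffineMap.lineMap c d t) a b = (1 - t) * orient c a b + t * orient d a b := by
  simp only [orient, lineMap_coord]; ring

theorem plane_ext {a b : Plane} (h0 : a 0 = b 0) (h1 : a 1 = b 1) : a = b := by
  ext i; fin_cases i <;> assumption

theorem continuous_orient (a b : Plane) : Continuous (orient a b) := by
  unfold orient; fun_prop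

/-- Barycentric coordinates are ratios of signed areas. -/
theorem orient_smul_eq (a b c z : Plane) :
    orient a b c • z = orient b c z • a + orient c a z • b + orient a b z • c := by
  apply plane_ext <;> simp only [PiLp.add_apply, PiLp.smul_apply, smul_eq_mul, orient] <;> ring

theorem orient_eq_add (a b c z : Plane) :
    orient a b c = orient b c z + orient c a z + orient a b z := by
  simp only [orient]; ring

theorem mem_of_orient_nonneg {S : Set Plane} (hS : Convex ℝ S) {a b c z : Plane} (ha : a ∈ S)
    (hb : b ∈ S) (hc : c ∈ S) (habc : 0 < orient a b c) (hbcz : 0 ≤ orient b c z)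
    (hcaz : 0 ≤ orient c a z) (habz : 0 ≤ orient a b z) : z ∈ S := by
  have hsum : orient b c z / orient a b c + orient c a z / orient a b c +
      orient a b z / orient a b c = 1 := by
    rw [← add_div, ← add_div, ← orient_eq_add, div_self habc.ne']
  have hz : (orient b c z / orient a b c) • a + (orient c a z / orient a b c) • b +
      (orient a b z / orient a b c) • c = z := by
    simp only [div_eq_inv_mul, mul_smul, ← smul_add]
    rw [← orient_smul_eq, inv_smul_smul₀ habc.ne']
  have hmem := hS.sum_mem (t := Finset.univ) (w := ![orient b c z / orient a b c,
    orient c a z / orient a b c, orient a b z / orient a b c]) (z := ![a, b, c])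
    (fun i _ => by fin_cases i <;> exact div_nonneg ‹_› habc.le)
    (by simpa [Fin.sum_univ_three] using hsum) (fun i _ => by fin_cases i <;> assumption)
  rw [← hz]
  simpa [Fin.sum_univ_three] using hmem

theorem exists_and_not_succ {P : ℕ → Prop} {a b : ℕ} (hab : a ≤ b) (ha : P a) (hb : ¬ P b) :
    ∃ c, a ≤ c ∧ c < b ∧ P c ∧ ¬ P (c + 1) := by
  induction b, hab using Nat.le_induction with
  | base => exact absurd ha hb
  | succ n hn ih =>
    by_cases h : P n
    · exact ⟨n, hn, n.lt_succ_self, h, hb⟩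
    · obtain ⟨c, hac, hcn, hc⟩ := ih h
      exact ⟨c, hac, by omega, hc⟩

theorem exists_mod_eq_of_pos {m : ℕ} (hm : 0 < m) (a j : ℕ) :
    ∃ k, a ≤ k ∧ k < a + m ∧ k % m = j % m := by
  have : j % m ∈ (Finset.Ico a (a + m)).image (· % m) := by
    rw [Nat.image_Ico_mod]
    exact Finset.mem_range.2 (Nat.mod_lt j hm)
  simpa [and_assoc] using this

/-! ### Polygons as periodic sequences of vertices -/

/-- `V` runs cyclically, in counterclockwise order, through the vertices of a strictly convex
polygon with `m` sides. Indexing by all of `ℕ` turns a stretch of the boundary that passes the first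
vertex into an interval of indices. -/
structure CyclicPolygon (m : ℕ) (V : ℕ → Plane) : Prop where
  three_le : 3 ≤ m
  periodic : Function.Periodic V m
  convex : ∀ i j k, i < j → j < k → k < i + m → 0 < orient (V i) (V j) (V k)

/-- The affine function that vanishes on the `j`-th side line and is positive inside the polygon:
the distance to that line, up to the length of the side. -/
def side (V : ℕ → Plane) (j : ℕ) (z : Plane) : ℝ := orient (V j) (V (j + 1)) z

/-- The closed polygon, as the intersection of the closed half-planes bounded by the side lines. -/
def body (V : ℕ → Plane) : Set Plane := {z | ∀ j, 0 ≤ side V j z}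

/-- The open polygon, as the intersection of the open half-planes bounded by the side lines. -/
def openBody (V : ℕ → Plane) : Set Plane := {z | ∀ j, 0 < side V j z}

section HalfPlanes

variable {V : ℕ → Plane} {a b : Plane}

theorem side_lineMap (V : ℕ → Plane) (j : ℕ) (a b : Plane) (t : ℝ) :
    side V j (AffineMap.lineMap a b t) = (1 - t) * side V j a + t * side V j b :=
  orient_lineMap _ _ _ _ _

theorem continuous_side (V : ℕ → Plane) (j : ℕ) : Continuous (side V j) := continuous_orient _ _

@[simp] theorem side_left (V : ℕ → Plane) (j : ℕ) : side V j (V j) = 0 := by simp [side]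

@[simp] theorem side_right (V : ℕ → Plane) (j : ℕ) : side V j (V (j + 1)) = 0 := by simp [side]

theorem openBody_subset_body (V : ℕ → Plane) : openBody V ⊆ body V := fun _ h j => (h j).le

theorem lineMap_mem_body (ha : a ∈ body V) (hb : b ∈ body V) {t : ℝ} (h0 : 0 ≤ t) (h1 : t ≤ 1) :
    AffineMap.lineMap a b t ∈ body V := fun j => by
  rw [side_lineMap]
  exact add_nonneg (mul_nonneg (sub_nonneg.2 h1) (ha j)) (mul_nonneg h0 (hb j))

theorem lineMap_mem_openBody (ha : a ∈ body V) (hb : b ∈ openBody V) {t : ℝ} (h0 : 0 < t)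
    (h1 : t ≤ 1) : AffineMap.lineMap a b t ∈ openBody V := fun j => by
  rw [side_lineMap]
  exact add_pos_of_nonneg_of_pos (mul_nonneg (sub_nonneg.2 h1) (ha j)) (mul_pos h0 (hb j))

theorem isClosed_body (V : ℕ → Plane) : IsClosed (body V) := by
  simp only [body, Set.ofPred_forall]
  exact isClosed_iInter fun j => isClosed_le continuous_const (continuous_side V j)

theorem convex_body (V : ℕ → Plane) : Convex ℝ (body V) := by
  rw [convex_iff_segment_subset]
  intro a ha b hb
  rw [segment_eq_image_lineMap]
  rintro _ ⟨t, ht, rfl⟩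
  exact lineMap_mem_body ha hb ht.1 ht.2

theorem convex_openBody (V : ℕ → Plane) : Convex ℝ (openBody V) := by
  rw [convex_iff_segment_subset]
  intro a ha b hb
  rw [segment_eq_image_lineMap]
  rintro _ ⟨t, ht, rfl⟩
  rcases ht.1.eq_or_lt with rfl | h0
  · rwa [AffineMap.lineMap_apply_zero]
  · exact lineMap_mem_openBody (openBody_subset_body V ha) hb h0 ht.2

/-- The Plücker relation for two consecutive sides. -/
theorem side_mul_side_sub (V : ℕ → Plane) (j : ℕ) (x y : Plane) :
    side V j x * side V (j + 1) y - side V j y * side V (j + 1) x =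
      orient (V j) (V (j + 1)) (V (j + 2)) * orient (V (j + 1)) x y := by
  simp only [side, orient]; ring

end HalfPlanes

namespace CyclicPolygon

variable {m : ℕ} {V : ℕ → Plane}

theorem pos (hV : CyclicPolygon m V) : 0 < m := by have := hV.three_le; omega

theorem apply_congr (hV : CyclicPolygon m V) {j k : ℕ} (h : j % m = k % m) : V j = V k := by
  rw [← hV.periodic.map_mod_nat j, h, hV.periodic.map_mod_nat]

theorem side_periodic (hV : CyclicPolygon m V) (z : Plane) :
    Function.Periodic (fun j => side V j z) m := fun j => by
  simp only [side, hV.periodic j, show j + m + 1 = j + 1 + m by ring, hV.periodic (j + 1)]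

theorem side_add (hV : CyclicPolygon m V) (j : ℕ) (z : Plane) : side V (j + m) z = side V j z :=
  hV.side_periodic z j

theorem side_mod (hV : CyclicPolygon m V) (j : ℕ) (z : Plane) : side V (j % m) z = side V j z :=
  (hV.side_periodic z).map_mod_nat j

theorem side_congr (hV : CyclicPolygon m V) {j k : ℕ} (h : j % m = k % m) (z : Plane) :
    side V j z = side V k z := by
  rw [← hV.side_mod j, h, hV.side_mod]

theorem orient_nonneg (hV : CyclicPolygon m V) {i j k : ℕ} (hij : i ≤ j) (hjk : j ≤ k)
    (hk : k ≤ i + m) : 0 ≤ orient (V i) (V j) (V k) := by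
  rcases hij.eq_or_lt with rfl | hij
  · simp
  rcases hjk.eq_or_lt with rfl | hjk
  · simp
  rcases hk.eq_or_lt with rfl | hk
  · simp [hV.periodic i]
  exact (hV.convex i j k hij hjk hk).le

theorem side_vertex_pos (hV : CyclicPolygon m V) {j k : ℕ} (h1 : j + 1 < k) (h2 : k < j + m) :
    0 < side V j (V k) := hV.convex _ _ _ (Nat.lt_succ_self j) h1 h2

theorem vertex_mem (hV : CyclicPolygon m V) (k : ℕ) : V k ∈ body V := fun j => by
  obtain ⟨k', hjk', hk'm, hmod⟩ := exists_mod_eq_of_pos hV.pos j k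
  rw [← hV.apply_congr hmod]
  rcases hjk'.eq_or_lt with rfl | hjk'
  · simp
  · exact hV.orient_nonneg (Nat.le_succ j) hjk' hk'm.le

theorem turn_pos (hV : CyclicPolygon m V) (j : ℕ) : 0 < orient (V j) (V (j + 1)) (V (j + 2)) :=
  hV.convex _ _ _ (by omega) (by omega) (by have := hV.three_le; omega)

theorem isOpen_openBody (hV : CyclicPolygon m V) : IsOpen (openBody V) := by
  have : openBody V = ⋂ j ∈ Finset.range m, {z | 0 < side V j z} := by
    ext z
    simp only [openBody, Set.mem_ofPred_eq, Set.mem_iInter, Finset.mem_range]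
    exact ⟨fun h j _ => h j, fun h j => hV.side_mod j z ▸ h _ (Nat.mod_lt _ hV.pos)⟩
  rw [this]
  exact isOpen_biInter_finset fun j _ => isOpen_lt continuous_const (continuous_side V j)

theorem interior_body (hV : CyclicPolygon m V) : interior (body V) = openBody V := by
  refine Set.Subset.antisymm (fun z hz j => ?_)
    (interior_maximal (openBody_subset_body V) hV.isOpen_openBody)
  -- If `side V j` vanished at `z`, it would be negative beyond `z` on the ray from `V (j + 2)`.
  refine (interior_subset hz j).lt_of_ne' fun hjz => ?_
  have hline : Filter.Tendsto (fun t : ℝ => (AffineMap.lineMap z (V (j + 2)) t : Plane))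
      (nhdsWithin 0 (Set.Iio 0)) (nhds z) :=
    (AffineMap.lineMap_continuous.tendsto' 0 z (AffineMap.lineMap_apply_zero _ _)).mono_left
      nhdsWithin_le_nhds
  obtain ⟨t, htbody, ht : t < 0⟩ :=
    ((hline.eventually (mem_interior_iff_mem_nhds.1 hz)).and self_mem_nhdsWithin).exists
  have hneg := htbody j
  rw [side_lineMap, hjz, mul_zero, zero_add] at hneg
  exact (mul_neg_of_neg_of_pos ht (hV.turn_pos j)).not_ge hneg

theorem frontier_body (hV : CyclicPolygon m V) :
    frontier (body V) = {z | z ∈ body V ∧ ∃ j, side V j z = 0} := by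
  rw [(isClosed_body V).frontier_eq, hV.interior_body]
  ext z
  simp only [Set.mem_sdiff, Set.mem_ofPred_eq, openBody, not_forall, not_lt]
  exact and_congr_right fun hz => exists_congr fun j => ⟨fun h => le_antisymm h (hz j), le_of_eq⟩

theorem exists_fan_triangle (hV : CyclicPolygon m V) {z : Plane} (hz : z ∈ body V) :
    ∃ c, 1 ≤ c ∧ c + 1 < m ∧ 0 ≤ orient (V 0) (V c) z ∧ orient (V 0) (V (c + 1)) z ≤ 0 := by
  have hm := hV.three_le
  obtain ⟨c, hc, -, ⟨hcz, hcm⟩, hsucc⟩ := exists_and_not_succ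
    (P := fun c => 0 ≤ orient (V 0) (V c) z ∧ c < m - 1) (a := 1) (b := m - 1) (by omega)
    ⟨hz 0, by omega⟩ (by simp)
  refine ⟨c, hc, by omega, hcz, ?_⟩
  by_contra! hpos
  have hlast : c + 1 = m - 1 := by
    by_contra h
    exact hsucc ⟨hpos.le, by omega⟩
  have hclosing := hz (m - 1)
  rw [side, show m - 1 + 1 = 0 + m by omega, hV.periodic 0, orient_swap, ← hlast] at hclosing
  linarith

theorem convexHull_eq_body (hV : CyclicPolygon m V) : convexHull ℝ (Set.range V) = body V := by
  refine Set.Subset.antisymm (convexHull_min ?_ (convex_body V)) fun z hz => ?_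
  · rintro _ ⟨k, rfl⟩
    exact hV.vertex_mem k
  · obtain ⟨c, hc, hcm, hcz, hsucc⟩ := hV.exists_fan_triangle hz
    have hvertex (k : ℕ) : V k ∈ convexHull ℝ (Set.range V) := subset_convexHull _ _ ⟨k, rfl⟩
    refine mem_of_orient_nonneg (convex_convexHull ℝ _) (hvertex 0) (hvertex c) (hvertex (c + 1))
      (hV.convex _ _ _ (by omega) (by omega) (by omega)) (hz c) ?_ hcz
    rw [orient_swap]
    linarith

end CyclicPolygon

section CyclicExtension

variable {m : ℕ} {v : Fin m → Plane}

/-- The `m`-periodic sequence of vertices that extends the finite list `v`. -/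
def cyclicExtension (hm : 0 < m) (v : Fin m → Plane) (j : ℕ) : Plane :=
  v ⟨j % m, Nat.mod_lt j hm⟩

theorem cyclicExtension_of_lt (hm : 0 < m) (v : Fin m → Plane) {j : ℕ} (hj : j < m) :
    cyclicExtension hm v j = v ⟨j, hj⟩ := by
  simp only [cyclicExtension, Nat.mod_eq_of_lt hj]

theorem periodic_cyclicExtension (hm : 0 < m) (v : Fin m → Plane) :
    Function.Periodic (cyclicExtension hm v) m := fun j => by
  simp only [cyclicExtension, Nat.add_mod_right]

theorem range_cyclicExtension (hm : 0 < m) (v : Fin m → Plane) :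
    Set.range (cyclicExtension hm v) = Set.range v := by
  refine Set.Subset.antisymm (Set.range_subset_iff.2 fun j => ⟨_, rfl⟩) ?_
  rintro _ ⟨i, rfl⟩
  exact ⟨i, cyclicExtension_of_lt hm v i.2⟩

theorem IsConvexPolygon.orient_cyclicExtension_pos (hv : IsConvexPolygon v) (hm : 0 < m) {i j k : ℕ}
    (hij : i < j) (hjk : j < k) (hk : k < i + m) (hi : i < m) :
    0 < orient (cyclicExtension hm v i) (cyclicExtension hm v j) (cyclicExtension hm v k) := by
  have hbase {a b c : ℕ} (hab : a < b) (hbc : b < c) (hc : c < m) :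
      0 < orient (cyclicExtension hm v a) (cyclicExtension hm v b) (cyclicExtension hm v c) := by
    rw [cyclicExtension_of_lt hm v hc, cyclicExtension_of_lt hm v (hbc.trans hc),
      cyclicExtension_of_lt hm v ((hab.trans hbc).trans hc)]
    exact hv.2 _ _ _ hab hbc
  have hperiodic := periodic_cyclicExtension hm v
  rcases lt_or_ge k m with hkm | hkm
  · exact hbase hij hjk hkm
  obtain ⟨k, rfl⟩ := Nat.exists_eq_add_of_le' hkm
  rw [hperiodic k]
  rcases lt_or_ge j m with hjm | hjm
  · rw [orient_rotate]
    exact hbase (by omega) hij hjm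
  obtain ⟨j, rfl⟩ := Nat.exists_eq_add_of_le' hjm
  rw [hperiodic j, ← orient_rotate]
  exact hbase (by omega) (by omega) hi

theorem IsConvexPolygon.cyclicPolygon (hv : IsConvexPolygon v) (hm : 0 < m) :
    CyclicPolygon m (cyclicExtension hm v) where
  three_le := hv.1
  periodic := periodic_cyclicExtension hm v
  convex i j k hij hjk hk := by
    have hi := Nat.mod_add_div' i m
    have hshift {l : ℕ} (hl : i ≤ l) :
        cyclicExtension hm v (l - i / m * m) = cyclicExtension hm v l := by
      rw [← (periodic_cyclicExtension hm v).nat_mul (i / m) (l - i / m * m), Nat.cast_id,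
        Nat.sub_add_cancel (by omega)]
    rw [← hshift le_rfl, ← hshift hij.le, ← hshift (hij.trans hjk).le]
    have := Nat.mod_lt i hm
    exact hv.orient_cyclicExtension_pos hm (by omega) (by omega) (by omega) (by omega)

theorem IsConvexPolygon.region_eq (hv : IsConvexPolygon v) (hm : 0 < m) :
    region v = body (cyclicExtension hm v) := by
  rw [← (hv.cyclicPolygon hm).convexHull_eq_body, range_cyclicExtension, region]

end CyclicExtension

end HilbertPlane

namespace HilbertPlane

/-! ### The Hilbert metric of a polygon -/

/-- The exponential of the Funk distance from `a` to `b`: the largest ratio of their distances to a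
side line. For `m`-gons the first `m` sides suffice; one more keeps the maximum defined at
`m = 0`. -/
noncomputable def expFunk (m : ℕ) (V : ℕ → Plane) (a b : Plane) : ℝ :=
  (Finset.range (m + 1)).sup' Finset.nonempty_range_add_one fun j => side V j a / side V j b

/-- The cross ratio of `a`, `b` and the endpoints of the chord through them, that is, the
exponential of twice their Hilbert distance. -/
noncomputable def crossRatio (m : ℕ) (V : ℕ → Plane) (a b : Plane) : ℝ :=
  expFunk m V a b * expFunk m V b a

section ExpFunk

variable (m : ℕ) (V : ℕ → Plane)

theorem exists_expFunk_eq (a b : Plane) : ∃ j, expFunk m V a b = side V j a / side V j b := by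
  obtain ⟨j, -, hj⟩ := Finset.exists_mem_eq_sup' (Finset.nonempty_range_add_one (n := m))
    fun j => side V j a / side V j b
  exact ⟨j, hj⟩

theorem continuous_expFunk_left (b : Plane) : Continuous fun a => expFunk m V a b :=
  Continuous.finset_sup'_apply _ fun j _ => (continuous_side V j).div_const _

theorem continuousOn_expFunk_right (a : Plane) :
    ContinuousOn (fun b => expFunk m V a b) (openBody V) :=
  ContinuousOn.finset_sup'_apply _ fun j _ =>
    continuousOn_const.div (continuous_side V j).continuousOn fun _ h => (h j).ne'

theorem continuousOn_crossRatio_left (b : Plane) :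
    ContinuousOn (fun a => crossRatio m V a b) (openBody V) :=
  (continuous_expFunk_left m V b).continuousOn.mul (continuousOn_expFunk_right m V b)

variable {m V}

theorem expFunk_self {a : Plane} (ha : a ∈ openBody V) : expFunk m V a a = 1 := by
  obtain ⟨j, hj⟩ := exists_expFunk_eq m V a a
  rw [hj, div_self (ha j).ne']

end ExpFunk

theorem eq_of_side_eq {V : ℕ → Plane} {j : ℕ}
    (hturn : orient (V j) (V (j + 1)) (V (j + 2)) ≠ 0) {a b : Plane}
    (hj : side V j a = side V j b) (hj' : side V (j + 1) a = side V (j + 1) b) : a = b := by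
  have h0 : orient (V j) (V (j + 1)) (V (j + 2)) * (b 0 - a 0) =
      (side V j b - side V j a) * (V (j + 2) 0 - V (j + 1) 0) -
        (side V (j + 1) b - side V (j + 1) a) * (V (j + 1) 0 - V j 0) := by
    simp only [orient, side]; ring
  have h1 : orient (V j) (V (j + 1)) (V (j + 2)) * (b 1 - a 1) =
      (side V j b - side V j a) * (V (j + 2) 1 - V (j + 1) 1) -
        (side V (j + 1) b - side V (j + 1) a) * (V (j + 1) 1 - V j 1) := by
    simp only [orient, side]; ring
  simp only [hj, hj', sub_self, zero_mul, mul_eq_zero, hturn, false_or, sub_eq_zero] at h0 h1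
  exact plane_ext h0.symm h1.symm

namespace CyclicPolygon

variable {m : ℕ} {V : ℕ → Plane} {a b : Plane}

theorem le_expFunk (hV : CyclicPolygon m V) (j : ℕ) (a b : Plane) :
    side V j a / side V j b ≤ expFunk m V a b := by
  rw [← hV.side_mod j a, ← hV.side_mod j b]
  exact Finset.le_sup' (fun j => side V j a / side V j b)
    (Finset.mem_range.2 ((Nat.mod_lt j hV.pos).trans m.lt_succ_self))

theorem side_le_expFunk_mul (hV : CyclicPolygon m V) (j : ℕ) (a : Plane) (hb : b ∈ openBody V) :
    side V j a ≤ expFunk m V a b * side V j b :=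
  (div_le_iff₀ (hb j)).1 (hV.le_expFunk j a b)

theorem expFunk_eq (hV : CyclicPolygon m V) {j : ℕ}
    (h : ∀ i, side V i a / side V i b ≤ side V j a / side V j b) :
    expFunk m V a b = side V j a / side V j b := by
  obtain ⟨i, hi⟩ := exists_expFunk_eq m V a b
  exact le_antisymm (hi ▸ h i) (hV.le_expFunk j a b)

theorem sum_side_eq (hV : CyclicPolygon m V) (a b : Plane) :
    ∑ j ∈ Finset.range m, side V j a = ∑ j ∈ Finset.range m, side V j b := by
  have hdiff (j : ℕ) : side V j a - side V j b =
      (V (j + 1) 0 - V j 0) * (a 1 - b 1) - (V (j + 1) 1 - V j 1) * (a 0 - b 0) := by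
    simp only [side, orient]; ring
  have hclosed : V m = V 0 := by simpa using hV.periodic 0
  rw [← sub_eq_zero, ← Finset.sum_sub_distrib]
  simp only [hdiff]
  rw [Finset.sum_sub_distrib, ← Finset.sum_mul, ← Finset.sum_mul,
    Finset.sum_range_sub (fun j => V j 0), Finset.sum_range_sub (fun j => V j 1), hclosed]
  ring

theorem eq_of_side_le (hV : CyclicPolygon m V) (h : ∀ j, side V j a ≤ side V j b) : a = b := by
  have heq := (Finset.sum_eq_sum_iff_of_le fun j _ => h j).1 (hV.sum_side_eq a b)
  have hm := hV.three_le
  exact eq_of_side_eq (hV.turn_pos 0).ne' (heq 0 (Finset.mem_range.2 (by omega)))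
    (heq 1 (Finset.mem_range.2 (by omega)))

theorem exists_side_pos (hV : CyclicPolygon m V) (a : Plane) : ∃ j, 0 < side V j a := by
  by_contra! h
  have hvertex (k : ℕ) : a = V k := hV.eq_of_side_le fun j => (h j).trans (hV.vertex_mem k j)
  have hturn := hV.turn_pos 0
  rw [zero_add, ← hvertex 0, ← hvertex 1, orient_self] at hturn
  exact hturn.false

theorem expFunk_pos (hV : CyclicPolygon m V) (a : Plane) (hb : b ∈ openBody V) :
    0 < expFunk m V a b := by
  obtain ⟨j, hj⟩ := hV.exists_side_pos a
  exact (div_pos hj (hb j)).trans_le (hV.le_expFunk j a b)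

theorem crossRatio_pos (hV : CyclicPolygon m V) (ha : a ∈ openBody V) (hb : b ∈ openBody V) :
    0 < crossRatio m V a b :=
  mul_pos (hV.expFunk_pos a hb) (hV.expFunk_pos b ha)

theorem side_pos_of_expFunk_eq (hV : CyclicPolygon m V) (hb : b ∈ openBody V) {j : ℕ}
    (h : expFunk m V a b = side V j a / side V j b) : 0 < side V j a :=
  (div_pos_iff_of_pos_right (hb j)).1 (h ▸ hV.expFunk_pos a hb)

theorem one_lt_expFunk (hV : CyclicPolygon m V) (hb : b ∈ openBody V) (hab : a ≠ b) :
    1 < expFunk m V a b := by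
  by_contra! h
  exact hab (hV.eq_of_side_le fun j =>
    (hV.side_le_expFunk_mul j a hb).trans (mul_le_of_le_one_left (hb j).le h))

theorem sSup_chord (hV : CyclicPolygon m V) (hb : b ∈ openBody V) (hab : a ≠ b) :
    sSup {t : ℝ | AffineMap.lineMap a b t ∈ body V} = expFunk m V a b / (expFunk m V a b - 1) := by
  have hF := hV.one_lt_expFunk hb hab
  have hle := fun i => hV.side_le_expFunk_mul i a hb
  obtain ⟨j, hj⟩ := exists_expFunk_eq m V a b
  rw [eq_div_iff (hb j).ne'] at hj
  generalize expFunk m V a b = F at *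
  have hF' : 0 < F - 1 := sub_pos.2 hF
  refine IsGreatest.csSup_eq ⟨fun i => ?_, fun t ht => ?_⟩
  · have : side V i (AffineMap.lineMap a b (F / (F - 1))) =
        (F * side V i b - side V i a) / (F - 1) := by
      rw [side_lineMap]; field_simp; ring
    rw [this]
    exact div_nonneg (sub_nonneg.2 (hle i)) hF'.le
  · have hjt := ht j
    rw [side_lineMap, ← hj, show (1 - t) * (F * side V j b) + t * side V j b =
      (F - t * (F - 1)) * side V j b by ring] at hjt
    exact (le_div_iff₀ hF').2 (sub_nonneg.1 (nonneg_of_mul_nonneg_left hjt (hb j)))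

theorem dist_chordEnd_div (hV : CyclicPolygon m V) (hb : b ∈ openBody V) (hab : a ≠ b) :
    dist a (chordEnd (body V) a b) / dist b (chordEnd (body V) a b) = expFunk m V a b := by
  have hF : 0 < expFunk m V a b - 1 := sub_pos.2 (hV.one_lt_expFunk hb hab)
  have hF' := hV.expFunk_pos a hb
  rw [chordEnd, hV.sSup_chord hb hab, dist_left_lineMap, dist_right_lineMap]
  generalize expFunk m V a b = F at *
  have hd : dist a b ≠ 0 := dist_ne_zero.2 hab
  rw [show 1 - F / (F - 1) = -(1 / (F - 1)) by field_simp; ring, norm_neg,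
    Real.norm_of_nonneg (by positivity), Real.norm_of_nonneg (by positivity)]
  field_simp

theorem hilbertDist_eq (hV : CyclicPolygon m V) (ha : a ∈ openBody V) (hb : b ∈ openBody V) :
    hilbertDist (body V) a b = 1 / 2 * Real.log (crossRatio m V a b) := by
  unfold hilbertDist crossRatio
  split_ifs with h
  · subst h
    simp [expFunk_self ha]
  · rw [hV.dist_chordEnd_div hb h, hV.dist_chordEnd_div ha (Ne.symm h), mul_comm (expFunk m V b a)]

theorem bisector_eq (hV : CyclicPolygon m V) {p q : Plane} (hp : p ∈ openBody V)
    (hq : q ∈ openBody V) : bisector (body V) p q =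
      {x | x ∈ openBody V ∧ crossRatio m V x p = crossRatio m V x q} := by
  ext x
  simp only [bisector, hV.interior_body, Set.mem_ofPred_eq]
  refine and_congr_right fun hx => ?_
  rw [hV.hilbertDist_eq hx hp, hV.hilbertDist_eq hx hq, mul_right_inj' (by norm_num)]
  exact Real.log_injOn_pos.eq_iff (hV.crossRatio_pos hx hp) (hV.crossRatio_pos hx hq)

end CyclicPolygon

/-! ### The bisector near the boundary -/

/-- On the side `i`, the sign of `d(x,p) - d(x,q)` as the interior point `x` tends to the boundary
point `z`: the chords end near `z` on the side `i`, whose distances are compared by the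
coefficients, and at the far end are compared by `expFunk`. -/
noncomputable def balance (m : ℕ) (V : ℕ → Plane) (p q : Plane) (i : ℕ) (z : Plane) : ℝ :=
  side V i p * expFunk m V z p - side V i q * expFunk m V z q

theorem balance_swap (m : ℕ) (V : ℕ → Plane) (p q : Plane) (i : ℕ) (z : Plane) :
    balance m V q p i z = -balance m V p q i z := (neg_sub _ _).symm

theorem continuous_balance (m : ℕ) (V : ℕ → Plane) (p q : Plane) (i : ℕ) :
    Continuous (balance m V p q i) :=
  ((continuous_expFunk_left m V p).const_mul _).sub ((continuous_expFunk_left m V q).const_mul _)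

theorem bisectorEnds_swap (K : Set Plane) (p q : Plane) :
    bisectorEnds K q p = bisectorEnds K p q := by
  simp only [bisectorEnds, bisector, eq_comm]

namespace CyclicPolygon

variable {m : ℕ} {V : ℕ → Plane} {p q z : Plane} {i : ℕ} {ε : ℝ}

theorem expFunk_lineMap_le (hV : CyclicPolygon m V) (hq : q ∈ openBody V) (hε1 : ε ≤ 1) :
    expFunk m V (AffineMap.lineMap z q ε) q ≤ (1 - ε) * expFunk m V z q + ε := by
  obtain ⟨k, hk⟩ := exists_expFunk_eq m V (AffineMap.lineMap z q ε) q
  rw [hk, div_le_iff₀ (hq k), side_lineMap]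
  have := mul_le_mul_of_nonneg_left (hV.side_le_expFunk_mul k z hq) (sub_nonneg.2 hε1)
  linarith

theorem expFunk_lineMap_right_le (hz : z ∈ body V) (hq : q ∈ openBody V) (hε0 : 0 < ε)
    (hε1 : ε ≤ 1) : expFunk m V q (AffineMap.lineMap z q ε) ≤ 1 / ε := by
  obtain ⟨k, hk⟩ := exists_expFunk_eq m V q (AffineMap.lineMap z q ε)
  rw [hk, div_le_div_iff₀ (lineMap_mem_openBody hz hq hε0 hε1 k) hε0, side_lineMap]
  have := mul_nonneg (sub_nonneg.2 hε1) (hz k)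
  linarith

theorem expFunk_mul_le_lineMap (hV : CyclicPolygon m V) (hp : p ∈ openBody V) (hq : q ∈ openBody V)
    (hε0 : 0 ≤ ε) : expFunk m V z p * ((1 - ε) * expFunk m V z q + ε) ≤
      expFunk m V z q * expFunk m V (AffineMap.lineMap z q ε) p := by
  obtain ⟨j, hj⟩ := exists_expFunk_eq m V z p
  refine le_trans ?_ (mul_le_mul_of_nonneg_left (hV.le_expFunk j _ p) (hV.expFunk_pos z hq).le)
  rw [hj, div_mul_eq_mul_div, ← mul_div_assoc, side_lineMap]
  refine div_le_div_of_nonneg_right ?_ (hp j).le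
  have := mul_le_mul_of_nonneg_left (hV.side_le_expFunk_mul j z hq) hε0
  linarith

theorem crossRatio_le_of_balance_nonneg (hV : CyclicPolygon m V) (hp : p ∈ openBody V)
    (hq : q ∈ openBody V) (hz : z ∈ body V) (hi : side V i z = 0) (hbal : 0 ≤ balance m V p q i z)
    (hε0 : 0 < ε) (hε1 : ε ≤ 1) :
    crossRatio m V (AffineMap.lineMap z q ε) q ≤ crossRatio m V (AffineMap.lineMap z q ε) p := by
  have hx := lineMap_mem_openBody hz hq hε0 hε1
  have hnear : side V i p / (ε * side V i q) ≤ expFunk m V p (AffineMap.lineMap z q ε) := by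
    simpa [side_lineMap, hi] using hV.le_expFunk i p (AffineMap.lineMap z q ε)
  have hfar := hV.expFunk_mul_le_lineMap (z := z) hp hq hε0.le
  have hFp := hV.expFunk_pos z hp
  have hFq := hV.expFunk_pos z hq
  have hpi := hp i
  have hqi := hq i
  have hA : 0 ≤ (1 - ε) * expFunk m V z q + ε :=
    add_nonneg (mul_nonneg (sub_nonneg.2 hε1) hFq.le) hε0.le
  calc crossRatio m V (AffineMap.lineMap z q ε) q
      ≤ ((1 - ε) * expFunk m V z q + ε) * (1 / ε) :=
        mul_le_mul (hV.expFunk_lineMap_le hq hε1) (expFunk_lineMap_right_le hz hq hε0 hε1)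
          (hV.expFunk_pos q hx).le hA
    _ ≤ ((1 - ε) * expFunk m V z q + ε) * (1 / ε) *
          (side V i p * expFunk m V z p / (side V i q * expFunk m V z q)) := by
        refine le_mul_of_one_le_right (by positivity) ((one_le_div (by positivity)).2 ?_)
        exact sub_nonneg.1 hbal
    _ = expFunk m V z p * ((1 - ε) * expFunk m V z q + ε) / expFunk m V z q *
          (side V i p / (ε * side V i q)) := by field_simp
    _ ≤ crossRatio m V (AffineMap.lineMap z q ε) p :=
        mul_le_mul ((div_le_iff₀' hFq).2 hfar) hnear (by positivity) (hV.expFunk_pos _ hp).le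

theorem mem_bisectorEnds (hV : CyclicPolygon m V) (hp : p ∈ openBody V) (hq : q ∈ openBody V)
    (hz : z ∈ body V) {j : ℕ} (hi : side V i z = 0) (hj : side V j z = 0)
    (hbali : 0 ≤ balance m V p q i z) (hbalj : balance m V p q j z ≤ 0) :
    z ∈ bisectorEnds (body V) p q := by
  refine ⟨Metric.mem_closure_iff.2 fun δ hδ => ?_, hV.frontier_body ▸ ⟨hz, i, hi⟩⟩
  have hclose (r : Plane) : ∀ᶠ ε in nhdsWithin (0 : ℝ) (Set.Ioi 0),
      (AffineMap.lineMap z r ε : Plane) ∈ Metric.ball z δ :=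
    ((AffineMap.lineMap_continuous.tendsto' 0 z (AffineMap.lineMap_apply_zero _ _)).mono_left
      nhdsWithin_le_nhds).eventually (Metric.ball_mem_nhds z hδ)
  obtain ⟨ε, ⟨hqδ, hpδ⟩, hε0, hε1⟩ :=
    (((hclose q).and (hclose p)).and (Ioc_mem_nhdsGT zero_lt_one)).exists
  -- On the convex set `openBody V ∩ ball z δ` the two cross ratios take both orders.
  obtain ⟨x, ⟨hx, hxδ⟩, hxeq⟩ :=
    ((convex_openBody V).inter (convex_ball z δ)).isPreconnected.intermediate_value₂
      ⟨lineMap_mem_openBody hz hp hε0 hε1, hpδ⟩ ⟨lineMap_mem_openBody hz hq hε0 hε1, hqδ⟩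
      ((continuousOn_crossRatio_left m V p).mono Set.inter_subset_left)
      ((continuousOn_crossRatio_left m V q).mono Set.inter_subset_left)
      (hV.crossRatio_le_of_balance_nonneg hq hp hz hj
        (by rw [balance_swap]; exact neg_nonneg.2 hbalj) hε0 hε1)
      (hV.crossRatio_le_of_balance_nonneg hp hq hz hi hbali hε0 hε1)
  exact ⟨x, hV.bisector_eq hp hq ▸ ⟨hx, hxeq⟩, dist_comm x z ▸ hxδ⟩

theorem crossRatio_lt_of_balance_pos (hV : CyclicPolygon m V) (hp : p ∈ openBody V) {x : Plane}
    (hx : x ∈ openBody V) {k : ℕ} (hk : expFunk m V q x = side V k q / side V k x)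
    (hbal : 0 < balance m V p q k x) : crossRatio m V x q < crossRatio m V x p := by
  calc crossRatio m V x q = side V k q * expFunk m V x q / side V k x := by
        rw [crossRatio, hk]; ring
    _ < side V k p * expFunk m V x p / side V k x :=
        div_lt_div_of_pos_right (sub_pos.1 hbal) (hx k)
    _ = expFunk m V x p * (side V k p / side V k x) := by ring
    _ ≤ crossRatio m V x p :=
        mul_le_mul_of_nonneg_left (hV.le_expFunk k p x) (hV.expFunk_pos x hp).le

theorem eventually_exists_expFunk_eq (hV : CyclicPolygon m V) (hq : q ∈ openBody V)
    (hz : z ∈ body V) (hi : side V i z = 0) : ∀ᶠ x in nhds z, x ∈ openBody V →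
      ∃ k ∈ Finset.range m, side V k z = 0 ∧ expFunk m V q x = side V k q / side V k x := by
  have hfar : ∀ᶠ x in nhds z, ∀ k ∈ Finset.range m, side V k z ≠ 0 →
      side V k q * side V i x < side V i q * side V k x := by
    refine (Filter.eventually_all_finset _).2 fun k _ => ?_
    rcases eq_or_ne (side V k z) 0 with hk | hk
    · exact Filter.Eventually.of_forall fun x h => absurd hk h
    · have hlt : side V k q * side V i z < side V i q * side V k z := by
        rw [hi, mul_zero]
        exact mul_pos (hq i) ((hz k).lt_of_ne' hk)
      filter_upwards [(isOpen_lt ((continuous_side V i).const_mul (side V k q))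
        ((continuous_side V k).const_mul (side V i q))).mem_nhds hlt] with x hx _ using hx
  filter_upwards [hfar] with x hx hxopen
  obtain ⟨k, hk⟩ := exists_expFunk_eq m V q x
  have hkmod : expFunk m V q x = side V (k % m) q / side V (k % m) x := by
    rw [hV.side_mod, hV.side_mod, hk]
  have hkm : k % m ∈ Finset.range m := Finset.mem_range.2 (Nat.mod_lt k hV.pos)
  refine ⟨k % m, hkm, by_contra fun hkz => ?_, hkmod⟩
  have hle := hV.le_expFunk i q x
  rw [hkmod, div_le_div_iff₀ (hxopen i) (hxopen _)] at hle
  exact (hx _ hkm hkz).not_ge hle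

theorem exists_balance_nonpos (hV : CyclicPolygon m V) (hp : p ∈ openBody V) (hq : q ∈ openBody V)
    (hz : z ∈ bisectorEnds (body V) p q) : ∃ i, side V i z = 0 ∧ balance m V p q i z ≤ 0 := by
  obtain ⟨hclosure, hfrontier⟩ := hz
  rw [hV.frontier_body] at hfrontier
  obtain ⟨hzbody, i, hi⟩ := hfrontier
  by_contra! hpos
  have hbal : ∀ᶠ x in nhds z, ∀ k ∈ Finset.range m, side V k z = 0 → 0 < balance m V p q k x := by
    refine (Filter.eventually_all_finset _).2 fun k _ => ?_
    by_cases hk : side V k z = 0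
    · filter_upwards [(continuous_balance m V p q k).continuousAt.eventually
        (lt_mem_nhds (hpos k hk))] with x hx _ using hx
    · exact Filter.Eventually.of_forall fun x h => absurd h hk
  obtain ⟨x, ⟨hxbal, hxnear⟩, hxbis⟩ := mem_closure_iff_nhds.1 hclosure _
    (hbal.and (hV.eventually_exists_expFunk_eq hq hzbody hi))
  rw [hV.bisector_eq hp hq] at hxbis
  obtain ⟨hxopen, hxeq⟩ := hxbis
  obtain ⟨k, hkm, hkz, hk⟩ := hxnear hxopen
  exact (hV.crossRatio_lt_of_balance_pos hp hxopen hk (hxbal k hkm hkz)).ne' hxeq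

theorem exists_balance_nonneg (hV : CyclicPolygon m V) (hp : p ∈ openBody V) (hq : q ∈ openBody V)
    (hz : z ∈ bisectorEnds (body V) p q) : ∃ i, side V i z = 0 ∧ 0 ≤ balance m V p q i z := by
  obtain ⟨i, hi, hbal⟩ := hV.exists_balance_nonpos hq hp (bisectorEnds_swap _ p q ▸ hz)
  rw [balance_swap, neg_nonpos] at hbal
  exact ⟨i, hi, hbal⟩

end CyclicPolygon

end HilbertPlane

namespace HilbertPlane

/-! ### The line through `p` and `q` -/

section Lines

variable {p q r z g : Plane}

theorem orient_mul_sub (p q a b z r g : Plane) :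
    orient z r g * (orient p q a - orient p q b) =
      orient a b z * (orient p q r - orient p q g) - orient p q z * (orient a b r - orient a b g)
        - orient p q r * orient a b g + orient a b r * orient p q g := by
  simp only [orient]; ring

theorem orient_mul_sub_of_line {V : ℕ → Plane} {i : ℕ} (hr : orient p q r = 0)
    (hig : side V i g = 0) (hg : orient p q g = 0) (z : Plane) :
    orient z r g * (orient p q (V (i + 1)) - orient p q (V i)) = orient p q z * side V i r := by
  have h := orient_mul_sub p q (V i) (V (i + 1)) z r g
  rw [← side, ← side, ← side, hr, hig, hg] at h
  linarith

theorem side_mul_orient_of_line {e : Plane} (hr : orient p q r = 0) (hze : orient z r e = 0)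
    (V : ℕ → Plane) (i : ℕ) :
    side V i e * orient p q z =
      orient p q e * side V i z + (orient p q z - orient p q e) * side V i r := by
  have h := orient_mul_sub p q (V i) (V (i + 1)) z r e
  rw [hze, hr] at h
  unfold side
  linarith

theorem side_sub_side (V : ℕ → Plane) (i : ℕ) (p q : Plane) :
    side V i p - side V i q = orient p q (V (i + 1)) - orient p q (V i) := by
  simp only [side, orient]; ring

theorem exists_lineMap_eq (hpq : p ≠ q) (hz : orient p q z = 0) :
    ∃ t : ℝ, z = AffineMap.lineMap p q t := by
  by_cases h0 : q 0 - p 0 = 0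
  · have h1 : q 1 - p 1 ≠ 0 := fun h1 => hpq (plane_ext (by linarith) (by linarith))
    refine ⟨(z 1 - p 1) / (q 1 - p 1), ?_⟩
    simp only [orient, h0, zero_mul, zero_sub, neg_eq_zero, mul_eq_zero, h1, false_or] at hz
    apply plane_ext <;> rw [lineMap_coord]
    · rw [h0]; linarith
    · field_simp; ring
  · refine ⟨(z 0 - p 0) / (q 0 - p 0), ?_⟩
    apply plane_ext <;> rw [lineMap_coord]
    · field_simp; ring
    · unfold orient at hz
      field_simp
      linarith

theorem exists_lineMap_orient_eq_zero {h : Plane} (hg : orient z r g ≤ 0)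
    (hh : 0 ≤ orient z r h) :
    ∃ t : ℝ, 0 ≤ t ∧ t ≤ 1 ∧ orient z r (AffineMap.lineMap g h t) = 0 := by
  obtain ⟨t, ⟨ht0, ht1⟩, ht⟩ : (0 : ℝ) ∈
      (fun t : ℝ => orient z r (AffineMap.lineMap g h t)) '' Set.Icc 0 1 := by
    refine intermediate_value_Icc zero_le_one ?_ ?_
    · exact ((continuous_orient z r).comp AffineMap.lineMap_continuous).continuousOn
    · simpa using ⟨hg, hh⟩
  exact ⟨t, ht0, ht1, ht⟩

end Lines

namespace CyclicPolygon

variable {m : ℕ} {V : ℕ → Plane} {p q : Plane}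

theorem balance_lineMap_pos (hV : CyclicPolygon m V) (hp : p ∈ openBody V) (hq : q ∈ openBody V)
    {t : ℝ} (ht : 1 < t) {i : ℕ} (hi : side V i (AffineMap.lineMap p q t) = 0) :
    0 < balance m V p q i (AffineMap.lineMap p q t) := by
  set z : Plane := AffineMap.lineMap p q t
  have hside (k : ℕ) : side V k z = (1 - t) * side V k p + t * side V k q := side_lineMap V k p q t
  obtain ⟨j, hj⟩ := exists_expFunk_eq m V z q
  have hratio : side V i q * side V j p < side V i p * side V j q := by
    have hjz := hV.side_pos_of_expFunk_eq hq hj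
    rw [hside] at hi hjz
    nlinarith [hp i, hq i, hp j, hq j]
  refine sub_pos.2 ?_
  calc side V i q * expFunk m V z q
      = side V i q * side V j p / side V j q * (side V j z / side V j p) := by
        have := (hp j).ne'
        rw [hj]; field_simp
    _ < side V i p * (side V j z / side V j p) := by
        refine mul_lt_mul_of_pos_right ((div_lt_iff₀ (hq j)).2 hratio) (div_pos ?_ (hp j))
        exact hV.side_pos_of_expFunk_eq hq hj
    _ ≤ side V i p * expFunk m V z p :=
        mul_le_mul_of_nonneg_left (hV.le_expFunk j z p) (hp i).le

theorem balance_pos_of_line (hV : CyclicPolygon m V) (hp : p ∈ openBody V) (hq : q ∈ openBody V)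
    (hpq : p ≠ q) {z : Plane} (hs : orient p q z = 0) {i : ℕ}
    (hi : side V i z = 0) (hlt : side V i q < side V i p) : 0 < balance m V p q i z := by
  obtain ⟨t, rfl⟩ := exists_lineMap_eq hpq hs
  refine hV.balance_lineMap_pos hp hq ?_ hi
  rw [side_lineMap] at hi
  by_contra! ht
  nlinarith [hq i]

theorem balance_neg_of_line (hV : CyclicPolygon m V) (hp : p ∈ openBody V) (hq : q ∈ openBody V)
    (hpq : p ≠ q) {z : Plane} (hs : orient p q z = 0) {i : ℕ}
    (hi : side V i z = 0) (hlt : side V i p < side V i q) : balance m V p q i z < 0 := by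
  have := hV.balance_pos_of_line hq hp hpq.symm (by rw [orient_swap, hs, neg_zero]) hi hlt
  rwa [balance_swap, neg_pos] at this

theorem balance_ne_zero_of_line (hV : CyclicPolygon m V) (hp : p ∈ openBody V)
    (hq : q ∈ openBody V) (hpq : p ≠ q) {z : Plane} (hs : orient p q z = 0)
    {i : ℕ} (hi : side V i z = 0) : balance m V p q i z ≠ 0 := by
  rcases lt_trichotomy (side V i p) (side V i q) with h | h | h
  · exact (hV.balance_neg_of_line hp hq hpq hs hi h).ne
  · obtain ⟨t, rfl⟩ := exists_lineMap_eq hpq hs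
    rw [side_lineMap, h, ← add_mul, sub_add_cancel, one_mul] at hi
    exact absurd hi (hq i).ne'
  · exact (hV.balance_pos_of_line hp hq hpq hs hi h).ne'

theorem orient_ne_zero_of_mem_bisectorEnds (hV : CyclicPolygon m V) (hp : p ∈ openBody V)
    (hq : q ∈ openBody V) (hpq : p ≠ q) {z : Plane} (hz : z ∈ bisectorEnds (body V) p q) :
    orient p q z ≠ 0 := by
  intro hs
  obtain ⟨i, hi, hTi⟩ := hV.exists_balance_nonpos hp hq hz
  obtain ⟨j, hj, hTj⟩ := hV.exists_balance_nonneg hp hq hz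
  obtain ⟨t, rfl⟩ := exists_lineMap_eq hpq hs
  rcases lt_or_ge 1 t with ht | ht
  · exact (hV.balance_lineMap_pos hp hq ht hi).not_ge hTi
  · have ht0 : t < 0 := by
      by_contra! ht0
      rw [side_lineMap] at hi
      rcases ht0.eq_or_lt with rfl | ht0
      · linarith [hp i]
      · nlinarith [mul_pos ht0 (hq i), mul_nonneg (sub_nonneg.2 ht) (hp i).le]
    rw [← AffineMap.lineMap_apply_one_sub] at hj hTj
    have := hV.balance_lineMap_pos hq hp (by linarith) hj
    rw [balance_swap] at this
    linarith

theorem orient_nonpos_of_not_alternating (hV : CyclicPolygon m V) (p q : Plane) {i j k l : ℕ}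
    (hij : i < j) (hjk : j < k) (hkl : k < l) (hl : l < i + m) (hi : orient p q (V i) ≤ 0)
    (hj : 0 < orient p q (V j)) (hk : orient p q (V k) ≤ 0) : orient p q (V l) ≤ 0 := by
  by_contra! hl'
  -- The diagonals `V i V k` and `V j V l` meet, in weights given by the four triangles.
  have hmeet : orient (V j) (V k) (V l) * orient p q (V i) + orient (V i) (V j) (V l) *
      orient p q (V k) = orient (V i) (V k) (V l) * orient p q (V j) +
      orient (V i) (V j) (V k) * orient p q (V l) := by
    simp only [orient]; ring
  have := mul_pos (hV.convex i k l (by omega) hkl (by omega)) hj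
  have := mul_pos (hV.convex i j k hij hjk (by omega)) hl'
  have := mul_nonpos_of_nonneg_of_nonpos (hV.convex j k l hjk hkl (by omega)).le hi
  have := mul_nonpos_of_nonneg_of_nonpos (hV.convex i j l hij (by omega) (by omega)).le hk
  linarith

end CyclicPolygon

/-- The directed line from `p` to `q` leaves the polygon through the side `f` and enters it through
the side `b`, so that the vertices `f + 1, …, b` are the ones strictly to its left. -/
structure Crossing (m : ℕ) (V : ℕ → Plane) (p q : Plane) (f b : ℕ) : Prop where
  lt : f < b
  lt_add : b < f + m
  start_nonpos : orient p q (V f) ≤ 0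
  start_pos : 0 < orient p q (V (f + 1))
  end_pos : 0 < orient p q (V b)
  end_nonpos : orient p q (V (b + 1)) ≤ 0

namespace Crossing

variable {m : ℕ} {V : ℕ → Plane} {p q r g z : Plane} {f b : ℕ}

theorem orient_entry_nonpos (hc : Crossing m V p q f b) (hr : r ∈ openBody V)
    (hsr : orient p q r = 0) (hg : side V b g = 0) (hsg : orient p q g = 0)
    (hz : 0 ≤ orient p q z) : orient z r g ≤ 0 := by
  have h := orient_mul_sub_of_line hsr hg hsg z
  by_contra! hpos
  nlinarith [mul_nonneg hz (hr b).le, hc.end_pos, hc.end_nonpos]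

theorem orient_exit_nonneg (hc : Crossing m V p q f b) (hr : r ∈ openBody V)
    (hsr : orient p q r = 0) (hg : side V f g = 0) (hsg : orient p q g = 0)
    (hz : 0 ≤ orient p q z) : 0 ≤ orient z r g := by
  have h := orient_mul_sub_of_line hsr hg hsg z
  by_contra! hneg
  nlinarith [mul_nonneg hz (hr f).le, hc.start_pos, hc.start_nonpos]

end Crossing

namespace CyclicPolygon

variable {m : ℕ} {V : ℕ → Plane} {p q r z : Plane} {f b : ℕ}

theorem left_vertex (hV : CyclicPolygon m V) (hc : Crossing m V p q f b) {j : ℕ} (h1 : f < j)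
    (h2 : j ≤ b) : 0 < orient p q (V j) := by
  by_contra! hj
  have hsucc : f + 1 ≠ j := fun h => hj.not_gt (h ▸ hc.start_pos)
  have hb : j ≠ b := fun h => hj.not_gt (h ▸ hc.end_pos)
  exact hc.end_pos.not_ge (hV.orient_nonpos_of_not_alternating p q (j := f + 1) (k := j)
    f.lt_succ_self (by omega) (by omega) hc.lt_add hc.start_nonpos hc.start_pos hj)

theorem right_vertex (hV : CyclicPolygon m V) (hc : Crossing m V p q f b) {j : ℕ} (h1 : b < j)
    (h2 : j ≤ f + m) : orient p q (V j) ≤ 0 := by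
  by_contra! hj
  have hf : orient p q (V (f + m)) ≤ 0 := hV.periodic f ▸ hc.start_nonpos
  have hb : 0 < orient p q (V (b + m)) := hV.periodic b ▸ hc.end_pos
  have hsucc : b + 1 ≠ j := fun h => hj.not_ge (h ▸ hc.end_nonpos)
  have hfm : j ≠ f + m := fun h => hj.not_ge (h ▸ hf)
  have hfb := hc.lt
  exact hb.not_ge (hV.orient_nonpos_of_not_alternating p q (i := b + 1) (j := j) (k := f + m)
    (by omega) (by omega) (by omega) (by omega) hc.end_nonpos hj hf)

theorem exists_crossing_point (hV : CyclicPolygon m V) {i : ℕ}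
    (h : orient p q (V i) * orient p q (V (i + 1)) ≤ 0) :
    ∃ g ∈ body V, side V i g = 0 ∧ orient p q g = 0 := by
  rcases mul_nonpos_iff.1 h with ⟨hi, hi'⟩ | ⟨hi, hi'⟩
  · obtain ⟨t, ht0, ht1, ht⟩ := exists_lineMap_orient_eq_zero hi' hi
    exact ⟨_, lineMap_mem_body (hV.vertex_mem _) (hV.vertex_mem _) ht0 ht1,
      by simp [side_lineMap], ht⟩
  · obtain ⟨t, ht0, ht1, ht⟩ := exists_lineMap_orient_eq_zero hi hi'
    exact ⟨_, lineMap_mem_body (hV.vertex_mem _) (hV.vertex_mem _) ht0 ht1,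
      by simp [side_lineMap], ht⟩

theorem exists_entry_point (hV : CyclicPolygon m V) (hc : Crossing m V p q f b) :
    ∃ g ∈ body V, side V b g = 0 ∧ orient p q g = 0 :=
  hV.exists_crossing_point (mul_nonpos_of_nonneg_of_nonpos hc.end_pos.le hc.end_nonpos)

theorem exists_exit_point (hV : CyclicPolygon m V) (hc : Crossing m V p q f b) :
    ∃ g ∈ body V, side V f g = 0 ∧ orient p q g = 0 :=
  hV.exists_crossing_point (mul_nonpos_of_nonpos_of_nonneg hc.start_nonpos hc.start_pos.le)

theorem expFunk_eq_of_mem_ray (hV : CyclicPolygon m V) (hr : r ∈ openBody V)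
    (hsr : orient p q r = 0) (hz : 0 < orient p q z) {e : Plane} (he : e ∈ body V) {j : ℕ}
    (hje : side V j e = 0) (hse : orient p q e ≤ 0) (hze : orient z r e = 0) :
    expFunk m V z r = side V j z / side V j r := by
  have hside := side_mul_orient_of_line hsr hze V
  have hj := hside j
  rw [hje, zero_mul] at hj
  have hneg : orient p q e < 0 := hse.lt_of_ne fun h0 => by
    rw [h0] at hj
    nlinarith [hr j]
  refine hV.expFunk_eq fun i => ?_
  rw [div_le_div_iff₀ (hr i) (hr j)]
  have hi : -orient p q e * side V i z ≤ (orient p q z - orient p q e) * side V i r := by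
    linarith [hside i, mul_nonneg (he i) hz.le]
  refine le_of_mul_le_mul_left ?_ (neg_pos.2 hneg)
  calc -orient p q e * (side V i z * side V j r)
      = -orient p q e * side V i z * side V j r := by ring
    _ ≤ (orient p q z - orient p q e) * side V i r * side V j r :=
        mul_le_mul_of_nonneg_right hi (hr j).le
    _ = -orient p q e * (side V j z * side V i r) := by linear_combination -side V i r * hj

theorem expFunk_eq_of_exit (hV : CyclicPolygon m V) (hr : r ∈ openBody V)
    (hsr : orient p q r = 0) {g h : Plane} (hz : 0 < orient p q z) (hg : g ∈ body V)
    (hh : h ∈ body V) {j : ℕ} (hjg : side V j g = 0) (hjh : side V j h = 0)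
    (hsg : orient p q g ≤ 0) (hsh : orient p q h ≤ 0) (hog : orient z r g ≤ 0)
    (hoh : 0 ≤ orient z r h) : expFunk m V z r = side V j z / side V j r := by
  obtain ⟨t, ht0, ht1, ht⟩ := exists_lineMap_orient_eq_zero hog hoh
  refine hV.expFunk_eq_of_mem_ray hr hsr hz (lineMap_mem_body hg hh ht0 ht1) ?_ ?_ ht
  · rw [side_lineMap, hjg, hjh, mul_zero, mul_zero, add_zero]
  · rw [orient_lineMap]
    nlinarith

theorem exists_exit (hV : CyclicPolygon m V) (hc : Crossing m V p q f b) (hr : r ∈ openBody V)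
    (hsr : orient p q r = 0) (hz : 0 < orient p q z) :
    ∃ j, b ≤ j ∧ j ≤ f + m ∧ expFunk m V z r = side V j z / side V j r := by
  obtain ⟨g, hg, hbg, hsg⟩ := hV.exists_entry_point hc
  obtain ⟨h, hh, hfh, hsh⟩ := hV.exists_exit_point hc
  let P (j : ℕ) : Prop := ∃ g ∈ body V, side V j g = 0 ∧ orient p q g ≤ 0 ∧ orient z r g ≤ 0
  have hPb : P b := ⟨g, hg, hbg, hsg.le, hc.orient_entry_nonpos hr hsr hbg hsg hz.le⟩
  by_cases hP : P (f + m)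
  · obtain ⟨g', hg', hfg', hsg', hog'⟩ := hP
    exact ⟨f + m, hc.lt_add.le, le_rfl,
      hV.expFunk_eq_of_exit hr hsr hz hg' hh hfg' (hV.side_add f h ▸ hfh) hsg' hsh.le hog'
        (hc.orient_exit_nonneg hr hsr hfh hsh hz.le)⟩
  · obtain ⟨j, hbj, hjf, ⟨g', hg', hjg', hsg', hog'⟩, hsucc⟩ :=
      exists_and_not_succ hc.lt_add.le hPb hP
    have hs : orient p q (V (j + 1)) ≤ 0 := hV.right_vertex hc (by omega) (by omega)
    refine ⟨j, hbj, hjf.le, hV.expFunk_eq_of_exit hr hsr hz hg' (hV.vertex_mem (j + 1)) hjg'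
      (side_right V j) hsg' hs hog' ?_⟩
    by_contra! hneg
    exact hsucc ⟨V (j + 1), hV.vertex_mem _, side_left V _, hs, hneg.le⟩

end CyclicPolygon

end HilbertPlane

namespace HilbertPlane

/-! ### Uniqueness of the limit point on the left -/

/-- The left part of the boundary, from the entry side `f` to the exit side `b`, is parametrized by
the real position `i + t`: the point `z` lies on the side `i` and divides it in the ratio
`t : 1 - t`. -/
structure LeftPosition (V : ℕ → Plane) (f b : ℕ) (z : Plane) (i : ℕ) (t : ℝ) : Prop where
  le_index : f ≤ i
  index_le : i ≤ b
  nonneg : 0 ≤ t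
  le_one : t ≤ 1
  eq_lineMap : z = AffineMap.lineMap (V i) (V (i + 1)) t

namespace CyclicPolygon

variable {m : ℕ} {V : ℕ → Plane} {p q x y z : Plane} {f b : ℕ}

theorem side_ratio_strictAnti (hV : CyclicPolygon m V) (hc : Crossing m V p q f b)
    (hq : q ∈ openBody V) {i j : ℕ} (hi : f ≤ i) (hij : i < j) (hj : j ≤ b) :
    side V j p / side V j q < side V i p / side V i q := by
  have hstep {k : ℕ} (hfk : f ≤ k) (hkb : k < b) :
      side V (k + 1) p / side V (k + 1) q < side V k p / side V k q := by
    rw [div_lt_div_iff₀ (hq _) (hq _)]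
    have hdet := side_mul_side_sub V k p q
    rw [← orient_rotate (V (k + 1)) p q] at hdet
    linarith [mul_pos (hV.turn_pos k) (hV.left_vertex hc (j := k + 1) (by omega) hkb)]
  induction j, hij using Nat.le_induction with
  | base => exact hstep hi (by omega)
  | succ n hn ih => exact (hstep (by omega) (by omega)).trans (ih (by omega))

theorem side_ratio_mono (hV : CyclicPolygon m V) (hc : Crossing m V p q f b)
    (hq : q ∈ openBody V) {i j : ℕ} (hi : b ≤ i) (hij : i ≤ j) (hj : j ≤ f + m) :
    side V i p / side V i q ≤ side V j p / side V j q := by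
  induction j, hij using Nat.le_induction with
  | base => exact le_rfl
  | succ n hn ih =>
    refine (ih (by omega)).trans ?_
    rw [div_le_div_iff₀ (hq _) (hq _)]
    have hdet := side_mul_side_sub V n p q
    rw [← orient_rotate (V (n + 1)) p q] at hdet
    linarith [mul_nonpos_of_nonneg_of_nonpos (hV.turn_pos n).le
      (hV.right_vertex hc (j := n + 1) (by omega) hj)]

theorem side_mul_side_succ_le (hV : CyclicPolygon m V) {j : ℕ}
    (h : 0 ≤ orient (V (j + 1)) x y) :
    side V j y * side V (j + 1) x ≤ side V j x * side V (j + 1) y := by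
  linarith [side_mul_side_sub V j x y, mul_nonneg (hV.turn_pos j).le h]

theorem side_mul_side_succ_lt (hV : CyclicPolygon m V) {j : ℕ}
    (h : 0 < orient (V (j + 1)) x y) :
    side V j y * side V (j + 1) x < side V j x * side V (j + 1) y := by
  linarith [side_mul_side_sub V j x y, mul_pos (hV.turn_pos j) h]

theorem side_mul_side_le (hV : CyclicPolygon m V) (hx : x ∈ body V) {j k : ℕ} (hjk : j < k)
    (hpos : ∀ t, j < t → t < k → 0 < side V t x)
    (h : ∀ c, j < c → c ≤ k → 0 ≤ orient (V c) x y) :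
    side V j y * side V k x ≤ side V j x * side V k y := by
  induction k, hjk using Nat.le_induction with
  | base => exact hV.side_mul_side_succ_le (h _ j.lt_succ_self le_rfl)
  | succ k hk ih =>
    have hjk := ih (fun t h1 h2 => hpos t h1 (by omega)) fun c h1 h2 => h c h1 (by omega)
    have hsucc := hV.side_mul_side_succ_le (h (k + 1) (by omega) le_rfl)
    refine le_of_mul_le_mul_left ?_ (hpos k (by omega) (by omega))
    calc side V k x * (side V j y * side V (k + 1) x)
        = side V j y * side V k x * side V (k + 1) x := by ring
      _ ≤ side V j x * side V k y * side V (k + 1) x :=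
        mul_le_mul_of_nonneg_right hjk (hx (k + 1))
      _ = side V j x * (side V k y * side V (k + 1) x) := by ring
      _ ≤ side V j x * (side V k x * side V (k + 1) y) := mul_le_mul_of_nonneg_left hsucc (hx j)
      _ = side V k x * (side V j x * side V (k + 1) y) := by ring

theorem side_mul_side_lt (hV : CyclicPolygon m V) (hx : x ∈ body V) {j k : ℕ} (hjk : j < k)
    (hpos : ∀ t, j < t → t ≤ k → 0 < side V t x) (hlt : 0 < orient (V (j + 1)) x y)
    (h : ∀ c, j + 1 < c → c ≤ k → 0 ≤ orient (V c) x y) :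
    side V j y * side V k x < side V j x * side V k y := by
  have hsucc := hV.side_mul_side_succ_lt hlt
  rcases (Nat.succ_le_of_lt hjk).eq_or_lt with rfl | hjk'
  · exact hsucc
  have hle := hV.side_mul_side_le hx hjk' (fun t h1 h2 => hpos t (by omega) h2.le)
    (fun c h1 h2 => h c h1 h2)
  refine lt_of_mul_lt_mul_left ?_ (hx (j + 1))
  calc side V (j + 1) x * (side V j y * side V k x)
      = side V j y * side V (j + 1) x * side V k x := by ring
    _ < side V j x * side V (j + 1) y * side V k x :=
      mul_lt_mul_of_pos_right hsucc (hpos k hjk le_rfl)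
    _ = side V j x * (side V (j + 1) y * side V k x) := by ring
    _ ≤ side V j x * (side V (j + 1) x * side V k y) := mul_le_mul_of_nonneg_left hle (hx j)
    _ = side V (j + 1) x * (side V j x * side V k y) := by ring

theorem exists_lineMap_of_side (hV : CyclicPolygon m V) (hz : z ∈ body V) {i : ℕ}
    (hi : side V i z = 0) :
    ∃ t : ℝ, 0 ≤ t ∧ t ≤ 1 ∧ z = AffineMap.lineMap (V i) (V (i + 1)) t := by
  have hm := hV.three_le
  have hD : 0 < side V (i + 1) (V i) := by
    rw [side, orient_rotate]
    exact hV.turn_pos i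
  have heq : z = AffineMap.lineMap (V i) (V (i + 1))
      (1 - side V (i + 1) z / side V (i + 1) (V i)) := by
    refine eq_of_side_eq (hV.turn_pos i).ne' ?_ ?_
    · rw [hi, side_lineMap, side_left, side_right, mul_zero, mul_zero, add_zero]
    · rw [side_lineMap, side_left]
      field_simp
      ring
  refine ⟨_, ?_, sub_le_self _ (div_nonneg (hz (i + 1)) hD.le), heq⟩
  -- The side before the side `i` meets its line in `V i` only.
  have hnext : V (i + m - 1 + 1) = V i := by
    rw [Nat.sub_add_cancel (by omega), hV.periodic i]
  have hz' := hz (i + m - 1)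
  have hi0 : side V (i + m - 1) (V i) = 0 := hnext ▸ side_right V (i + m - 1)
  have hi1 : 0 < side V (i + m - 1) (V (i + 1)) := by
    rw [← hV.periodic (i + 1)]
    exact hV.side_vertex_pos (by omega) (by omega)
  rw [heq, side_lineMap, hi0, mul_zero, zero_add] at hz'
  exact nonneg_of_mul_nonneg_left hz' hi1

theorem orient_lineMap_nonpos_of_right (hV : CyclicPolygon m V) (hc : Crossing m V p q f b)
    {i : ℕ} (h1 : b < i) (h2 : i < f + m) {t : ℝ} (ht0 : 0 ≤ t) (ht1 : t ≤ 1) :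
    orient p q (AffineMap.lineMap (V i) (V (i + 1)) t) ≤ 0 := by
  rw [orient_lineMap]
  exact add_nonpos
    (mul_nonpos_of_nonneg_of_nonpos (sub_nonneg.2 ht1) (hV.right_vertex hc h1 h2.le))
    (mul_nonpos_of_nonneg_of_nonpos ht0 (hV.right_vertex hc (by omega) h2))

theorem exists_leftPosition (hV : CyclicPolygon m V) (hc : Crossing m V p q f b) (hz : z ∈ body V)
    (hs : 0 < orient p q z) {i : ℕ} (hi : side V i z = 0) :
    ∃ j t, LeftPosition V f b z j t ∧ j % m = i % m := by
  obtain ⟨j, hfj, hjm, hmod⟩ := exists_mod_eq_of_pos hV.pos f i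
  obtain ⟨t, ht0, ht1, rfl⟩ := hV.exists_lineMap_of_side hz (i := j) (hV.side_congr hmod z ▸ hi)
  refine ⟨j, t, ⟨hfj, ?_, ht0, ht1, rfl⟩, hmod⟩
  by_contra! hbj
  exact hs.not_ge (hV.orient_lineMap_nonpos_of_right hc hbj hjm ht0 ht1)

theorem side_pos_of_right (hV : CyclicPolygon m V) (hc : Crossing m V p q f b) (hz : z ∈ body V)
    (hs : 0 < orient p q z) {i : ℕ} (h1 : b < i) (h2 : i < f + m) : 0 < side V i z := by
  refine (hz i).lt_of_ne' fun hi => ?_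
  obtain ⟨t, ht0, ht1, rfl⟩ := hV.exists_lineMap_of_side hz hi
  exact hs.not_ge (hV.orient_lineMap_nonpos_of_right hc h1 h2 ht0 ht1)

end CyclicPolygon

theorem orient_of_same_side (V : ℕ → Plane) (i : ℕ) (u : Plane) (s t : ℝ) :
    orient u (AffineMap.lineMap (V i) (V (i + 1)) s) (AffineMap.lineMap (V i) (V (i + 1)) t) =
      (t - s) * side V i u := by
  simp only [side, orient, lineMap_coord]; ring

theorem orient_lineMap_lineMap_nonneg {u a a' c c' : Plane} {s t : ℝ} (hs0 : 0 ≤ s) (hs1 : s ≤ 1)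
    (ht0 : 0 ≤ t) (ht1 : t ≤ 1) (hac : 0 ≤ orient u a c) (hac' : 0 ≤ orient u a c')
    (ha'c : 0 ≤ orient u a' c) (ha'c' : 0 ≤ orient u a' c') :
    0 ≤ orient u (AffineMap.lineMap a a' s) (AffineMap.lineMap c c' t) := by
  have h (w : Plane) (h0 : 0 ≤ orient u a w) (h1 : 0 ≤ orient u a' w) :
      0 ≤ orient u (AffineMap.lineMap a a' s) w := by
    rw [← orient_rotate, orient_lineMap_left, orient_rotate u a w, orient_rotate u a' w]
    exact add_nonneg (mul_nonneg (sub_nonneg.2 hs1) h0) (mul_nonneg hs0 h1)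
  rw [orient_lineMap]
  exact add_nonneg (mul_nonneg (sub_nonneg.2 ht1) (h c hac ha'c)) (mul_nonneg ht0 (h c' hac' ha'c'))

namespace CyclicPolygon

variable {m : ℕ} {V : ℕ → Plane} {p q x y z : Plane} {f b i j : ℕ} {s t : ℝ}

theorem orient_boundary_nonneg (hV : CyclicPolygon m V) {c : ℕ} (hs0 : 0 ≤ s) (hs1 : s ≤ 1)
    (ht0 : 0 ≤ t) (ht1 : t ≤ 1) (hij : i ≤ j) (hst : i = j → s ≤ t) (hj : j < c) (hc : c ≤ i + m) :
    0 ≤ orient (V c) (AffineMap.lineMap (V i) (V (i + 1)) s)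
      (AffineMap.lineMap (V j) (V (j + 1)) t) := by
  rcases hij.eq_or_lt with rfl | hij
  · rw [orient_of_same_side]
    exact mul_nonneg (sub_nonneg.2 (hst rfl)) (hV.vertex_mem c i)
  · apply orient_lineMap_lineMap_nonneg hs0 hs1 ht0 ht1 <;> rw [← orient_rotate] <;>
      exact hV.orient_nonneg (by omega) (by omega) (by omega)

theorem mul_expFunk_le_of_balance (hV : CyclicPolygon m V) (hq : q ∈ openBody V)
    (hx : balance m V p q i x ≤ 0) (hy : 0 ≤ balance m V p q j y) :
    side V i p * side V j q * (expFunk m V x p * expFunk m V y q) ≤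
      side V j p * side V i q * (expFunk m V y p * expFunk m V x q) := by
  have hFx := hV.expFunk_pos x hq
  have hFy := hV.expFunk_pos y hq
  have hqi := hq i
  have hqj := hq j
  calc side V i p * side V j q * (expFunk m V x p * expFunk m V y q)
      = side V i p * expFunk m V x p * (side V j q * expFunk m V y q) := by ring
    _ ≤ side V i q * expFunk m V x q * (side V j p * expFunk m V y p) :=
      mul_le_mul (sub_nonpos.1 hx) (sub_nonneg.1 hy) (by positivity) (by positivity)
    _ = side V j p * side V i q * (expFunk m V y p * expFunk m V x q) := by ring

theorem side_ratio_le_of_balance_nonpos (hV : CyclicPolygon m V) (hp : p ∈ openBody V)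
    (hq : q ∈ openBody V) {l : ℕ} (hl : expFunk m V x q = side V l x / side V l q)
    (hx : balance m V p q i x ≤ 0) : side V i p / side V i q ≤ side V l p / side V l q := by
  have hF := hV.expFunk_pos x hp
  have hFl : expFunk m V x q * side V l q ≤ expFunk m V x p * side V l p := by
    rw [hl, div_mul_cancel₀ _ (hq l).ne']
    exact hV.side_le_expFunk_mul l x hp
  rw [div_le_div_iff₀ (hq i) (hq l)]
  refine le_of_mul_le_mul_right ?_ hF
  calc side V i p * side V l q * expFunk m V x p
      = side V i p * expFunk m V x p * side V l q := by ring
    _ ≤ side V i q * expFunk m V x q * side V l q :=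
      mul_le_mul_of_nonneg_right (sub_nonpos.1 hx) (hq l).le
    _ = side V i q * (expFunk m V x q * side V l q) := by ring
    _ ≤ side V i q * (expFunk m V x p * side V l p) := mul_le_mul_of_nonneg_left hFl (hq i).le
    _ = side V l p * side V i q * expFunk m V x p := by ring

theorem div_mul_div_le_expFunk_mul (hV : CyclicPolygon m V) (hp : p ∈ openBody V)
    (hq : q ∈ openBody V) (hy : y ∈ body V) (k l : ℕ) :
    side V k x / side V k p * (side V l y / side V l q) ≤ expFunk m V x p * expFunk m V y q :=
  mul_le_mul (hV.le_expFunk k x p) (hV.le_expFunk l y q) (div_nonneg (hy l) (hq l).le)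
    (hV.expFunk_pos x hp).le

theorem expFunk_mul_le (hV : CyclicPolygon m V) (hc : Crossing m V p q f b) (hp : p ∈ openBody V)
    (hq : q ∈ openBody V) (hx : x ∈ body V) (hy : y ∈ body V) (hsx : 0 < orient p q x)
    (hsy : 0 < orient p q y) (hxy : ∀ c, b < c → c ≤ f + m → 0 ≤ orient (V c) x y) :
    expFunk m V y p * expFunk m V x q ≤ expFunk m V x p * expFunk m V y q := by
  obtain ⟨k, hbk, hkf, hk⟩ := hV.exists_exit hc hp (orient_self_left p q) hsy
  obtain ⟨l, hbl, hlf, hl⟩ := hV.exists_exit hc hq (orient_self_right p q) hsx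
  have hpk := hp k
  have hql := hq l
  rcases lt_or_ge k l with hkl | hlk
  · refine le_trans ?_ (hV.div_mul_div_le_expFunk_mul hp hq hy k l)
    rw [hk, hl, div_mul_div_comm, div_mul_div_comm]
    exact div_le_div_of_nonneg_right (hV.side_mul_side_le hx hkl
      (fun c _ _ => hV.side_pos_of_right hc hx hsx (by omega) (by omega))
      (fun c _ _ => hxy c (by omega) (by omega))) (mul_pos hpk hql).le
  · refine le_trans ?_ (hV.div_mul_div_le_expFunk_mul hp hq hy l k)
    have hratio := hV.side_ratio_mono (p := p) hc hq hbl hlk hkf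
    rw [div_le_div_iff₀ hql (hq k)] at hratio
    rw [hk, hl, div_mul_div_comm, div_mul_div_comm, mul_comm (side V k y), mul_comm (side V k p)]
    refine div_le_div_of_nonneg_left (mul_nonneg (hx l) (hy k)) (mul_pos (hp l) (hq k)) ?_
    linarith

theorem expFunk_mul_lt_of_same_side (hV : CyclicPolygon m V) (hp : p ∈ openBody V)
    (hq : q ∈ openBody V) {k l : ℕ} (hk : expFunk m V y p = side V k y / side V k p)
    (hl : expFunk m V x q = side V l x / side V l q) (hkl : k < l) (hx : x ∈ body V)
    (hy : y ∈ body V) (hpos : ∀ t, k < t → t ≤ l → 0 < side V t x)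
    (hlt : 0 < orient (V (k + 1)) x y)
    (hxy : ∀ c, k + 1 < c → c ≤ l → 0 ≤ orient (V c) x y) :
    expFunk m V y p * expFunk m V x q < expFunk m V x p * expFunk m V y q := by
  refine lt_of_lt_of_le ?_ (hV.div_mul_div_le_expFunk_mul hp hq hy k l)
  rw [hk, hl, div_mul_div_comm, div_mul_div_comm]
  exact div_lt_div_of_pos_right (hV.side_mul_side_lt hx hkl hpos hlt hxy)
    (mul_pos (hp k) (hq l))

theorem balance_neg_of_side_lt (hV : CyclicPolygon m V) (hc : Crossing m V p q f b)
    (hp : p ∈ openBody V) (hq : q ∈ openBody V) (hx : x ∈ body V) (hy : y ∈ body V)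
    (hsx : 0 < orient p q x) (hsy : 0 < orient p q y)
    (hxy : ∀ c, b < c → c ≤ f + m → 0 ≤ orient (V c) x y) (hfi : f ≤ i) (hij : i < j)
    (hjb : j ≤ b) (hbal : balance m V p q i x ≤ 0) : balance m V p q j y < 0 := by
  by_contra! hbal'
  have hle := hV.mul_expFunk_le_of_balance hq hbal hbal'
  have hratio := hV.side_ratio_strictAnti hc hq hfi hij hjb
  rw [div_lt_div_iff₀ (hq j) (hq i)] at hratio
  have hF := mul_pos (hV.expFunk_pos y hp) (hV.expFunk_pos x hq)
  have := mul_lt_mul_of_pos_right hratio hF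
  have := mul_le_mul_of_nonneg_left (hV.expFunk_mul_le hc hp hq hx hy hsx hsy hxy)
    (mul_pos (hp i) (hq j)).le
  linarith

theorem balance_neg_of_same_side (hV : CyclicPolygon m V) (hc : Crossing m V p q f b)
    (hp : p ∈ openBody V) (hq : q ∈ openBody V)
    (hinj : ∀ i j, side V i p * side V j q = side V j p * side V i q → i % m = j % m)
    (hx : AffineMap.lineMap (V i) (V (i + 1)) s ∈ body V)
    (hy : AffineMap.lineMap (V i) (V (i + 1)) t ∈ body V)
    (hsx : 0 < orient p q (AffineMap.lineMap (V i) (V (i + 1)) s))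
    (hsy : 0 < orient p q (AffineMap.lineMap (V i) (V (i + 1)) t)) (hfi : f ≤ i) (hib : i ≤ b)
    (hst : s < t) (hbal : balance m V p q i (AffineMap.lineMap (V i) (V (i + 1)) s) ≤ 0) :
    balance m V p q i (AffineMap.lineMap (V i) (V (i + 1)) t) < 0 := by
  set x : Plane := AffineMap.lineMap (V i) (V (i + 1)) s
  set y : Plane := AffineMap.lineMap (V i) (V (i + 1)) t
  have hix : side V i x = 0 := by rw [side_lineMap, side_left, side_right]; ring
  have hiy : side V i y = 0 := by rw [side_lineMap, side_left, side_right]; ring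
  by_contra! hbal'
  obtain ⟨k, hbk, hkf, hk⟩ := hV.exists_exit hc hp (orient_self_left p q) hsy
  obtain ⟨l, hbl, hlf, hl⟩ := hV.exists_exit hc hq (orient_self_right p q) hsx
  have hky := hV.side_pos_of_expFunk_eq hp hk
  have hlx := hV.side_pos_of_expFunk_eq hq hl
  have hik : i ≠ k := by rintro rfl; exact hky.ne' hiy
  have hil : l ≠ i + m := by rintro rfl; exact hlx.ne' ((hV.side_add i x).trans hix)
  have hxy (c : ℕ) : orient (V c) x y = (t - s) * side V i (V c) := orient_of_same_side ..
  rcases lt_or_ge k l with hkl | hlk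
  · have hlt : expFunk m V y p * expFunk m V x q < expFunk m V x p * expFunk m V y q := by
      refine hV.expFunk_mul_lt_of_same_side hp hq hk hl hkl hx hy (fun c hkc hcl => ?_) ?_ ?_
      · rcases hcl.eq_or_lt with rfl | hcl
        · exact hlx
        · exact hV.side_pos_of_right hc hx hsx (by omega) (by omega)
      · rw [hxy]
        exact mul_pos (sub_pos.2 hst) (hV.side_vertex_pos (by omega) (by omega))
      · intro c _ _
        rw [hxy]
        exact mul_nonneg (sub_pos.2 hst).le (hV.vertex_mem c i)
    have := hV.mul_expFunk_le_of_balance hq hbal hbal'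
    linarith [mul_lt_mul_of_pos_left hlt (mul_pos (hp i) (hq i))]
  · -- The ratios of the distances of `p` and `q` to the sides `i`, `l` and `k` then agree.
    have hil := hV.side_ratio_le_of_balance_nonpos hp hq hl hbal
    have hlk := hV.side_ratio_mono (p := p) hc hq hbl hlk hkf
    have hki := hV.side_ratio_le_of_balance_nonpos hq hp hk (i := i) (by
      rw [balance_swap]; linarith)
    rw [div_le_div_iff₀ (hp i) (hp k), mul_comm, mul_comm (side V k q),
      ← div_le_div_iff₀ (hq k) (hq i)] at hki
    have heq := le_antisymm hil (hlk.trans hki)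
    rw [div_eq_div_iff (hq i).ne' (hq l).ne'] at heq
    exact hlx.ne' (hV.side_congr (hinj i l heq) x ▸ hix)

theorem balance_neg_of_balance_nonpos (hV : CyclicPolygon m V) (hc : Crossing m V p q f b)
    (hp : p ∈ openBody V) (hq : q ∈ openBody V)
    (hinj : ∀ i j, side V i p * side V j q = side V j p * side V i q → i % m = j % m)
    (hx : LeftPosition V f b x i s) (hy : LeftPosition V f b y j t) (hst : i + s < j + t)
    (hsx : 0 < orient p q x) (hsy : 0 < orient p q y) (hbal : balance m V p q i x ≤ 0) :
    balance m V p q j y < 0 := by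
  obtain ⟨hfi, -, hs0, hs1, rfl⟩ := hx
  obtain ⟨-, hjb, ht0, ht1, rfl⟩ := hy
  have hxb := lineMap_mem_body (hV.vertex_mem i) (hV.vertex_mem (i + 1)) hs0 hs1
  have hyb := lineMap_mem_body (hV.vertex_mem j) (hV.vertex_mem (j + 1)) ht0 ht1
  rcases lt_trichotomy i j with hij | rfl | hji
  · exact hV.balance_neg_of_side_lt hc hp hq hxb hyb hsx hsy (fun c _ _ =>
      hV.orient_boundary_nonneg hs0 hs1 ht0 ht1 hij.le (fun h => absurd h hij.ne) (by omega)
        (by omega)) hfi hij hjb hbal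
  · exact hV.balance_neg_of_same_side hc hp hq hinj hxb hyb hsx hsy hfi hjb
      (lt_of_add_lt_add_left hst) hbal
  · have : (j : ℝ) + 1 ≤ i := mod_cast hji
    linarith

end CyclicPolygon

end HilbertPlane

namespace HilbertPlane

namespace CyclicPolygon

variable {m : ℕ} {V : ℕ → Plane} {p q x y z : Plane} {f b i j : ℕ} {s t : ℝ}

theorem vertex_ne_succ (hV : CyclicPolygon m V) (i : ℕ) : V i ≠ V (i + 1) := by
  intro h
  have := hV.turn_pos i
  rw [← h, orient_self] at this
  exact this.false

theorem eq_one_or_eq_zero_of_side_lineMap (hV : CyclicPolygon m V) (hij : i < j) (hj : j < i + m)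
    (ht0 : 0 ≤ t) (ht1 : t ≤ 1) (h : side V j (AffineMap.lineMap (V i) (V (i + 1)) t) = 0) :
    j = i + 1 ∧ t = 1 ∨ i + m = j + 1 ∧ t = 0 := by
  have hm := hV.three_le
  rw [side_lineMap, add_eq_zero_iff_of_nonneg
    (mul_nonneg (sub_nonneg.2 ht1) (hV.vertex_mem i j)) (mul_nonneg ht0 (hV.vertex_mem _ j)),
    mul_eq_zero, mul_eq_zero, sub_eq_zero] at h
  have hi (h' : j + 1 < i + m) : side V j (V i) ≠ 0 := by
    rw [← hV.periodic i]
    exact (hV.side_vertex_pos h' (by omega)).ne'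
  have hsucc (h' : i + 1 < j) : side V j (V (i + 1)) ≠ 0 := by
    rw [← hV.periodic (i + 1)]
    exact (hV.side_vertex_pos (by omega) (by omega)).ne'
  rcases (Nat.succ_le_of_lt hij).eq_or_lt with rfl | hij'
  · exact .inl ⟨rfl, (h.1.resolve_right (hi (by omega))).symm⟩
  · have ht := h.2.resolve_right (hsucc hij')
    refine .inr ⟨?_, ht⟩
    by_contra hne
    exact hi (by omega) (h.1.resolve_left (by rw [ht]; exact one_ne_zero))

theorem bisectorEnds_subset_body (hV : CyclicPolygon m V) (p q : Plane) :
    bisectorEnds (body V) p q ⊆ body V := fun _ hz => (hV.frontier_body ▸ hz.2 :).1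

end CyclicPolygon

namespace LeftPosition

variable {m : ℕ} {V : ℕ → Plane} {p q x y : Plane} {f b i j : ℕ} {s t : ℝ}

theorem side_eq_zero (h : LeftPosition V f b x i t) : side V i x = 0 := by
  rw [h.eq_lineMap, side_lineMap, side_left, side_right, mul_zero, mul_zero, add_zero]

theorem add_eq_of_lt (hx : LeftPosition V f b x i s) (hx' : LeftPosition V f b x j t)
    (hV : CyclicPolygon m V) (hc : Crossing m V p q f b) (hsx : 0 < orient p q x) (hij : i < j) :
    (i : ℝ) + s = j + t := by
  have hbm := hc.lt_add
  have hfi := hx.le_index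
  have hjb := hx'.index_le
  have hj := hx.eq_lineMap ▸ hx'.side_eq_zero
  have hi := hx'.eq_lineMap ▸ (hV.side_add i x).trans hx.side_eq_zero
  rcases hV.eq_one_or_eq_zero_of_side_lineMap hij (by omega) hx.nonneg hx.le_one hj with
    ⟨rfl, rfl⟩ | ⟨hm, rfl⟩
  · rcases hV.eq_one_or_eq_zero_of_side_lineMap (by omega) (by omega) hx'.nonneg hx'.le_one hi with
      ⟨hm, -⟩ | ⟨-, rfl⟩
    · have := hV.three_le
      omega
    · rw [Nat.cast_add, Nat.cast_one, add_zero]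
  · obtain rfl : i = f := by omega
    rw [hx.eq_lineMap, AffineMap.lineMap_apply_zero] at hsx
    exact absurd hsx hc.start_nonpos.not_gt

theorem add_eq (hx : LeftPosition V f b x i s) (hx' : LeftPosition V f b x j t)
    (hV : CyclicPolygon m V) (hc : Crossing m V p q f b) (hsx : 0 < orient p q x) :
    (i : ℝ) + s = j + t := by
  rcases lt_trichotomy i j with hij | rfl | hji
  · exact hx.add_eq_of_lt hx' hV hc hsx hij
  · rw [AffineMap.lineMap_injective ℝ (hV.vertex_ne_succ i)
      (hx.eq_lineMap.symm.trans hx'.eq_lineMap)]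
  · exact (hx'.add_eq_of_lt hx hV hc hsx hji).symm

theorem eq_of_add_eq (hx : LeftPosition V f b x i s) (hy : LeftPosition V f b y j t)
    (h : (i : ℝ) + s = j + t) : x = y := by
  wlog hij : i ≤ j generalizing x y i j s t
  · exact (this hy hx h.symm (by omega)).symm
  rw [hx.eq_lineMap, hy.eq_lineMap]
  rcases hij.eq_or_lt with rfl | hij
  · rw [add_left_cancel h]
  · have hij' : (i : ℝ) + 1 ≤ j := mod_cast hij
    obtain rfl : s = 1 := by linarith [hx.le_one, hy.nonneg]
    obtain rfl : t = 0 := by linarith [hx.le_one, hy.nonneg]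
    obtain rfl : i + 1 = j := by rw [add_zero] at h; exact_mod_cast h
    rw [AffineMap.lineMap_apply_one, AffineMap.lineMap_apply_zero]

end LeftPosition

namespace CyclicPolygon

variable {m : ℕ} {V : ℕ → Plane} {p q x y z : Plane} {f b : ℕ}

theorem exists_leftPosition_of_mem_bisectorEnds (hV : CyclicPolygon m V)
    (hc : Crossing m V p q f b) (hp : p ∈ openBody V) (hq : q ∈ openBody V)
    (hz : z ∈ bisectorEnds (body V) p q) (hs : 0 < orient p q z) :
    ∃ u : ℝ, (∃ i t, LeftPosition V f b z i t ∧ i + t = u ∧ balance m V p q i z ≤ 0) ∧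
      ∃ i t, LeftPosition V f b z i t ∧ i + t = u ∧ 0 ≤ balance m V p q i z := by
  have hzb := hV.bisectorEnds_subset_body p q hz
  obtain ⟨i, hi, hbali⟩ := hV.exists_balance_nonpos hp hq hz
  obtain ⟨j, hj, hbalj⟩ := hV.exists_balance_nonneg hp hq hz
  obtain ⟨i', s, hposi, hmodi⟩ := hV.exists_leftPosition hc hzb hs hi
  obtain ⟨j', t, hposj, hmodj⟩ := hV.exists_leftPosition hc hzb hs hj
  rw [balance, ← hV.side_congr hmodi, ← hV.side_congr hmodi] at hbali
  rw [balance, ← hV.side_congr hmodj, ← hV.side_congr hmodj] at hbalj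
  exact ⟨i' + s, ⟨i', s, hposi, rfl, hbali⟩, j', t, hposj, hposj.add_eq hposi hV hc hs, hbalj⟩

theorem eq_of_mem_bisectorEnds (hV : CyclicPolygon m V) (hc : Crossing m V p q f b)
    (hp : p ∈ openBody V) (hq : q ∈ openBody V)
    (hinj : ∀ i j, side V i p * side V j q = side V j p * side V i q → i % m = j % m)
    (hx : x ∈ bisectorEnds (body V) p q) (hy : y ∈ bisectorEnds (body V) p q)
    (hsx : 0 < orient p q x) (hsy : 0 < orient p q y) : x = y := by
  obtain ⟨_, ⟨i, s, hi, rfl, hbali⟩, i', s', hi', hii', hbali'⟩ :=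
    hV.exists_leftPosition_of_mem_bisectorEnds hc hp hq hx hsx
  obtain ⟨_, ⟨j, t, hj, rfl, hbalj⟩, j', t', hj', hjj', hbalj'⟩ :=
    hV.exists_leftPosition_of_mem_bisectorEnds hc hp hq hy hsy
  refine hi.eq_of_add_eq hj (le_antisymm ?_ ?_)
  · rw [← hii']
    by_contra! hlt
    exact hbali'.not_gt
      (hV.balance_neg_of_balance_nonpos hc hp hq hinj hj hi' hlt hsy hsx hbalj)
  · rw [← hjj']
    by_contra! hlt
    exact hbalj'.not_gt
      (hV.balance_neg_of_balance_nonpos hc hp hq hinj hi hj' hlt hsx hsy hbali)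

theorem bisectorEnds_eq_pair (hV : CyclicPolygon m V) (hc : Crossing m V p q f b)
    (hc' : ∃ f' b', Crossing m V q p f' b') (hp : p ∈ openBody V) (hq : q ∈ openBody V)
    (hpq : p ≠ q)
    (hinj : ∀ i j, side V i p * side V j q = side V j p * side V i q → i % m = j % m)
    (hx : x ∈ bisectorEnds (body V) p q) (hy : y ∈ bisectorEnds (body V) p q)
    (hsx : 0 < orient p q x) (hsy : orient p q y < 0) :
    bisectorEnds (body V) p q = {x, y} := by
  obtain ⟨f', b', hc'⟩ := hc'
  refine Set.Subset.antisymm (fun z hz => ?_) (Set.pair_subset hx hy)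
  rcases lt_trichotomy (orient p q z) 0 with hsz | hsz | hsz
  · have hswap := bisectorEnds_swap (body V) p q
    refine .inr (hV.eq_of_mem_bisectorEnds hc' hq hp (fun i j h => hinj i j ?_)
      (hswap ▸ hz) (hswap ▸ hy) ?_ ?_)
    · linarith
    · rw [orient_swap]; linarith
    · rw [orient_swap]; linarith
  · exact absurd hsz (hV.orient_ne_zero_of_mem_bisectorEnds hp hq hpq hz)
  · exact .inl (hV.eq_of_mem_bisectorEnds hc hp hq hinj hz hx hsz hsx)

end CyclicPolygon

/-! ### Concurrent lines -/

theorem mem_line_of_orient_eq_zero {a b z : Plane} (hab : a ≠ b) (hz : orient a b z = 0) :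
    z ∈ line[ℝ, a, b] := by
  obtain ⟨t, rfl⟩ := exists_lineMap_eq hab hz
  exact AffineMap.lineMap_mem_affineSpan_pair t a b

theorem parallel_of_orient_eq {a b c d : Plane} (hab : a ≠ b) (hcd : c ≠ d)
    (h : orient a b c = orient a b d) : (line[ℝ, a, b]).Parallel line[ℝ, c, d] := by
  rw [AffineSubspace.affineSpan_pair_parallel_iff_vectorSpan_eq, vectorSpan_pair_rev,
    vectorSpan_pair_rev, vsub_eq_sub, vsub_eq_sub]
  have hline : orient a b (a + (d - c)) = 0 := by
    simp only [orient, PiLp.add_apply, PiLp.sub_apply] at h ⊢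
    linarith
  obtain ⟨t, ht⟩ := exists_lineMap_eq hab hline
  have hdc : d - c = t • (b - a) := by
    rw [AffineMap.lineMap_apply, vadd_eq_add, vsub_eq_sub, add_comm] at ht
    exact add_right_cancel ht
  have ht0 : t ≠ 0 := by
    rintro rfl
    rw [zero_smul, sub_eq_zero] at hdc
    exact hcd hdc.symm
  rw [hdc]
  exact (Submodule.span_singleton_smul_eq ht0.isUnit _).symm

theorem concurrent_of_side_ratio_eq {p q a b c d : Plane} (hpq : p ≠ q) (hab : a ≠ b) (hcd : c ≠ d)
    (haq : orient a b q ≠ 0)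
    (h : orient a b p * orient c d q = orient c d p * orient a b q) :
    Concurrent line[ℝ, p, q] line[ℝ, a, b] line[ℝ, c, d] := by
  have hparallel {u v : Plane} (huv : u ≠ v) (h : orient u v p = orient u v q) :
      (line[ℝ, p, q]).Parallel line[ℝ, u, v] := by
    refine parallel_of_orient_eq hpq huv ?_
    simp only [orient] at h ⊢
    linarith
  by_cases hpq' : orient a b p = orient a b q
  · have hcd' : orient c d p = orient c d q := by
      rw [hpq', mul_comm] at h
      exact (mul_right_cancel₀ haq h).symm
    exact .inr ⟨hparallel hab hpq', (hparallel hab hpq').symm.trans (hparallel hcd hcd')⟩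
  · have hne : orient a b p - orient a b q ≠ 0 := sub_ne_zero.2 hpq'
    refine .inl ⟨AffineMap.lineMap p q (orient a b p / (orient a b p - orient a b q)),
      AffineMap.lineMap_mem_affineSpan_pair _ _ _, mem_line_of_orient_eq_zero hab ?_,
      mem_line_of_orient_eq_zero hcd ?_⟩
    · rw [orient_lineMap]; field_simp; ring
    · rw [orient_lineMap]; field_simp; linarith

theorem sideLine_eq {m : ℕ} (v : Fin m → Plane) (hm : 0 < m) (k : ℕ) :
    sideLine v ⟨k % m, Nat.mod_lt k hm⟩ =
      line[ℝ, cyclicExtension hm v k, cyclicExtension hm v (k + 1)] := by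
  have : finRotate m ⟨k % m, Nat.mod_lt k hm⟩ = ⟨(k + 1) % m, Nat.mod_lt _ hm⟩ := by
    obtain ⟨n, rfl⟩ : ∃ n, m = n + 1 := ⟨m - 1, by omega⟩
    rw [finRotate_apply]
    apply Fin.ext
    simp [Fin.val_add, Nat.add_mod]
  simp only [sideLine, cyclicExtension, this]

theorem side_ratio_injective {m : ℕ} {v : Fin m → Plane} (hv : IsConvexPolygon v) (hm : 0 < m)
    {p q : Plane} (hpq : p ≠ q) (hq : q ∈ openBody (cyclicExtension hm v))
    (h : ∀ i j : Fin m, i ≠ j → ¬ Concurrent line[ℝ, p, q] (sideLine v i) (sideLine v j))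
    (i j : ℕ) (hij : side (cyclicExtension hm v) i p * side (cyclicExtension hm v) j q =
      side (cyclicExtension hm v) j p * side (cyclicExtension hm v) i q) : i % m = j % m := by
  by_contra hne
  have hV := hv.cyclicPolygon hm
  refine h ⟨i % m, Nat.mod_lt i hm⟩ ⟨j % m, Nat.mod_lt j hm⟩ (fun e => hne (Fin.mk.inj e)) ?_
  rw [sideLine_eq v hm, sideLine_eq v hm]
  exact concurrent_of_side_ratio_eq hpq (hV.vertex_ne_succ i) (hV.vertex_ne_succ j) (hq i).ne' hij

end HilbertPlane

namespace HilbertPlane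

/-! ### Invariants of the searches -/

theorem orient_lineMap_pos {p q x y : Plane} {t : ℝ} (hx : 0 ≤ orient p q x)
    (hy : 0 ≤ orient p q y) (hxy : 0 < orient p q x + orient p q y) (h0 : 0 < t) (h1 : t < 1) :
    0 < orient p q (AffineMap.lineMap x y t) := by
  rw [orient_lineMap]
  rcases hx.eq_or_lt with hx0 | hx0
  · rw [← hx0, zero_add] at hxy
    rw [← hx0, mul_zero, zero_add]
    exact mul_pos h0 hxy
  · exact add_pos_of_pos_of_nonneg (mul_pos (sub_pos.2 h1) hx0) (mul_nonneg h0.le hy)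

/-- Invariant of the search for the side through which the rays from the segment `[zl, zh]` through
`r` leave the polygon: the side is one of `lo, …, hi - 1`. -/
structure ExitBracket (V : ℕ → Plane) (p q r zl zh : Plane) (lo hi : ℕ) : Prop where
  lower : ∃ g ∈ body V, side V lo g = 0 ∧ orient p q g ≤ 0 ∧ orient zl r g ≤ 0 ∧ orient zh r g ≤ 0
  upper : ∃ g ∈ body V, side V (hi - 1) g = 0 ∧ orient p q g ≤ 0 ∧ 0 ≤ orient zl r g ∧
    0 ≤ orient zh r g

namespace ExitBracket

variable {m : ℕ} {V : ℕ → Plane} {p q r z zl zh : Plane} {f b lo hi j : ℕ} {s t : ℝ}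

theorem of_crossing (hV : CyclicPolygon m V) (hc : Crossing m V p q f b) (hr : r ∈ openBody V)
    (hsr : orient p q r = 0) (hzl : 0 ≤ orient p q zl) (hzh : 0 ≤ orient p q zh) :
    ExitBracket V p q r zl zh b (f + m + 1) := by
  obtain ⟨g, hg, hbg, hsg⟩ := hV.exists_entry_point hc
  obtain ⟨h, hh, hfh, hsh⟩ := hV.exists_exit_point hc
  refine ⟨⟨g, hg, hbg, hsg.le, ?_, ?_⟩, ⟨h, hh, ?_, hsh.le, ?_, ?_⟩⟩
  · exact hc.orient_entry_nonpos hr hsr hbg hsg hzl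
  · exact hc.orient_entry_nonpos hr hsr hbg hsg hzh
  · rw [Nat.add_sub_cancel, hV.side_add, hfh]
  · exact hc.orient_exit_nonneg hr hsr hfh hsh hzl
  · exact hc.orient_exit_nonneg hr hsr hfh hsh hzh

theorem set_lower (h : ExitBracket V p q r zl zh lo hi) (hV : CyclicPolygon m V)
    (hj : orient p q (V j) ≤ 0) (hl : orient zl r (V j) ≤ 0) (hh : orient zh r (V j) ≤ 0) :
    ExitBracket V p q r zl zh j hi :=
  ⟨⟨V j, hV.vertex_mem j, side_left V j, hj, hl, hh⟩, h.upper⟩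

theorem set_upper (h : ExitBracket V p q r zl zh lo hi) (hV : CyclicPolygon m V) (hj0 : 0 < j)
    (hj : orient p q (V j) ≤ 0) (hl : 0 ≤ orient zl r (V j)) (hh : 0 ≤ orient zh r (V j)) :
    ExitBracket V p q r zl zh lo j := by
  obtain ⟨k, rfl⟩ := Nat.exists_eq_succ_of_ne_zero hj0.ne'
  exact ⟨h.lower, V (k + 1), hV.vertex_mem _, side_right V k, hj, hl, hh⟩

theorem mono (h : ExitBracket V p q r zl zh lo hi) (hs0 : 0 ≤ s) (hs1 : s ≤ 1)
    (ht0 : 0 ≤ t) (ht1 : t ≤ 1) :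
    ExitBracket V p q r (AffineMap.lineMap zl zh s) (AffineMap.lineMap zl zh t) lo hi := by
  obtain ⟨⟨g, hg, hlog, hsg, hlg, hhg⟩, ⟨g', hg', hhig', hsg', hlg', hhg'⟩⟩ := h
  refine ⟨⟨g, hg, hlog, hsg, ?_, ?_⟩, ⟨g', hg', hhig', hsg', ?_, ?_⟩⟩ <;>
    rw [orient_lineMap_left] <;> nlinarith

theorem expFunk_eq (h : ExitBracket V p q r zl zh lo (lo + 1)) (hV : CyclicPolygon m V)
    (hr : r ∈ openBody V) (hsr : orient p q r = 0) (hzl : 0 ≤ orient p q zl)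
    (hzh : 0 ≤ orient p q zh) (hpos : 0 < orient p q zl + orient p q zh)
    (hz : z ∈ segment ℝ zl zh) : expFunk m V z r = side V lo z / side V lo r := by
  rw [segment_eq_image_lineMap] at hz
  obtain ⟨t, ht, rfl⟩ := hz
  have hopen : Set.EqOn (fun t : ℝ => expFunk m V (AffineMap.lineMap zl zh t) r)
      (fun t : ℝ => side V lo (AffineMap.lineMap zl zh t) / side V lo r) (Set.Ioo 0 1) := by
    intro t ht
    obtain ⟨⟨g, hg, hlog, hsg, hlg, -⟩, ⟨g', hg', hlog', hsg', hlg', -⟩⟩ :=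
      h.mono ht.1.le ht.2.le ht.1.le ht.2.le
    exact hV.expFunk_eq_of_exit hr hsr (orient_lineMap_pos hzl hzh hpos ht.1 ht.2) hg hg' hlog
      hlog' hsg hsg' hlg hlg'
  have hclosed := hopen.closure ((continuous_expFunk_left m V r).comp AffineMap.lineMap_continuous)
    (((continuous_side V lo).comp AffineMap.lineMap_continuous).div_const _)
  rw [closure_Ioo zero_ne_one] at hclosed
  exact hclosed ht

end ExitBracket

/-- Invariant of the search for a limit point on the side `i`: the balance changes its sign on the
segment `[zl, zh]`. -/
structure RootBracket (m : ℕ) (V : ℕ → Plane) (p q : Plane) (i : ℕ) (zl zh : Plane) : Prop where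
  mem_left : zl ∈ body V
  mem_right : zh ∈ body V
  side_left : side V i zl = 0
  side_right : side V i zh = 0
  orient_left : 0 ≤ orient p q zl
  orient_right : 0 ≤ orient p q zh
  orient_pos : 0 < orient p q zl + orient p q zh
  balance_left : 0 ≤ balance m V p q i zl
  balance_right : balance m V p q i zh ≤ 0

namespace RootBracket

variable {m : ℕ} {V : ℕ → Plane} {p q r zl zh : Plane} {i j k : ℕ} {t : ℝ}

theorem side_lineMap_eq_zero (h : RootBracket m V p q i zl zh) (t : ℝ) :
    side V i (AffineMap.lineMap zl zh t) = 0 := by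
  rw [side_lineMap, h.side_left, h.side_right, mul_zero, mul_zero, add_zero]

theorem shrink_left (h : RootBracket m V p q i zl zh) (h0 : 0 < t) (h1 : t < 1)
    (hbal : 0 ≤ balance m V p q i (AffineMap.lineMap zl zh t)) :
    RootBracket m V p q i (AffineMap.lineMap zl zh t) zh :=
  have hs := orient_lineMap_pos h.orient_left h.orient_right h.orient_pos h0 h1
  ⟨lineMap_mem_body h.mem_left h.mem_right h0.le h1.le, h.mem_right, h.side_lineMap_eq_zero t,
    h.side_right, hs.le, h.orient_right, add_pos_of_pos_of_nonneg hs h.orient_right, hbal,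
    h.balance_right⟩

theorem shrink_right (h : RootBracket m V p q i zl zh) (h0 : 0 < t) (h1 : t < 1)
    (hbal : balance m V p q i (AffineMap.lineMap zl zh t) ≤ 0) :
    RootBracket m V p q i zl (AffineMap.lineMap zl zh t) :=
  have hs := orient_lineMap_pos h.orient_left h.orient_right h.orient_pos h0 h1
  ⟨h.mem_left, lineMap_mem_body h.mem_left h.mem_right h0.le h1.le, h.side_left,
    h.side_lineMap_eq_zero t, h.orient_left, hs.le, add_pos_of_nonneg_of_pos h.orient_left hs,
    h.balance_left, hbal⟩

theorem lineMap_mem_bisectorEnds (h : RootBracket m V p q i zl zh) (hV : CyclicPolygon m V)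
    (hp : p ∈ openBody V) (hq : q ∈ openBody V) (hpq : p ≠ q) (ht0 : 0 ≤ t) (ht1 : t ≤ 1)
    (hbal : balance m V p q i (AffineMap.lineMap zl zh t) = 0) :
    AffineMap.lineMap zl zh t ∈ bisectorEnds (body V) p q ∧
      0 < orient p q (AffineMap.lineMap zl zh t) := by
  have hzi := h.side_lineMap_eq_zero t
  refine ⟨hV.mem_bisectorEnds hp hq (lineMap_mem_body h.mem_left h.mem_right ht0 ht1) hzi hzi
    hbal.ge hbal.le, lt_of_le_of_ne ?_ fun hs =>
      hV.balance_ne_zero_of_line hp hq hpq hs.symm hzi hbal⟩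
  rw [orient_lineMap]
  exact add_nonneg (mul_nonneg (sub_nonneg.2 ht1) h.orient_left) (mul_nonneg ht0 h.orient_right)

/-- Once the far ends of all chords are known, the limit point is the root of an affine function. -/
theorem root_mem_bisectorEnds (h : RootBracket m V p q i zl zh) (hV : CyclicPolygon m V)
    (hp : p ∈ openBody V) (hq : q ∈ openBody V) (hpq : p ≠ q)
    (hj : ∀ z ∈ segment ℝ zl zh, expFunk m V z p = side V j z / side V j p)
    (hk : ∀ z ∈ segment ℝ zl zh, expFunk m V z q = side V k z / side V k q)
    {cl ch : ℝ}
    (hcl : cl = side V i p * (side V j zl / side V j p) - side V i q * (side V k zl / side V k q))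
    (hch : ch = side V i p * (side V j zh / side V j p) - side V i q * (side V k zh / side V k q)) :
    AffineMap.lineMap zl zh (cl / (cl - ch)) ∈ bisectorEnds (body V) p q ∧
      0 < orient p q (AffineMap.lineMap zl zh (cl / (cl - ch))) := by
  obtain ⟨F, hF⟩ : ∃ F : Plane → ℝ, ∀ z, F z = side V i p * (side V j z / side V j p) -
    side V i q * (side V k z / side V k q) := ⟨_, fun _ => rfl⟩
  rw [← hF] at hcl hch
  subst hcl hch
  have hFbal (z) (hz : z ∈ segment ℝ zl zh) : balance m V p q i z = F z := by
    rw [hF, balance, hj z hz, hk z hz]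
  have hFl : 0 ≤ F zl := hFbal zl (left_mem_segment ℝ zl zh) ▸ h.balance_left
  have hFh : F zh ≤ 0 := hFbal zh (right_mem_segment ℝ zl zh) ▸ h.balance_right
  have ht0 : 0 ≤ F zl / (F zl - F zh) := div_nonneg hFl (by linarith)
  have ht1 : F zl / (F zl - F zh) ≤ 1 := div_le_one_of_le₀ (by linarith) (by linarith)
  refine h.lineMap_mem_bisectorEnds hV hp hq hpq ht0 ht1 ?_
  have haffine (t : ℝ) : F (AffineMap.lineMap zl zh t) = (1 - t) * F zl + t * F zh := by
    rw [hF, hF, hF, side_lineMap, side_lineMap]; ring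
  rw [hFbal _ (segment_eq_image_lineMap ℝ zl zh ▸ ⟨_, ⟨ht0, ht1⟩, rfl⟩), haffine]
  by_cases h0 : F zl - F zh = 0
  · rw [show F zl = 0 by linarith, show F zh = 0 by linarith, mul_zero, mul_zero, add_zero]
  · field_simp
    ring

end RootBracket

/-- The oriented areas of the triangles on `p` and two of `u`, `v`, `w` are barycentric coordinates
of `p` up to a common factor. -/
theorem orient_mul_orient_add (p q u v w : Plane) :
    orient v w p * orient p q u + orient u p w * orient p q v - orient u p v * orient p q w =
      0 := by
  simp only [orient]; ring

/-- The hypotheses on `c` say that `p` lies in the triangle `V 0, V c, V (c + 1)`, so the line `pq`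
separates `V 0` from `V c` or `V (c + 1)`, unless it passes through `V 0`. In that case `V c` and
`V (m - 1)` lie on different sides of it. -/
theorem CyclicPolygon.exists_vertex_across {m : ℕ} {V : ℕ → Plane} {p q : Plane}
    (hV : CyclicPolygon m V) (hp : p ∈ openBody V) (hpq : p ≠ q) {c : ℕ}
    (hc : orient (V 0) p (V c) < 0) (hc' : 0 ≤ orient (V 0) p (V (c + 1))) :
    ¬ (0 < orient p q (V c) ↔ 0 < orient p q (V 0)) ∨
    ¬ (0 < orient p q (V (c + 1)) ↔ 0 < orient p q (V 0)) ∨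
    ¬ (0 < orient p q (V (m - 1)) ↔ 0 < orient p q (V 0)) := by
  by_contra! hcon
  obtain ⟨hiff, hiff', hifflast⟩ := hcon
  have hpc : 0 < orient (V c) (V (c + 1)) p := hp c
  have hlast : 0 < orient (V 0) p (V (m - 1)) := by
    have h := hp (m - 1)
    rwa [side, Nat.sub_add_cancel hV.pos, ← zero_add m, hV.periodic, zero_add,
      ← orient_rotate] at h
  have hbary := orient_mul_orient_add p q (V 0) (V c) (V (c + 1))
  by_cases h0 : 0 < orient p q (V 0)
  · linarith [mul_pos hpc h0, mul_nonneg hc' (hiff.2 h0).le,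
      mul_neg_of_neg_of_pos hc (hiff'.2 h0)]
  rw [iff_false_right h0, not_lt] at hiff hiff' hifflast
  have hline : orient p q (V 0) = 0 := by
    refine le_antisymm (not_lt.1 h0) (nonneg_of_mul_nonneg_right ?_ hpc)
    linarith [mul_nonpos_of_nonneg_of_nonpos hc' hiff, mul_nonneg_of_nonpos_of_nonpos hc.le hiff']
  obtain ⟨t, ht⟩ := exists_lineMap_eq hpq hline
  have horient (w : Plane) : orient (V 0) p w = -t * orient p q w := by
    rw [ht]
    simp only [orient, lineMap_coord]; ring
  rw [horient] at hc hlast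
  have ht_pos : 0 < t := by
    by_contra! ht0
    linarith [mul_nonneg_of_nonpos_of_nonpos ht0 hifflast]
  linarith [mul_nonpos_of_nonneg_of_nonpos ht_pos.le hiff]

end HilbertPlane

/-! ### Time-bounded program logic -/

namespace RealRAM

namespace Prog

/-- The time a program takes at most if each of its loops runs at most `L` times whenever it is
entered. -/
def bound (L : ℕ) : Prog → ℕ
  | skip => 1
  | setI _ e => e.cost + 1
  | setR _ e => e.cost + 1
  | store a e => a.cost + e.cost + 1
  | seq c d => c.bound L + d.bound L
  | ite b c d => b.cost + (c.bound L + d.bound L) + 1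
  | loop b c => L * (b.cost + c.bound L + 1) + (b.cost + 1)

/-- The nesting depth of the loops of a program. -/
def depth : Prog → ℕ
  | skip => 0
  | setI _ _ => 0
  | setR _ _ => 0
  | store _ _ => 0
  | seq c d => max c.depth d.depth
  | ite _ c d => max c.depth d.depth
  | loop _ c => c.depth + 1

theorem bound_le (L : ℕ) (c : Prog) : c.bound L ≤ c.bound 1 * (L + 1) ^ c.depth := by
  have le_mul_pow (n d : ℕ) : n ≤ n * (L + 1) ^ d := Nat.le_mul_of_pos_right n (by positivity)
  have pow_mono {n d e : ℕ} (h : d ≤ e) : n * (L + 1) ^ d ≤ n * (L + 1) ^ e :=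
    Nat.mul_le_mul_left n (Nat.pow_le_pow_right L.succ_pos h)
  induction c with
  | skip | setI | setR | store => simp only [bound, depth, pow_zero, mul_one, le_refl]
  | seq c d ihc ihd =>
    simp only [bound, depth, add_mul]
    exact Nat.add_le_add (ihc.trans (pow_mono (le_max_left _ _)))
      (ihd.trans (pow_mono (le_max_right _ _)))
  | ite b c d ihc ihd =>
    simp only [bound, depth, add_right_comm _ _ 1, add_mul (b.cost + 1), add_mul (c.bound 1)]
    exact Nat.add_le_add (le_mul_pow _ _) (Nat.add_le_add (ihc.trans (pow_mono (le_max_left _ _)))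
      (ihd.trans (pow_mono (le_max_right _ _))))
  | loop b c ih =>
    calc L * (b.cost + c.bound L + 1) + (b.cost + 1)
        ≤ (L + 1) * (b.cost + 1 + c.bound L) := by
          rw [add_mul, one_mul, add_right_comm]
          omega
      _ ≤ (L + 1) * ((b.cost + 1 + c.bound 1) * (L + 1) ^ c.depth) := by
          rw [add_mul _ (c.bound 1)]
          exact Nat.mul_le_mul_left _ (Nat.add_le_add (le_mul_pow _ _) ih)
      _ = (b.cost + 1 + c.bound 1) * (L + 1) ^ (c.depth + 1) := by ring
      _ ≤ (1 * (b.cost + c.bound 1 + 1) + (b.cost + 1)) * (L + 1) ^ (c.depth + 1) :=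
          Nat.mul_le_mul_right _ (by omega)

end Prog

namespace State

/-- Assignment to an index register. -/
def setI (s : State) (i n : ℕ) : State := { s with idx := Function.update s.idx i n }

/-- Assignment to a real register. -/
def setR (s : State) (i : ℕ) (x : ℝ) : State := { s with reg := Function.update s.reg i x }

@[simp] theorem setI_idx (s : State) (i n j : ℕ) :
    (s.setI i n).idx j = if j = i then n else s.idx j :=
  Function.update_apply s.idx i n j

@[simp] theorem setR_reg (s : State) (i : ℕ) (x : ℝ) (j : ℕ) :
    (s.setR i x).reg j = if j = i then x else s.reg j :=
  Function.update_apply s.reg i x j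

end State

/-- Started in the state `s`, the program `c` halts in a state with the property `Q`, within the
time that it takes at most if each of its loops runs at most `L` times whenever it is entered. -/
def Ensures (L : ℕ) (c : Prog) (s : State) (Q : State → Prop) : Prop :=
  ∃ t s', Exec c s t s' ∧ t ≤ c.bound L ∧ Q s'

/-- The states agree on the memory, on the index registers below `a` and on the real registers
below `b`. Every program fragment states in this form which registers it leaves alone. -/
structure Agree (a b : ℕ) (s s' : State) : Prop where
  mem : s'.mem = s.mem
  idx : ∀ i < a, s'.idx i = s.idx i
  reg : ∀ i < b, s'.reg i = s.reg i

namespace Agree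

variable {a b a' b' : ℕ} {s s' s'' : State}

theorem refl (s : State) : Agree a b s s := ⟨rfl, fun _ _ => rfl, fun _ _ => rfl⟩

theorem mono (h : Agree a' b' s s') (ha : a ≤ a') (hb : b ≤ b') : Agree a b s s' :=
  ⟨h.mem, fun i hi => h.idx i (hi.trans_le ha), fun i hi => h.reg i (hi.trans_le hb)⟩

theorem trans (h : Agree a b s s') (h' : Agree a' b' s' s'') (ha : a ≤ a') (hb : b ≤ b') :
    Agree a b s s'' :=
  ⟨h'.mem.trans h.mem, fun i hi => (h'.idx i (hi.trans_le ha)).trans (h.idx i hi),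
    fun i hi => (h'.reg i (hi.trans_le hb)).trans (h.reg i hi)⟩

theorem setI (h : Agree a b s s') {i n : ℕ} (hi : a ≤ i) : Agree a b s (s'.setI i n) :=
  ⟨h.mem, fun j hj => by rw [State.setI_idx, if_neg (by omega), h.idx j hj], h.reg⟩

theorem setR (h : Agree a b s s') {i : ℕ} {x : ℝ} (hi : b ≤ i) : Agree a b s (s'.setR i x) :=
  ⟨h.mem, h.idx, fun j hj => by rw [State.setR_reg, if_neg (by omega), h.reg j hj]⟩

end Agree

/-- The body of a binary search between the values of the index registers `lo` and `lo + 1`: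
`probe` is run with their midpoint in the index register `lo + 2`, and the outcome of the test `b`
tells which of the two bounds the midpoint replaces. -/
def halve (lo : ℕ) (probe : Prog) (b : BExp) : Prog :=
  .seq (.setI (lo + 2) (.half (.add (.var lo) (.var (lo + 1))))) <|
  .seq probe <|
  .ite b (.setI lo (.var (lo + 2))) (.setI (lo + 1) (.var (lo + 2)))

/-- Binary search: the index registers `lo` and `lo + 1` start with the values of `e` and `e'` and
are moved towards each other by `halve` until they are adjacent. -/
def binarySearch (lo : ℕ) (e e' : IExp) (probe : Prog) (b : BExp) : Prog :=
  .seq (.setI lo e) <| .seq (.setI (lo + 1) e') <|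
  .loop (.ltI (.add (.var lo) (.lit 1)) (.var (lo + 1))) (halve lo probe b)

theorem clog_lt_clog_of_le_half {k n : ℕ} (hn : 2 ≤ n) (hk : k ≤ (n + 1) / 2) :
    Nat.clog 2 k < Nat.clog 2 n := by
  rw [Nat.clog_of_two_le one_lt_two hn, Nat.lt_succ_iff]
  exact Nat.clog_mono_right 2 hk

namespace Ensures

variable {L : ℕ} {c d : Prog} {s : State} {P Q : State → Prop}

theorem imp (h : Ensures L c s P) (hPQ : ∀ s', P s' → Q s') : Ensures L c s Q :=
  let ⟨t, s', hexec, ht, hP⟩ := h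
  ⟨t, s', hexec, ht, hPQ s' hP⟩

theorem skip (h : Q s) : Ensures L .skip s Q := ⟨_, _, .skip s, le_rfl, h⟩

theorem setI {i : ℕ} {e : IExp} (h : Q (s.setI i (e.eval s))) : Ensures L (.setI i e) s Q :=
  ⟨_, _, .setI s i e, le_rfl, h⟩

theorem setR {i : ℕ} {e : RExp} (h : Q (s.setR i (e.eval s))) : Ensures L (.setR i e) s Q :=
  ⟨_, _, .setR s i e, le_rfl, h⟩

theorem seq (hc : Ensures L c s P) (hd : ∀ s', P s' → Ensures L d s' Q) :
    Ensures L (.seq c d) s Q :=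
  let ⟨_, s', hexec, ht, hP⟩ := hc
  let ⟨_, s'', hexec', ht', hQ⟩ := hd s' hP
  ⟨_, s'', .seq hexec hexec', Nat.add_le_add ht ht', hQ⟩

theorem seq_setI {i : ℕ} {e : IExp} (h : Ensures L d (s.setI i (e.eval s)) Q) :
    Ensures L (.seq (.setI i e) d) s Q :=
  seq (P := (· = s.setI i (e.eval s))) (setI rfl) fun _ hs => hs ▸ h

theorem seq_setR {i : ℕ} {e : RExp} (h : Ensures L d (s.setR i (e.eval s)) Q) :
    Ensures L (.seq (.setR i e) d) s Q :=
  seq (P := (· = s.setR i (e.eval s))) (setR rfl) fun _ hs => hs ▸ h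

theorem ite {b : BExp} (hc : b.Holds s → Ensures L c s Q) (hd : ¬ b.Holds s → Ensures L d s Q) :
    Ensures L (.ite b c d) s Q := by
  by_cases hb : b.Holds s
  · obtain ⟨t, s', hexec, ht, hQ⟩ := hc hb
    exact ⟨_, _, .iteTrue hb hexec, by rw [Prog.bound]; omega, hQ⟩
  · obtain ⟨t, s', hexec, ht, hQ⟩ := hd hb
    exact ⟨_, _, .iteFalse hb hexec, by rw [Prog.bound]; omega, hQ⟩

theorem loop {b : BExp} {I : State → Prop} (μ : State → ℕ) (hI : I s) (hμ : μ s ≤ L)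
    (step : ∀ s, I s → b.Holds s → Ensures L c s fun s' => I s' ∧ μ s' < μ s) :
    Ensures L (.loop b c) s fun s' => I s' ∧ ¬ b.Holds s' := by
  suffices ∀ n s, I s → μ s ≤ n → ∃ t s', Exec (.loop b c) s t s' ∧
      t ≤ n * (b.cost + c.bound L + 1) + (b.cost + 1) ∧ I s' ∧ ¬ b.Holds s' from
    this L s hI hμ
  intro n
  induction n with
  | zero =>
    intro s hI hμ
    have hb : ¬ b.Holds s := fun hb =>
      let ⟨_, _, _, _, _, hlt⟩ := step s hI hb
      absurd hlt (by omega)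
    exact ⟨_, s, .loopFalse hb, by omega, hI, hb⟩
  | succ n ih =>
    intro s hI hμ
    by_cases hb : b.Holds s
    · obtain ⟨t, s', hexec, ht, hI', hlt⟩ := step s hI hb
      obtain ⟨t', s'', hexec', ht', hI''⟩ := ih s' hI' (by omega)
      refine ⟨_, s'', .loopTrue hb hexec hexec', ?_, hI''⟩
      rw [add_mul, one_mul]
      omega
    · exact ⟨_, s, .loopFalse hb, by omega, hI, hb⟩

theorem halve {lo a l h : ℕ} {b : BExp} {I : ℕ → ℕ → State → Prop}
    (hI_setI : ∀ {l h s} i n, I l h s → I l h (s.setI i n))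
    (hl : s.idx lo = l) (hh : s.idx (lo + 1) = h)
    (probe : Ensures L c (s.setI (lo + 2) ((l + h) / 2)) fun s' =>
      Agree (lo + 3) a (s.setI (lo + 2) ((l + h) / 2)) s' ∧
        (b.Holds s' → I ((l + h) / 2) h s') ∧ (¬ b.Holds s' → I l ((l + h) / 2) s')) :
    Ensures L (halve lo c b) s fun s' => Agree lo a s s' ∧ I (s'.idx lo) (s'.idx (lo + 1)) s' ∧
      (s'.idx lo = (l + h) / 2 ∧ s'.idx (lo + 1) = h ∨
        s'.idx lo = l ∧ s'.idx (lo + 1) = (l + h) / 2) := by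
  subst hl hh
  refine seq_setI (seq probe fun s₁ ⟨hag, htrue, hfalse⟩ => ?_)
  have hs₁ : Agree lo a s s₁ := ((Agree.refl s).setI (by omega)).trans hag (by omega) le_rfl
  have hlo : s₁.idx lo = s.idx lo := by simp [hag.idx lo]
  have hhi : s₁.idx (lo + 1) = s.idx (lo + 1) := by simp [hag.idx (lo + 1)]
  have hmid : s₁.idx (lo + 2) = (s.idx lo + s.idx (lo + 1)) / 2 := by simp [hag.idx (lo + 2)]
  refine ite (fun hb => setI ⟨hs₁.setI le_rfl, ?_⟩) fun hb => setI ⟨hs₁.setI (by omega), ?_⟩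
  · simpa [IExp.eval, hmid, hhi] using hI_setI _ _ (htrue hb)
  · simpa [IExp.eval, hmid, hlo] using hI_setI _ _ (hfalse hb)

/-- The invariant `I l h` may depend on the bounds `l` and `h` of the search and on the real
registers, but not on the index registers. -/
theorem binarySearch {lo a l₀ h₀ : ℕ} {e e' : IExp} {b : BExp} (I : ℕ → ℕ → State → Prop)
    (hI_setI : ∀ {l h s} i n, I l h s → I l h (s.setI i n))
    (he : e.eval s = l₀) (he' : e'.eval (s.setI lo l₀) = h₀)
    (hlt : l₀ < h₀) (hL : h₀ - l₀ ≤ 2 ^ L) (hI : I l₀ h₀ s)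
    (step : ∀ l mid h s', l₀ ≤ l → l < mid → mid < h → h ≤ h₀ → Agree lo a s s' →
      s'.idx (lo + 2) = mid → I l h s' → Ensures L c s' fun s'' =>
        Agree (lo + 3) a s' s'' ∧ (b.Holds s'' → I mid h s'') ∧ (¬ b.Holds s'' → I l mid s'')) :
    Ensures L (binarySearch lo e e' c b) s fun s' => Agree lo a s s' ∧ ∃ l, l₀ ≤ l ∧ l < h₀ ∧
      s'.idx lo = l ∧ s'.idx (lo + 1) = l + 1 ∧ I l (l + 1) s' := by
  refine seq_setI (seq_setI ?_)
  rw [he, he']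
  refine imp (loop (I := fun s' => Agree lo a s s' ∧ l₀ ≤ s'.idx lo ∧
      s'.idx lo < s'.idx (lo + 1) ∧ s'.idx (lo + 1) ≤ h₀ ∧ I (s'.idx lo) (s'.idx (lo + 1)) s')
    (fun s' => Nat.clog 2 (s'.idx (lo + 1) - s'.idx lo)) ?_ ?_ ?_) ?_
  · simpa [hlt] using ⟨((Agree.refl s).setI le_rfl).setI (by omega), hI_setI _ _ (hI_setI _ _ hI)⟩
  · simpa using Nat.clog_le_of_le_pow hL
  · rintro s₁ ⟨hag, hl, _, hh, hI₁⟩ hb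
    simp only [BExp.Holds, IExp.eval] at hb
    refine (halve hI_setI rfl rfl (step _ _ _ _ hl (by omega) (by omega) hh (hag.setI (by omega))
      (by simp) (hI_setI _ _ hI₁))).imp fun s₂ ⟨hag₂, hI₂, hbounds⟩ =>
        ⟨⟨hag.trans hag₂ le_rfl le_rfl, by omega, by omega, by omega, hI₂⟩,
          clog_lt_clog_of_le_half (by omega) (by omega)⟩
  · rintro s' ⟨⟨hag, hl, hlh, hh, hI'⟩, hb⟩
    simp only [BExp.Holds, IExp.eval, not_lt] at hb
    have hadj : s'.idx (lo + 1) = s'.idx lo + 1 := by omega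
    exact ⟨hag, _, hl, by omega, rfl, hadj, hadj ▸ hI'⟩

end Ensures

end RealRAM

/-! ### Points in registers and vertices in memory -/

namespace RealRAM

open HilbertPlane

namespace State

/-- The point whose coordinates are in the real registers `x` and `x + 1`. -/
def pt (s : State) (x : ℕ) : Plane := !₂[s.reg x, s.reg (x + 1)]

/-- Assignment of a point to the real registers `x` and `x + 1`. -/
def setPt (s : State) (x : ℕ) (w : Plane) : State := (s.setR x (w 0)).setR (x + 1) (w 1)

@[simp] theorem pt_zero (s : State) (x : ℕ) : s.pt x 0 = s.reg x := rfl

@[simp] theorem pt_one (s : State) (x : ℕ) : s.pt x 1 = s.reg (x + 1) := rfl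

@[simp] theorem setI_pt (s : State) (i n x : ℕ) : (s.setI i n).pt x = s.pt x := rfl

theorem setR_pt_of_ne (s : State) {i x : ℕ} (a : ℝ) (h : i ≠ x) (h' : i ≠ x + 1) :
    (s.setR i a).pt x = s.pt x := by
  simp [pt, h.symm, h'.symm]

@[simp] theorem setPt_pt_self (s : State) (x : ℕ) (w : Plane) : (s.setPt x w).pt x = w := by
  apply plane_ext <;> simp [setPt]

theorem setPt_pt_of_ne (s : State) {x y : ℕ} (w : Plane) (h : y + 1 < x ∨ x + 1 < y) :
    (s.setPt x w).pt y = s.pt y := by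
  rw [setPt, setR_pt_of_ne _ _ (by omega) (by omega), setR_pt_of_ne _ _ (by omega) (by omega)]

end State

namespace Agree

variable {a b x : ℕ} {s s' : State}

theorem setPt (h : Agree a b s s') {w : Plane} (hx : b ≤ x) : Agree a b s (s'.setPt x w) :=
  (h.setR hx).setR (by omega)

theorem pt (h : Agree a b s s') (hx : x + 1 < b) : s'.pt x = s.pt x :=
  plane_ext (h.reg x (by omega)) (h.reg (x + 1) hx)

end Agree

/-- The orientation of three points in registers. -/
def orientE (a b c : ℕ) : RExp :=
  .sub (.mul (.sub (.var b) (.var a)) (.sub (.var (c + 1)) (.var (a + 1))))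
    (.mul (.sub (.var (b + 1)) (.var (a + 1))) (.sub (.var c) (.var a)))

@[simp] theorem orientE_eval (s : State) (a b c : ℕ) :
    (orientE a b c).eval s = orient (s.pt a) (s.pt b) (s.pt c) := rfl

namespace BExp

/-- The test whether a real expression is positive. -/
def pos (e : RExp) : BExp := .ltR (.lit 0) e

/-- The test whether a real expression is negative. -/
def neg (e : RExp) : BExp := .ltR e (.lit 0)

@[simp] theorem pos_holds {e : RExp} {s : State} : (pos e).Holds s ↔ 0 < e.eval s := by
  simp [pos, Holds, RExp.eval]

@[simp] theorem neg_holds {e : RExp} {s : State} : (neg e).Holds s ↔ e.eval s < 0 := by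
  simp [neg, Holds, RExp.eval]

end BExp

/-- Copies the point `y` to `x`. -/
def copyPt (x y : ℕ) : Prog := .seq (.setR x (.var y)) (.setR (x + 1) (.var (y + 1)))

/-- Assigns to `x` the point with parameter `t`, a real register, on the line through `y`
and `z`. -/
def interpolate (x y z t : ℕ) : Prog :=
  .seq (.setR x (.add (.var y) (.mul (.var t) (.sub (.var z) (.var y)))))
    (.setR (x + 1) (.add (.var (y + 1)) (.mul (.var t) (.sub (.var (z + 1)) (.var (y + 1))))))

namespace Ensures

variable {L x y z t : ℕ} {s : State} {Q : State → Prop}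

theorem setPt {e e' : RExp} {w : Plane} (he : e.eval s = w 0)
    (he' : e'.eval (s.setR x (w 0)) = w 1) (h : Q (s.setPt x w)) :
    Ensures L (.seq (.setR x e) (.setR (x + 1) e')) s Q := by
  refine seq_setR (setR ?_)
  rw [he, he']
  exact h

theorem copyPt (hxy : x ≠ y + 1) (h : Q (s.setPt x (s.pt y))) : Ensures L (copyPt x y) s Q :=
  setPt rfl (by simp [RExp.eval, hxy.symm]) h

theorem interpolate (hxy : x ≠ y + 1) (hxz : x ≠ z + 1) (hxt : x ≠ t)
    (h : Q (s.setPt x (AffineMap.lineMap (s.pt y) (s.pt z) (s.reg t)))) :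
    Ensures L (interpolate x y z t) s Q :=
  setPt (by simp [RExp.eval, lineMap_coord])
    (by simp [RExp.eval, lineMap_coord, hxy.symm, hxz.symm, hxt.symm]) h

end Ensures

end RealRAM

namespace HilbertPlane

open RealRAM

/-- The memory holds the vertices, the index register `0` their number, and the points `0` and `2`
are `p` and `q`. -/
structure Layout (m : ℕ) (V : ℕ → Plane) (p q : Plane) (s : State) : Prop where
  size : s.idx 0 = m
  vertex : ∀ k < m, s.mem (2 * k) = V k 0 ∧ s.mem (2 * k + 1) = V k 1
  pt_zero : s.pt 0 = p
  pt_two : s.pt 2 = q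

/-- Subtracts the number of vertices once from an index register, unless it is already smaller. -/
def wrap (i : ℕ) : Prog := .ite (.ltI (.var i) (.var 0)) .skip (.setI i (.sub (.var i) (.var 0)))

/-- Loads the vertex whose index is in the index register `j` into the point `x`. The index may be
as large as three times the number of vertices. -/
def loadVertex (j x : ℕ) : Prog :=
  .seq (.setI 16 (.var j)) <| .seq (wrap 16) <| .seq (wrap 16) <|
  .seq (.setR x (.load (.add (.var 16) (.var 16))))
    (.setR (x + 1) (.load (.add (.add (.var 16) (.var 16)) (.lit 1))))

/-- Loads the end points of the side whose index is in the index register `j` into the points `18`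
and `20`. -/
def loadSide (j : ℕ) : Prog :=
  .seq (loadVertex j 18) <| .seq (.setI 15 (.add (.var j) (.lit 1))) (loadVertex 15 20)

/-- Stores in the real register `dst` the ratio of the values of a side function at the points `z`
and `r`. -/
def sideRatio (j z r dst : ℕ) : Prog :=
  .seq (loadSide j) (.setR dst (.div (orientE 18 20 z) (orientE 18 20 r)))

namespace Layout

variable {L m i j x : ℕ} {V : ℕ → Plane} {p q : Plane} {s : State}

theorem of_agree {s' : State} {a b : ℕ} (h : Layout m V p q s) (hag : Agree a b s s') (ha : 1 ≤ a)
    (hb : 4 ≤ b) : Layout m V p q s' where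
  size := by rw [hag.idx 0 ha, h.size]
  vertex := hag.mem ▸ h.vertex
  pt_zero := by rw [hag.pt (by omega), h.pt_zero]
  pt_two := by rw [hag.pt (by omega), h.pt_two]

theorem ensures_wrap (hs : Layout m V p q s) (hV : CyclicPolygon m V) {b k : ℕ}
    (hi : s.idx i < (k + 2) * m) :
    Ensures L (wrap i) s fun s' =>
      Agree i b s s' ∧ V (s'.idx i) = V (s.idx i) ∧ s'.idx i < (k + 1) * m := by
  have hsucc : (k + 2) * m = (k + 1) * m + m := by ring
  refine .ite (fun hlt => .skip ⟨.refl s, rfl, ?_⟩)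
    fun hle => .setI ⟨(Agree.refl s).setI le_rfl, ?_⟩
  · simp only [BExp.Holds, IExp.eval, hs.size] at hlt
    nlinarith [Nat.zero_le (k * m)]
  · simp only [BExp.Holds, IExp.eval, hs.size, not_lt] at hle
    simp only [IExp.eval, State.setI_idx, if_true, hs.size]
    refine ⟨?_, by omega⟩
    rw [← hV.periodic (s.idx i - m), Nat.sub_add_cancel hle]

theorem ensures_loadVertex (hs : Layout m V p q s) (hV : CyclicPolygon m V) (hj : s.idx j = i)
    (hi : i < 3 * m) (hx : 4 ≤ x) :
    Ensures L (loadVertex j x) s fun s' => Agree 16 x s s' ∧ s'.pt x = V i := by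
  subst hj
  have hag₁ : Agree 16 x s (s.setI 16 (s.idx j)) := (Agree.refl s).setI le_rfl
  have hs₁ := hs.of_agree hag₁ (by omega) hx
  refine .seq_setI (.seq (hs₁.ensures_wrap hV (b := x) (k := 1) (by simpa [IExp.eval] using hi))
    fun s₂ ⟨hag, heq, hlt⟩ => ?_)
  have hag₂ := hag₁.trans hag le_rfl le_rfl
  have hs₂ := hs.of_agree hag₂ (by omega) hx
  refine .seq (hs₂.ensures_wrap hV (b := x) (k := 0) (by omega)) fun s₃ ⟨hag, heq', hlt'⟩ => ?_
  have hag₃ := hag₂.trans hag le_rfl le_rfl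
  obtain ⟨hmem, hmem'⟩ := (hs.of_agree hag₃ (by omega) hx).vertex (s₃.idx 16) (by simpa using hlt')
  have hvertex : V (s₃.idx 16) = V (s.idx j) := by rw [heq', heq]; simp
  refine .setPt (w := V (s.idx j)) ?_ ?_ ⟨hag₃.setPt le_rfl, State.setPt_pt_self ..⟩
  · rw [← hvertex, ← hmem, two_mul]; rfl
  · rw [← hvertex, ← hmem', two_mul]; rfl

theorem ensures_loadSide (hs : Layout m V p q s) (hV : CyclicPolygon m V) (hj : s.idx j = i)
    (hj' : j < 15) (hi : i + 1 < 3 * m) :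
    Ensures L (loadSide j) s fun s' =>
      Agree 15 18 s s' ∧ s'.pt 18 = V i ∧ s'.pt 20 = V (i + 1) := by
  refine .seq (hs.ensures_loadVertex hV hj (by omega) (by omega)) fun s₁ ⟨hag₁, hpt₁⟩ =>
    .seq_setI ?_
  have hj₁ : (IExp.add (.var j) (.lit 1)).eval s₁ = i + 1 := by
    simp [IExp.eval, hag₁.idx j (by omega), hj]
  have hag₂ : Agree 15 18 s (s₁.setI 15 (i + 1)) :=
    (hag₁.mono (by omega) le_rfl).setI le_rfl
  rw [hj₁]
  refine ((hs.of_agree hag₂ (by omega) (by omega)).ensures_loadVertex hV (by simp) hi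
    (by omega)).imp fun s₃ ⟨hag₃, hpt₃⟩ => ⟨hag₂.trans hag₃ (by omega) (by omega), ?_, hpt₃⟩
  rw [hag₃.pt (by omega), State.setI_pt, hpt₁]

theorem ensures_sideRatio (hs : Layout m V p q s) (hV : CyclicPolygon m V) (hj : s.idx j = i)
    (hj' : j < 15) (hi : i + 1 < 3 * m) {z r dst : ℕ} (hz : z < 17) (hr : r < 17)
    (hdst : dst < 18) :
    Ensures L (sideRatio j z r dst) s fun s' =>
      Agree 15 dst s s' ∧ s'.reg dst = side V i (s.pt z) / side V i (s.pt r) := by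
  refine .seq (hs.ensures_loadSide hV hj hj' hi) fun s₁ ⟨hag, hpt, hpt'⟩ =>
    .setR ⟨(hag.mono le_rfl hdst.le).setR le_rfl, ?_⟩
  simp only [State.setR_reg, if_true, RExp.eval, orientE_eval, hpt, hpt', side,
    hag.pt (x := z) (by omega), hag.pt (x := r) (by omega)]

end Layout

end HilbertPlane

/-! ### Evaluating the boundary balance -/

namespace HilbertPlane

open RealRAM

/-- The state holds a convex polygon with the points `p` and `q` inside, and in the index registers
`1` and `2` the sides crossed by the line `pq`. -/
structure CrossedLayout (m : ℕ) (V : ℕ → Plane) (p q : Plane) (f b : ℕ) (s : State) : Prop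
    extends Layout m V p q s where
  poly : CyclicPolygon m V
  p_mem : p ∈ openBody V
  q_mem : q ∈ openBody V
  ne : p ≠ q
  crossing : Crossing m V p q f b
  lt_size : f < m
  start : s.idx 1 = f
  finish : s.idx 2 = b

/-- Finds the side through which the ray from the point `12` through the point `r` leaves the
polygon, and stores the Funk ratio of these points in the real register `dst`. -/
def farRatio (r dst : ℕ) : Prog :=
  .seq (binarySearch 12 (.var 2) (.add (.add (.var 1) (.var 0)) (.lit 1)) (loadVertex 14 18)
    (.not (.pos (orientE 12 r 18)))) <|
  sideRatio 12 12 r dst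

/-- Stores in the real register `dst` the difference of the values at `p` and `q` of the side
function in the index register `7`, weighted by the real registers `16` and `17`. -/
def weightedDiff (dst : ℕ) : Prog :=
  .seq (loadSide 7) <|
  .setR dst (.sub (.mul (orientE 18 20 0) (.var 16)) (.mul (orientE 18 20 2) (.var 17)))

/-- Stores in the real register `17` the balance of the point `12` for the side in the index
register `7`. -/
def balanceProg : Prog := .seq (farRatio 0 16) <| .seq (farRatio 2 17) <| weightedDiff 17

theorem Layout.ensures_weightedDiff {L m i dst : ℕ} {V : ℕ → Plane} {p q : Plane} {s : State}
    (hs : Layout m V p q s) (hV : CyclicPolygon m V) (hi : s.idx 7 = i) (him : i + 1 < 3 * m)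
    (hdst : dst < 18) :
    Ensures L (weightedDiff dst) s fun s' => Agree 15 dst s s' ∧
      s'.reg dst = side V i p * s.reg 16 - side V i q * s.reg 17 := by
  refine .seq (hs.ensures_loadSide hV hi (by omega) him) fun s₁ ⟨hag, hpt, hpt'⟩ =>
    .setR ⟨(hag.mono le_rfl hdst.le).setR le_rfl, ?_⟩
  have hs₁ := hs.of_agree hag (by omega) (by omega)
  simp only [State.setR_reg, if_true, RExp.eval, orientE_eval, hpt, hpt', hs₁.pt_zero, hs₁.pt_two,
    hag.reg 16 (by omega), hag.reg 17 (by omega), side]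

namespace CrossedLayout

variable {L m f b i r dst : ℕ} {V : ℕ → Plane} {p q : Plane} {s : State}

theorem of_agree {s' : State} {a c : ℕ} (h : CrossedLayout m V p q f b s) (hag : Agree a c s s')
    (ha : 3 ≤ a) (hc : 4 ≤ c) : CrossedLayout m V p q f b s' :=
  { h with
    toLayout := h.toLayout.of_agree hag (by omega) hc
    start := by rw [hag.idx 1 (by omega), h.start]
    finish := by rw [hag.idx 2 (by omega), h.finish] }

theorem ensures_farRatio (hs : CrossedLayout m V p q f b s) (hL : 2 * m + 2 ≤ 2 ^ L)
    (hz : 0 < orient p q (s.pt 12)) (hr : r < 11) (hrb : s.pt r ∈ openBody V)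
    (hsr : orient p q (s.pt r) = 0) (hdst : dst < 18) :
    Ensures L (farRatio r dst) s fun s' =>
      Agree 12 dst s s' ∧ s'.reg dst = expFunk m V (s.pt 12) (s.pt r) := by
  have hfm := hs.lt_size
  have hfb := hs.crossing.lt
  have hbm := hs.crossing.lt_add
  refine .seq (.binarySearch (a := 18) (l₀ := b) (h₀ := f + m + 1)
    (fun l h _ => ExitBracket V p q (s.pt r) (s.pt 12) (s.pt 12) l h) (fun _ _ hI => hI)
    (by simp [IExp.eval, hs.finish]) (by simp [IExp.eval, hs.start, hs.size]) (by omega) (by omega)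
    (.of_crossing hs.poly hs.crossing hrb hsr hz.le hz.le) ?_) ?_
  · intro l mid h s₁ hl hlmid hmidh hh hag hmid hI
    refine ((hs.of_agree hag (by omega) (by omega)).ensures_loadVertex hs.poly hmid (by omega)
      (by omega)).imp fun s₂ ⟨hag', hpt⟩ => ⟨hag'.mono (by omega) le_rfl, ?_⟩
    have hright := hs.poly.right_vertex hs.crossing (hl.trans_lt hlmid) (by omega)
    have hag₂ := hag.trans hag' (by omega) le_rfl
    simp only [BExp.Holds, BExp.pos_holds, orientE_eval, hpt, hag₂.pt (x := 12) (by omega),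
      hag₂.pt (x := r) (by omega), not_lt, not_le]
    exact ⟨fun hmid => hI.set_lower hs.poly hright hmid hmid,
      fun hmid => hI.set_upper hs.poly (by omega) hright hmid.le hmid.le⟩
  · rintro s₁ ⟨hag, l, hbl, hlm, hlo, -, hI⟩
    refine ((hs.of_agree hag (by omega) (by omega)).ensures_sideRatio hs.poly hlo (by omega)
      (by omega) (by omega) (by omega) hdst).imp fun s₂ ⟨hag', hval⟩ =>
        ⟨(hag.mono le_rfl hdst.le).trans hag' (by omega) le_rfl, ?_⟩
    rw [hval, hag.pt (by omega), hag.pt (by omega),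
      hI.expFunk_eq hs.poly hrb hsr hz.le hz.le (by linarith) (left_mem_segment ℝ _ _)]

theorem ensures_balanceProg (hs : CrossedLayout m V p q f b s) (hL : 2 * m + 2 ≤ 2 ^ L)
    (hi : s.idx 7 = i) (him : i + 1 < 3 * m) (hz : 0 < orient p q (s.pt 12)) :
    Ensures L balanceProg s fun s' =>
      Agree 12 16 s s' ∧ s'.reg 17 = balance m V p q i (s.pt 12) := by
  refine .seq (hs.ensures_farRatio hL hz (by omega) (hs.pt_zero ▸ hs.p_mem)
    (by rw [hs.pt_zero, orient_self_left]) (by omega)) fun s₁ ⟨hag₁, hval₁⟩ => ?_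
  have hs₁ := hs.of_agree hag₁ (by omega) (by omega)
  have hz₁ : s₁.pt 12 = s.pt 12 := hag₁.pt (by omega)
  refine .seq (hs₁.ensures_farRatio hL (hz₁ ▸ hz) (by omega) (hs₁.pt_two ▸ hs.q_mem)
    (by rw [hs₁.pt_two, orient_self_right]) (by omega)) fun s₂ ⟨hag, hval₂⟩ => ?_
  have hag₂ := hag₁.trans hag le_rfl (by omega)
  refine ((hs.of_agree hag₂ (by omega) (by omega)).ensures_weightedDiff hs.poly
    ((hag₂.idx 7 (by omega)).trans hi) him (by omega)).imp fun s₃ ⟨hag₃, hval⟩ =>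
      ⟨hag₂.trans hag₃ (by omega) (by omega), ?_⟩
  rw [hval, hag.reg 16 (by omega), hval₁, hval₂, hz₁, hs.pt_zero, hs₁.pt_two, balance]

end CrossedLayout

end HilbertPlane

/-! ### Locating the limit point on one side -/

namespace HilbertPlane

open RealRAM

theorem div_sub_mem_Ioo {a b : ℝ} (h : a * b < 0) : a / (a - b) ∈ Set.Ioo 0 1 := by
  rcases mul_neg_iff.1 h with ⟨ha, hb⟩ | ⟨ha, hb⟩
  · exact ⟨div_pos ha (by linarith), (div_lt_one (by linarith)).2 (by linarith)⟩
  · exact ⟨div_pos_of_neg_of_neg ha (by linarith),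
      (div_lt_one_of_neg (by linarith)).2 (by linarith)⟩

theorem orient_lineMap_div_sub_eq_zero {x y r u : Plane}
    (h : orient x r u - orient y r u ≠ 0) :
    orient (AffineMap.lineMap x y (orient x r u / (orient x r u - orient y r u))) r u = 0 := by
  rw [orient_lineMap_left]
  field_simp
  ring

/-- The search for a limit point on the side `i` and for the side through which the rays towards
`r` leave the polygon: the segment from `zl` to `zh`, which lies in `K`, brackets the former, and
`lo` and `hi` bracket the latter. -/
structure SegmentBracket (m : ℕ) (V : ℕ → Plane) (p q r : Plane) (i : ℕ) (K : Set Plane)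
    (zl zh : Plane) (lo hi : ℕ) : Prop where
  root : RootBracket m V p q i zl zh
  subset : segment ℝ zl zh ⊆ K
  exit : ExitBracket V p q r zl zh lo hi

namespace SegmentBracket

variable {m i lo hi : ℕ} {V : ℕ → Plane} {p q r zl zh : Plane} {K : Set Plane} {t : ℝ}

theorem shrink_left (h : SegmentBracket m V p q r i K zl zh lo hi) (ht : t ∈ Set.Ioo 0 1)
    (hbal : 0 ≤ balance m V p q i (AffineMap.lineMap zl zh t)) :
    SegmentBracket m V p q r i K (AffineMap.lineMap zl zh t) zh lo hi where
  root := h.root.shrink_left ht.1 ht.2 hbal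
  subset := ((convex_segment zl zh).segment_subset
    (lineMap_mem_segment ℝ zl zh (Set.Ioo_subset_Icc_self ht)) (right_mem_segment ℝ _ _)).trans
    h.subset
  exit := by simpa using h.exit.mono ht.1.le ht.2.le zero_le_one le_rfl

theorem shrink_right (h : SegmentBracket m V p q r i K zl zh lo hi) (ht : t ∈ Set.Ioo 0 1)
    (hbal : balance m V p q i (AffineMap.lineMap zl zh t) ≤ 0) :
    SegmentBracket m V p q r i K zl (AffineMap.lineMap zl zh t) lo hi where
  root := h.root.shrink_right ht.1 ht.2 hbal
  subset := ((convex_segment zl zh).segment_subset (left_mem_segment ℝ _ _)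
    (lineMap_mem_segment ℝ zl zh (Set.Ioo_subset_Icc_self ht))).trans h.subset
  exit := by simpa using h.exit.mono le_rfl zero_le_one ht.1.le ht.2.le

end SegmentBracket

/-- If the line through the points `14` and `r` separates the points `8` and `10`, replaces one of
them by the intersection point, so that the segment between them still contains a limit point. -/
def shrinkProg (r : ℕ) : Prog :=
  .ite (.neg (.mul (orientE 8 r 14) (orientE 10 r 14)))
    (.seq (.setR 16 (.div (orientE 8 r 14) (.sub (orientE 8 r 14) (orientE 10 r 14)))) <|
    .seq (interpolate 12 8 10 16) <|
    .seq balanceProg <|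
    .ite (.neg (.var 17)) (copyPt 10 12) (copyPt 8 12))
    .skip

/-- Shrinks the segment between the points `8` and `10` until all rays from it through the point `r`
leave the polygon through one side, whose index is stored in the index register `9`. -/
def exitProg (r : ℕ) : Prog :=
  binarySearch 9 (.var 2) (.add (.add (.var 1) (.var 0)) (.lit 1))
    (.seq (loadVertex 11 14) (shrinkProg r))
    (.and (.not (.pos (orientE 8 r 14))) (.not (.pos (orientE 10 r 14))))

/-- Stores in the real register `dst` the affine function that is the balance on the segment
between the points `8` and `10`, evaluated at the point `z`. The rays through `p` and `q` leave the
polygon through the sides in the index registers `8` and `9`. -/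
def affineBalance (z dst : ℕ) : Prog :=
  .seq (sideRatio 8 z 0 16) <| .seq (sideRatio 9 z 2 17) <| weightedDiff dst

/-- Replaces the point `8` by the limit point on the segment between the points `8` and `10` of the
side in the index register `7`. -/
def rootProg : Prog :=
  .seq (exitProg 0) <| .seq (.setI 8 (.var 9)) <| .seq (exitProg 2) <|
  .seq (affineBalance 8 14) <| .seq (affineBalance 10 15) <|
  .seq (.setR 16 (.div (.var 14) (.sub (.var 14) (.var 15)))) <|
  interpolate 8 8 10 16

theorem Layout.ensures_affineBalance {L m i j k z dst : ℕ} {V : ℕ → Plane} {p q : Plane} {s : State}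
    (hs : Layout m V p q s) (hV : CyclicPolygon m V) (hi : s.idx 7 = i) (him : i + 1 < 3 * m)
    (hj : s.idx 8 = j) (hjm : j + 1 < 3 * m) (hk : s.idx 9 = k) (hkm : k + 1 < 3 * m)
    (hz : z < 15) (hdst : dst < 16) :
    Ensures L (affineBalance z dst) s fun s' => Agree 15 dst s s' ∧
      s'.reg dst = side V i p * (side V j (s.pt z) / side V j p) -
        side V i q * (side V k (s.pt z) / side V k q) := by
  refine .seq (hs.ensures_sideRatio hV hj (by omega) hjm (by omega) (by omega) (by omega))
    fun s₁ ⟨hag₁, hval₁⟩ => ?_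
  have hs₁ := hs.of_agree hag₁ (by omega) (by omega)
  refine .seq (hs₁.ensures_sideRatio hV ((hag₁.idx 9 (by omega)).trans hk) (by omega) hkm
    (by omega) (by omega) (by omega)) fun s₂ ⟨hag, hval₂⟩ => ?_
  have hag₂ := hag₁.trans hag le_rfl (by omega)
  refine ((hs.of_agree hag₂ (by omega) (by omega)).ensures_weightedDiff hV
    ((hag₂.idx 7 (by omega)).trans hi) him (by omega)).imp fun s₃ ⟨hag₃, hval⟩ =>
      ⟨(hag₂.mono le_rfl hdst.le).trans hag₃ le_rfl le_rfl, ?_⟩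
  rw [hval, hag.reg 16 (by omega), hval₁, hval₂, hag₁.pt (by omega), hs.pt_zero, hs₁.pt_two]

namespace CrossedLayout

variable {L m f b i lo up r : ℕ} {V : ℕ → Plane} {p q : Plane} {K : Set Plane} {s : State}

theorem ensures_shrinkProg (hs : CrossedLayout m V p q f b s) (hL : 2 * m + 2 ≤ 2 ^ L)
    (hi : s.idx 7 = i) (him : i + 1 < 3 * m) {w : Plane}
    (hbr : SegmentBracket m V p q w i K (s.pt 8) (s.pt 10) lo up) (hw : s.pt r = w) :
    Ensures L (shrinkProg r) s fun s' => Agree 12 8 s s' ∧ s'.pt 14 = s.pt 14 ∧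
      SegmentBracket m V p q w i K (s'.pt 8) (s'.pt 10) lo up ∧
      0 ≤ orient (s'.pt 8) w (s.pt 14) * orient (s'.pt 10) w (s.pt 14) := by
  subst hw
  refine .ite (fun hneg => .seq_setR (.seq (P := (· = _)) (.interpolate (by omega) (by omega)
    (by omega) rfl) ?_)) fun hnonneg =>
      .skip ⟨.refl s, rfl, hbr, by simpa [RExp.eval] using hnonneg⟩
  rintro s₁ hs₁
  simp only [BExp.neg_holds, RExp.eval, orientE_eval] at hneg
  have ht := div_sub_mem_Ioo hneg
  have hcut := orient_lineMap_div_sub_eq_zero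
    (sub_ne_zero.2 fun heq => (heq ▸ hneg).not_ge (mul_self_nonneg _))
  set t := orient (s.pt 8) (s.pt r) (s.pt 14) /
    (orient (s.pt 8) (s.pt r) (s.pt 14) - orient (s.pt 10) (s.pt r) (s.pt 14))
  have hag₁ : Agree 12 12 s s₁ := hs₁ ▸ ((Agree.refl s).setR (by omega)).setPt le_rfl
  have hz₁ : s₁.pt 12 = AffineMap.lineMap (s.pt 8) (s.pt 10) t := by
    rw [hs₁, State.setPt_pt_self, State.setR_pt_of_ne _ _ (by omega) (by omega),
      State.setR_pt_of_ne _ _ (by omega) (by omega), State.setR_reg, if_pos rfl]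
    rfl
  have hw₁ : s₁.pt 14 = s.pt 14 := by
    rw [hs₁, State.setPt_pt_of_ne _ _ (by omega), State.setR_pt_of_ne _ _ (by omega) (by omega)]
  have hpos : 0 < orient p q (s₁.pt 12) := hz₁ ▸ orient_lineMap_pos hbr.root.orient_left
    hbr.root.orient_right hbr.root.orient_pos ht.1 ht.2
  refine .seq ((hs.of_agree hag₁ (by omega) (by omega)).ensures_balanceProg hL
    ((hag₁.idx 7 (by omega)).trans hi) him hpos) fun s₂ ⟨hag, hbal⟩ => ?_
  have hag₂ := hag₁.trans hag le_rfl (by omega)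
  have hz₂ := (hag.pt (by omega)).trans hz₁
  have hw₂ := (hag.pt (by omega)).trans hw₁
  refine .ite (fun hb => .copyPt (by omega) ⟨(hag₂.mono le_rfl (by omega)).setPt (by omega), ?_⟩)
    fun hb => .copyPt (by omega) ⟨(hag₂.mono le_rfl (by omega)).setPt le_rfl, ?_⟩
  all_goals
    simp only [BExp.neg_holds, RExp.eval, hbal, not_lt, hz₁] at hb
    simp only [State.setPt_pt_self, State.setPt_pt_of_ne, hag₂.pt, Nat.reduceAdd, Nat.reduceLT,
      or_true, true_or, hw₂, hz₂, hcut, mul_zero, zero_mul, le_refl, and_true, true_and]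
  · exact hbr.shrink_right ht hb.le
  · exact hbr.shrink_left ht hb

theorem ensures_exitProg (hs : CrossedLayout m V p q f b s) (hL : 2 * m + 2 ≤ 2 ^ L)
    (hi : s.idx 7 = i) (him : i + 1 < 3 * m) (hr : r < 3) (hrb : s.pt r ∈ openBody V)
    (hsr : orient p q (s.pt r) = 0) (hroot : RootBracket m V p q i (s.pt 8) (s.pt 10)) :
    Ensures L (exitProg r) s fun s' => Agree 9 8 s s' ∧ ∃ j, s'.idx 9 = j ∧ j + 1 < 3 * m ∧
      RootBracket m V p q i (s'.pt 8) (s'.pt 10) ∧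
      segment ℝ (s'.pt 8) (s'.pt 10) ⊆ segment ℝ (s.pt 8) (s.pt 10) ∧
      ∀ z ∈ segment ℝ (s'.pt 8) (s'.pt 10),
        expFunk m V z (s.pt r) = side V j z / side V j (s.pt r) := by
  have hfm := hs.lt_size
  have hfb := hs.crossing.lt
  have hbm := hs.crossing.lt_add
  refine (Ensures.binarySearch (a := 8) (l₀ := b) (h₀ := f + m + 1)
    (fun l h s' => SegmentBracket m V p q (s.pt r) i (segment ℝ (s.pt 8) (s.pt 10))
      (s'.pt 8) (s'.pt 10) l h) (fun _ _ hI => hI)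
    (by simp [IExp.eval, hs.finish]) (by simp [IExp.eval, hs.start, hs.size]) (by omega) (by omega)
    ⟨hroot, subset_rfl,
      .of_crossing hs.poly hs.crossing hrb hsr hroot.orient_left hroot.orient_right⟩ ?_).imp ?_
  · intro l mid h s₁ hl hlmid hmidh hh hag hmid hI
    refine .seq ((hs.of_agree hag (by omega) (by omega)).ensures_loadVertex hs.poly hmid (by omega)
      (by omega)) fun s₂ ⟨hag', hpt⟩ => ?_
    have hag₂ := hag.trans hag' (by omega) (by omega)
    rw [← hag'.pt (x := 8) (by omega), ← hag'.pt (x := 10) (by omega)] at hI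
    refine ((hs.of_agree hag₂ (by omega) (by omega)).ensures_shrinkProg hL
      ((hag₂.idx 7 (by omega)).trans hi) him hI (hag₂.pt (by omega))).imp
      fun s₃ ⟨hag₃, hpt₃, hI₃, hnonneg⟩ =>
        ⟨(hag'.mono (by omega) (by omega)).trans hag₃ le_rfl le_rfl, ?_⟩
    have hright := hs.poly.right_vertex hs.crossing (hl.trans_lt hlmid) (by omega)
    rw [hpt] at hpt₃ hnonneg
    simp only [BExp.Holds, BExp.pos_holds, orientE_eval, hpt₃, hag₃.pt (x := r) (by omega),
      hag₂.pt (x := r) (by omega), not_lt]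
    refine ⟨fun hneg => ⟨hI₃.root, hI₃.subset, hI₃.exit.set_lower hs.poly hright hneg.1 hneg.2⟩,
      fun hneg => ?_⟩
    obtain ⟨hl, hh⟩ := (mul_nonneg_iff.1 hnonneg).resolve_right hneg
    exact ⟨hI₃.root, hI₃.subset, hI₃.exit.set_upper hs.poly (by omega) hright hl hh⟩
  · rintro s₁ ⟨hag, l, hbl, hlm, hlo, -, hI⟩
    exact ⟨hag, l, hlo, by omega, hI.root, hI.subset, fun z hz => hI.exit.expFunk_eq hs.poly hrb hsr
      hI.root.orient_left hI.root.orient_right hI.root.orient_pos hz⟩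

theorem ensures_rootProg (hs : CrossedLayout m V p q f b s) (hL : 2 * m + 2 ≤ 2 ^ L)
    (hi : s.idx 7 = i) (him : i + 1 < 3 * m)
    (hroot : RootBracket m V p q i (s.pt 8) (s.pt 10)) :
    Ensures L rootProg s fun s' => Agree 8 8 s s' ∧ s'.pt 8 ∈ bisectorEnds (body V) p q ∧
      0 < orient p q (s'.pt 8) := by
  refine .seq (hs.ensures_exitProg hL hi him (by omega) (hs.pt_zero ▸ hs.p_mem)
    (by rw [hs.pt_zero, orient_self_left]) hroot)
    fun s₁ ⟨hag, j, hj, hjm, hroot₁, _, hexp₁⟩ => .seq_setI ?_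
  rw [hs.pt_zero] at hexp₁
  have hag₁ : Agree 8 8 s (s₁.setI 8 ((IExp.var 9).eval s₁)) :=
    (hag.mono (by omega) le_rfl).setI le_rfl
  have hs₁ := hs.of_agree hag₁ (by omega) (by omega)
  refine .seq (hs₁.ensures_exitProg hL ((hag₁.idx 7 (by omega)).trans hi) him (by omega)
    (hs₁.pt_two ▸ hs.q_mem) (by rw [hs₁.pt_two, orient_self_right]) hroot₁)
    fun s₂ ⟨hag, k, hk, hkm, hroot₂, hseg₂, hexp₂⟩ => ?_
  rw [hs₁.pt_two] at hexp₂
  have hag₂ := hag₁.trans hag (by omega) le_rfl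
  have hs₂ := hs.of_agree hag₂ (by omega) (by omega)
  have hi₂ : s₂.idx 7 = i := (hag₂.idx 7 (by omega)).trans hi
  have hj₂ : s₂.idx 8 = j := (hag.idx 8 (by omega)).trans (by simp [IExp.eval, hj])
  refine .seq (hs₂.ensures_affineBalance hs.poly hi₂ him hj₂ hjm hk hkm (by omega) (by omega))
    fun s₃ ⟨hag₃, hval₃⟩ => ?_
  refine .seq ((hs₂.of_agree hag₃ (by omega) (by omega)).ensures_affineBalance hs.poly
    ((hag₃.idx 7 (by omega)).trans hi₂) him ((hag₃.idx 8 (by omega)).trans hj₂) hjm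
    ((hag₃.idx 9 (by omega)).trans hk) hkm (by omega) (by omega)) fun s₄ ⟨hag, hval₄⟩ => .seq_setR
      (.interpolate (by omega) (by omega) (by omega) ?_)
  have hag₄ := hag₃.trans hag le_rfl (by omega)
  rw [← hag.reg 14 (by omega)] at hval₃
  rw [hag₃.pt (by omega)] at hval₄
  have hends := hroot₂.root_mem_bisectorEnds hs.poly hs.p_mem hs.q_mem hs.ne
    (fun z hz => hexp₁ z (hseg₂ hz)) hexp₂ hval₃ hval₄
  refine ⟨((hag₂.trans hag₄ (by omega) (by omega)).setR (by omega)).setPt le_rfl, ?_⟩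
  rw [State.setPt_pt_self, State.setR_pt_of_ne _ _ (by omega) (by omega),
    State.setR_pt_of_ne _ _ (by omega) (by omega), State.setR_reg, if_pos rfl,
    hag₄.pt (by omega), hag₄.pt (by omega)]
  exact hends

end CrossedLayout

end HilbertPlane

/-! ### The limit point to the left of the line -/

namespace HilbertPlane

open RealRAM

/-- The point where the line `pq` meets the line through the side `i` (`p` if they are parallel). -/
noncomputable def sideCrossing (V : ℕ → Plane) (p q : Plane) (i : ℕ) : Plane :=
  AffineMap.lineMap p q (side V i p / (side V i p - side V i q))

/-- The first point, counterclockwise, of the part of the side `i` to the left of `pq`, if the line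
enters at the side `f`. -/
noncomputable def leftPartStart (V : ℕ → Plane) (p q : Plane) (f i : ℕ) : Plane :=
  if f < i then V i else sideCrossing V p q i

/-- The last point, counterclockwise, of the part of the side `i` to the left of `pq`, if the line
leaves at the side `b`. -/
noncomputable def leftPartEnd (V : ℕ → Plane) (p q : Plane) (b i : ℕ) : Plane :=
  if b < i + 1 then sideCrossing V p q i else V (i + 1)

section SideEnds

variable {m i f b : ℕ} {V : ℕ → Plane} {p q : Plane}

theorem CyclicPolygon.sideCrossing_mem (hV : CyclicPolygon m V) (hpq : p ≠ q)
    (hi : orient p q (V i) * orient p q (V (i + 1)) ≤ 0)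
    (hne : orient p q (V i) ≠ orient p q (V (i + 1))) :
    sideCrossing V p q i ∈ body V ∧ side V i (sideCrossing V p q i) = 0 ∧
      orient p q (sideCrossing V p q i) = 0 := by
  obtain ⟨g, hg, hside, horient⟩ := hV.exists_crossing_point hi
  have hparallel : side V i p - side V i q ≠ 0 := by
    rw [side_sub_side]
    exact sub_ne_zero.2 hne.symm
  obtain ⟨t, rfl⟩ := exists_lineMap_eq hpq horient
  suffices ht : t = side V i p / (side V i p - side V i q) by
    rw [sideCrossing, ← ht]
    exact ⟨hg, hside, horient⟩
  rw [side_lineMap] at hside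
  rw [eq_div_iff hparallel]
  linarith

namespace Crossing

theorem leftPartStart_mem (hc : Crossing m V p q f b) (hV : CyclicPolygon m V)
    (hp : p ∈ openBody V) (hq : q ∈ openBody V) (hpq : p ≠ q) (hfi : f ≤ i) (hib : i ≤ b)
    (hlo : i = f ∨ 0 < balance m V p q i (V i)) :
    leftPartStart V p q f i ∈ body V ∧ side V i (leftPartStart V p q f i) = 0 ∧
      0 ≤ orient p q (leftPartStart V p q f i) ∧
      (f < i → 0 < orient p q (leftPartStart V p q f i)) ∧
      0 ≤ balance m V p q i (leftPartStart V p q f i) := by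
  rcases hfi.lt_or_eq with hlt | rfl
  · have hpos := hV.left_vertex hc hlt hib
    rw [leftPartStart, if_pos hlt]
    exact ⟨hV.vertex_mem i, side_left V i, hpos.le, fun _ => hpos, (hlo.resolve_left hlt.ne').le⟩
  · obtain ⟨hbody, hside, horient⟩ := hV.sideCrossing_mem (i := f) hpq
      (mul_nonpos_of_nonpos_of_nonneg hc.start_nonpos hc.start_pos.le)
      (hc.start_nonpos.trans_lt hc.start_pos).ne
    rw [leftPartStart, if_neg (lt_irrefl f)]
    refine ⟨hbody, hside, horient.ge, fun h => absurd h (lt_irrefl f),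
      (hV.balance_pos_of_line hp hq hpq horient hside ?_).le⟩
    linarith [side_sub_side V f p q, hc.start_nonpos, hc.start_pos]

theorem leftPartEnd_mem (hc : Crossing m V p q f b) (hV : CyclicPolygon m V)
    (hp : p ∈ openBody V) (hq : q ∈ openBody V) (hpq : p ≠ q) (hfi : f ≤ i) (hib : i ≤ b)
    (hhi : i = b ∨ balance m V p q i (V (i + 1)) < 0) :
    leftPartEnd V p q b i ∈ body V ∧ side V i (leftPartEnd V p q b i) = 0 ∧
      0 ≤ orient p q (leftPartEnd V p q b i) ∧
      (i < b → 0 < orient p q (leftPartEnd V p q b i)) ∧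
      balance m V p q i (leftPartEnd V p q b i) ≤ 0 := by
  rcases hib.lt_or_eq with hlt | rfl
  · have hpos := hV.left_vertex hc (j := i + 1) (by omega) hlt
    rw [leftPartEnd, if_neg (by omega)]
    exact ⟨hV.vertex_mem _, side_right V i, hpos.le, fun _ => hpos, (hhi.resolve_left hlt.ne).le⟩
  · obtain ⟨hbody, hside, horient⟩ := hV.sideCrossing_mem (i := i) hpq
      (mul_nonpos_of_nonneg_of_nonpos hc.end_pos.le hc.end_nonpos)
      (hc.end_nonpos.trans_lt hc.end_pos).ne'
    rw [leftPartEnd, if_pos (by omega)]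
    refine ⟨hbody, hside, horient.ge, fun h => absurd h (lt_irrefl i),
      (hV.balance_neg_of_line hp hq hpq horient hside ?_).le⟩
    linarith [side_sub_side V i p q, hc.end_nonpos, hc.end_pos]

theorem rootBracket (hc : Crossing m V p q f b) (hV : CyclicPolygon m V)
    (hp : p ∈ openBody V) (hq : q ∈ openBody V) (hpq : p ≠ q) (hfi : f ≤ i) (hib : i ≤ b)
    (hlo : i = f ∨ 0 < balance m V p q i (V i))
    (hhi : i = b ∨ balance m V p q i (V (i + 1)) < 0) :
    RootBracket m V p q i (leftPartStart V p q f i) (leftPartEnd V p q b i) := by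
  obtain ⟨hl, hside_l, hl0, hlpos, hbal_l⟩ := hc.leftPartStart_mem hV hp hq hpq hfi hib hlo
  obtain ⟨hh, hside_h, hh0, hhpos, hbal_h⟩ := hc.leftPartEnd_mem hV hp hq hpq hfi hib hhi
  refine ⟨hl, hh, hside_l, hside_h, hl0, hh0, ?_, hbal_l, hbal_h⟩
  rcases hfi.lt_or_eq with hlt | rfl
  · exact add_pos_of_pos_of_nonneg (hlpos hlt) hh0
  · exact add_pos_of_nonneg_of_pos hl0 (hhpos hc.lt)

end Crossing

end SideEnds

/-- Stores in the point `6` the point where `pq` meets the line through the side in the index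
register `7`. -/
def crossingProg : Prog :=
  .seq (loadSide 7) <|
  .seq (.setR 16 (.div (orientE 18 20 0) (.sub (orientE 18 20 0) (orientE 18 20 2)))) <|
  interpolate 6 0 2 16

/-- Stores in the points `8` and `10` the ends of the part to the left of `pq` of the side in the
index registers `5` and `7`, whose successor is in the index register `6`. -/
def sideEndsProg : Prog :=
  .seq crossingProg <|
  .seq (.ite (.ltI (.var 1) (.var 5)) (loadVertex 5 8) (copyPt 8 6)) <|
  .ite (.ltI (.var 2) (.var 6)) (copyPt 10 6) (loadVertex 6 10)

/-- Binary search, into the index registers `5` and `6`, for two consecutive vertices to the left of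
`pq` between which the balance changes its sign. -/
def vertexSearch : Prog :=
  binarySearch 5 (.var 1) (.add (.var 2) (.lit 1)) (.seq (loadVertex 7 12) balanceProg)
    (.pos (.var 17))

/-- Stores in the point `12` the last vertex of the side in the index register `7`, and its balance
for this side in the real register `17`, where a vertex that is not to the left of `pq` counts as
having a negative balance. -/
def lastVertexBalance : Prog :=
  .ite (.ltI (.var 2) (.var 6)) (.setR 17 (.lit (-1))) (.seq (loadVertex 6 12) balanceProg)

/-- Finds the limit point to the left of `pq` and stores it in the point `8`. -/
def leftProg : Prog :=
  .seq vertexSearch <| .seq (.setI 7 (.var 5)) <| .seq lastVertexBalance <|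
  .ite (.neg (.var 17)) (.seq sideEndsProg rootProg) (copyPt 8 12)

theorem Layout.ensures_crossingProg {L m i : ℕ} {V : ℕ → Plane} {p q : Plane} {s : State}
    (hs : Layout m V p q s) (hV : CyclicPolygon m V) (hi : s.idx 7 = i) (him : i + 1 < 3 * m) :
    Ensures L crossingProg s fun s' => Agree 15 6 s s' ∧ s'.pt 6 = sideCrossing V p q i := by
  refine .seq (hs.ensures_loadSide hV hi (by omega) him) fun s₁ ⟨hag, hpt, hpt'⟩ =>
    .seq_setR (.interpolate (by omega) (by omega) (by omega)
      ⟨((hag.mono le_rfl (by omega)).setR (by omega)).setPt le_rfl, ?_⟩)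
  have hs₁ := hs.of_agree hag (by omega) (by omega)
  simp only [State.setPt_pt_self, State.setR_pt_of_ne, State.setR_reg, if_true, RExp.eval,
    orientE_eval, hpt, hpt', hs₁.pt_zero, hs₁.pt_two, sideCrossing, side, ne_eq,
    Nat.reduceEqDiff, Nat.reduceAdd, not_false_eq_true]

namespace CrossedLayout

variable {L m f b i : ℕ} {V : ℕ → Plane} {p q : Plane} {s : State}

theorem ensures_sideEndsProg (hs : CrossedLayout m V p q f b s) (h5 : s.idx 5 = i)
    (h6 : s.idx 6 = i + 1) (h7 : s.idx 7 = i) (him : i + 1 < 3 * m) :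
    Ensures L sideEndsProg s fun s' => Agree 15 6 s s' ∧
      s'.pt 8 = leftPartStart V p q f i ∧ s'.pt 10 = leftPartEnd V p q b i := by
  refine .seq (hs.ensures_crossingProg hs.poly h7 him) fun s₁ ⟨hag₁, hz₁⟩ => ?_
  have hs₁ := hs.of_agree hag₁ (by omega) (by omega)
  have hstart : Ensures L (.ite (.ltI (.var 1) (.var 5)) (loadVertex 5 8) (copyPt 8 6)) s₁
      fun s' => Agree 15 8 s₁ s' ∧ s'.pt 8 = leftPartStart V p q f i := by
    have h5₁ := (hag₁.idx 5 (by omega)).trans h5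
    have htest : (BExp.ltI (.var 1) (.var 5)).Holds s₁ ↔ f < i := by
      simp only [BExp.Holds, IExp.eval, hs₁.start, h5₁]
    refine .ite (fun hb => ?_) fun hb => .copyPt (by omega) ⟨(Agree.refl s₁).setPt le_rfl, ?_⟩
    · rw [leftPartStart, if_pos (htest.1 hb)]
      exact (hs₁.ensures_loadVertex hs.poly h5₁ (by omega) (by omega)).imp
        fun s' ⟨hag, hpt⟩ => ⟨hag.mono (by omega) le_rfl, hpt⟩
    · rw [State.setPt_pt_self, hz₁, leftPartStart, if_neg (htest.not.1 hb)]
  refine .seq hstart fun s₂ ⟨hag, hstart₂⟩ => ?_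
  have hag₂ := hag₁.trans hag le_rfl (by omega)
  have hs₂ := hs.of_agree hag₂ (by omega) (by omega)
  have hz₂ := (hag.pt (by omega)).trans hz₁
  have h6₂ := (hag₂.idx 6 (by omega)).trans h6
  have htest : (BExp.ltI (.var 2) (.var 6)).Holds s₂ ↔ b < i + 1 := by
    simp only [BExp.Holds, IExp.eval, hs₂.finish, h6₂]
  refine .ite (fun hb => .copyPt (by omega) ⟨hag₂.setPt (by omega), ?_, ?_⟩) fun hb => ?_
  · rw [State.setPt_pt_of_ne _ _ (by omega), hstart₂]
  · rw [State.setPt_pt_self, hz₂, leftPartEnd, if_pos (htest.1 hb)]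
  · rw [leftPartEnd, if_neg (htest.not.1 hb)]
    exact (hs₂.ensures_loadVertex hs.poly h6₂ him (by omega)).imp fun s' ⟨hag, hpt⟩ =>
      ⟨hag₂.trans hag (by omega) (by omega), (hag.pt (by omega)).trans hstart₂, hpt⟩

theorem ensures_loadVertex_balanceProg (hs : CrossedLayout m V p q f b s) {j k : ℕ}
    (hL : 2 * m + 2 ≤ 2 ^ L) (hj : s.idx j = k) (hfk : f < k) (hkb : k ≤ b) (hi : s.idx 7 = i)
    (him : i + 1 < 3 * m) :
    Ensures L (.seq (loadVertex j 12) balanceProg) s fun s' => Agree 12 12 s s' ∧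
      s'.pt 12 = V k ∧ s'.reg 17 = balance m V p q i (V k) := by
  have hfm := hs.lt_size
  have hbm := hs.crossing.lt_add
  refine .seq (hs.ensures_loadVertex hs.poly hj (by omega) (by omega)) fun s₁ ⟨hag₁, hpt⟩ => ?_
  rw [← hpt]
  refine ((hs.of_agree hag₁ (by omega) (by omega)).ensures_balanceProg hL
    ((hag₁.idx 7 (by omega)).trans hi) him (hpt ▸ hs.poly.left_vertex hs.crossing hfk hkb)).imp
    fun s₂ ⟨hag, hval⟩ =>
      ⟨(hag₁.mono (by omega) le_rfl).trans hag le_rfl (by omega), hag.pt (by omega), hval⟩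

theorem ensures_vertexSearch (hs : CrossedLayout m V p q f b s) (hL : 2 * m + 2 ≤ 2 ^ L) :
    Ensures L vertexSearch s fun s' => Agree 5 12 s s' ∧ ∃ i, f ≤ i ∧ i ≤ b ∧
      s'.idx 5 = i ∧ s'.idx 6 = i + 1 ∧ (i = f ∨ 0 < balance m V p q i (V i)) ∧
      (i = b ∨ balance m V p q (i + 1) (V (i + 1)) ≤ 0) := by
  have hfm := hs.lt_size
  have hfb := hs.crossing.lt
  have hbm := hs.crossing.lt_add
  refine (Ensures.binarySearch (a := 12) (l₀ := f) (h₀ := b + 1)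
    (fun l h _ => (l = f ∨ 0 < balance m V p q l (V l)) ∧
      (h = b + 1 ∨ balance m V p q h (V h) ≤ 0)) (fun _ _ hI => hI)
    (by simp [IExp.eval, hs.start]) (by simp [IExp.eval, hs.finish]) (by omega) (by omega)
    ⟨.inl rfl, .inl rfl⟩ ?_).imp ?_
  · intro l mid h s₁ hl hlmid hmidh hh hag hmid hI
    refine ((hs.of_agree hag (by omega) (by omega)).ensures_loadVertex_balanceProg hL hmid
      (by omega) (by omega) hmid (by omega)).imp fun s₂ ⟨hag', _, hval⟩ =>
        ⟨hag'.mono (by omega) le_rfl, ?_⟩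
    simp only [BExp.pos_holds, RExp.eval, hval, not_lt]
    exact ⟨fun hpos => ⟨.inr hpos, hI.2⟩, fun hneg => ⟨hI.1, .inr hneg⟩⟩
  · rintro s₁ ⟨hag, i, hfi, hib, h5, h6, hlo, hhi⟩
    exact ⟨hag, i, hfi, by omega, h5, h6, hlo, hhi.imp_left (by omega)⟩

theorem ensures_lastVertexBalance (hs : CrossedLayout m V p q f b s) (hL : 2 * m + 2 ≤ 2 ^ L)
    (hfi : f ≤ i) (hib : i ≤ b) (h6 : s.idx 6 = i + 1) (h7 : s.idx 7 = i) :
    Ensures L lastVertexBalance s fun s' => Agree 12 12 s s' ∧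
      (s'.reg 17 < 0 → i = b ∨ balance m V p q i (V (i + 1)) < 0) ∧
      (0 ≤ s'.reg 17 → i < b ∧ 0 ≤ balance m V p q i (V (i + 1)) ∧ s'.pt 12 = V (i + 1)) := by
  have hfm := hs.lt_size
  have hbm := hs.crossing.lt_add
  have htest : (BExp.ltI (.var 2) (.var 6)).Holds s ↔ b < i + 1 := by
    simp only [BExp.Holds, IExp.eval, hs.finish, h6]
  refine .ite (fun hb => .setR ⟨(Agree.refl s).setR (by omega), fun _ => .inl ?_, fun h => ?_⟩)
    fun hb => ?_
  · have := htest.1 hb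
    omega
  · norm_num [RExp.eval] at h
  · have hb := htest.not.1 hb
    refine (hs.ensures_loadVertex_balanceProg hL h6 (by omega) (by omega) h7 (by omega)).imp
      fun s₁ ⟨hag, hpt, hval⟩ => ⟨hag, fun h => .inr (hval ▸ h), fun h => ⟨by omega, hval ▸ h, hpt⟩⟩

theorem ensures_leftProg (hs : CrossedLayout m V p q f b s) (hL : 2 * m + 2 ≤ 2 ^ L) :
    Ensures L leftProg s fun s' => Agree 5 6 s s' ∧ s'.pt 8 ∈ bisectorEnds (body V) p q ∧
      0 < orient p q (s'.pt 8) := by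
  have hfm := hs.lt_size
  have hbm := hs.crossing.lt_add
  refine .seq (hs.ensures_vertexSearch hL) fun s₁ ⟨hag, i, hfi, hib, h5, h6, hlo, hhi⟩ =>
    .seq_setI ?_
  set s₂ := s₁.setI 7 ((IExp.var 5).eval s₁)
  have hag₂ : Agree 5 6 s s₂ := (hag.mono le_rfl (by omega)).setI (by omega)
  have h5₂ : s₂.idx 5 = i := h5
  have h6₂ : s₂.idx 6 = i + 1 := h6
  have h7₂ : s₂.idx 7 = i := h5
  refine .seq ((hs.of_agree hag₂ (by omega) (by omega)).ensures_lastVertexBalance hL hfi hib h6₂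
    h7₂) fun s₃ ⟨hag', hneg, hnonneg⟩ => ?_
  have hag₃ := hag₂.trans hag' (by omega) (by omega)
  refine .ite (fun hb => ?_) fun hb => .copyPt (by omega) ⟨hag₃.setPt (by omega), ?_⟩
  · simp only [BExp.neg_holds, RExp.eval] at hb
    have hs₃ := hs.of_agree hag₃ (by omega) (by omega)
    have h7₃ := (hag'.idx 7 (by omega)).trans h7₂
    refine .seq (hs₃.ensures_sideEndsProg ((hag'.idx 5 (by omega)).trans h5₂)
      ((hag'.idx 6 (by omega)).trans h6₂) h7₃ (by omega)) fun s₄ ⟨hag₄, hstart, hend⟩ => ?_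
    have hroot := hs.crossing.rootBracket hs.poly hs.p_mem hs.q_mem hs.ne hfi hib hlo (hneg hb)
    rw [← hstart, ← hend] at hroot
    exact ((hs₃.of_agree hag₄ (by omega) (by omega)).ensures_rootProg hL
      ((hag₄.idx 7 (by omega)).trans h7₃) (by omega) hroot).imp fun s₅ ⟨hag₅, hends⟩ =>
        ⟨(hag₃.trans hag₄ (by omega) le_rfl).trans hag₅ (by omega) (by omega), hends⟩
  · simp only [BExp.neg_holds, RExp.eval, not_lt] at hb
    obtain ⟨hlt, hbal, hpt⟩ := hnonneg hb
    rw [State.setPt_pt_self, hpt]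
    exact ⟨hs.poly.mem_bisectorEnds hs.p_mem hs.q_mem (hs.poly.vertex_mem _) (side_right V i)
      (side_left V (i + 1)) hbal (hhi.resolve_left hlt.ne),
      hs.poly.left_vertex hs.crossing (by omega) hlt⟩

end CrossedLayout

end HilbertPlane

/-! ### Locating the sides crossed by the line -/

namespace RealRAM.BExp

/-- The test whether two tests have the same outcome. -/
def iff (b c : BExp) : BExp := .and (.not (.and b (.not c))) (.not (.and c (.not b)))

@[simp] theorem iff_holds {b c : BExp} {s : State} :
    (iff b c).Holds s ↔ (b.Holds s ↔ c.Holds s) := by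
  simp only [iff, Holds]
  tauto

end RealRAM.BExp

namespace HilbertPlane

open RealRAM

theorem CyclicPolygon.crossing_of_changes {m t u : ℕ} {V : ℕ → Plane} {p q : Plane} {a : Prop}
    (hV : CyclicPolygon m V) (htu : t < u) (hum : u < t + m)
    (ht : 0 < orient p q (V t) ↔ a) (ht' : ¬ (0 < orient p q (V (t + 1)) ↔ a))
    (hu : ¬ (0 < orient p q (V u) ↔ a)) (hu' : 0 < orient p q (V (u + 1)) ↔ a) :
    (a → Crossing m V p q u (t + m)) ∧ (¬ a → Crossing m V p q t u) := by
  constructor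
  · intro ha
    simp only [ha, iff_true, not_lt] at ht ht' hu hu'
    refine ⟨hum, by omega, hu, hu', by rwa [hV.periodic], ?_⟩
    rwa [add_right_comm, hV.periodic]
  · intro ha
    simp only [ha, iff_false, not_lt, not_le] at ht ht' hu hu'
    exact ⟨htu, hum, ht, ht', hu, hu'⟩

/-- The test whether the point `x` lies on the same side of `pq` as the vertex `0`, which is held in
the point `18`. Points on the line count as lying to its right. -/
def sameSide (x : ℕ) : BExp :=
  .iff (.pos (orientE 0 2 x)) (.pos (orientE 0 2 18))

/-- Loads the vertex `0` into the point `18`, and into the index registers `5` and `6` the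
consecutive vertices between which the ray from the vertex `0` through `p` leaves the polygon. -/
def fanProg : Prog :=
  .seq (.setI 5 (.lit 0)) <| .seq (loadVertex 5 18) <|
  binarySearch 5 (.lit 1) (.sub (.var 0) (.lit 1)) (loadVertex 7 20) (.neg (orientE 18 0 20))

/-- Stores in the index register `4` a vertex on the other side of `pq` than the vertex `0`. -/
def acrossProg : Prog :=
  .seq (loadVertex 5 20) <|
  .ite (.not (sameSide 20)) (.setI 4 (.var 5)) <|
  .seq (loadVertex 6 20) <|
  .ite (.not (sameSide 20)) (.setI 4 (.var 6)) (.setI 4 (.sub (.var 0) (.lit 1)))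

/-- Binary search, into the index register `5`, for a vertex satisfying the test `b` on the point
`20` whose successor does not satisfy it. -/
def changeSearch (e e' : IExp) (b : BExp) : Prog := binarySearch 5 e e' (loadVertex 7 20) b

/-- Stores in the index registers `3` and `5` the vertices whose successors lie on the other side of
`pq`. -/
def changesProg : Prog :=
  .seq fanProg <| .seq acrossProg <|
  .seq (changeSearch (.lit 0) (.var 4) (sameSide 20)) <|
  .seq (.setI 3 (.var 5)) (changeSearch (.var 4) (.var 0) (.not (sameSide 20)))

/-- Stores the sides crossed by `pq` in the index registers `1` and `2`. -/
def crossProg : Prog :=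
  .seq changesProg <|
  .ite (.pos (orientE 0 2 18))
    (.seq (.setI 1 (.var 5)) (.setI 2 (.add (.var 3) (.var 0))))
    (.seq (.setI 1 (.var 3)) (.setI 2 (.var 5)))

/-- Computes the limit point to the left of `pq` and stores it in the point `8`. -/
def limitProg : Prog := .seq crossProg leftProg

/-- Copies the point `8` to `4` and exchanges `p` and `q`. -/
def swapProg : Prog :=
  .seq (copyPt 4 8) <| .seq (copyPt 8 0) <| .seq (copyPt 0 2) (copyPt 2 8)

/-- Computes the limit points to the left and to the right of `pq` and stores them in the points
`0` and `2`. -/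
def mainProg : Prog :=
  .seq limitProg <| .seq swapProg <| .seq limitProg <| .seq (copyPt 0 4) (copyPt 2 8)

namespace Layout

variable {L m : ℕ} {V : ℕ → Plane} {p q : Plane} {s : State}

theorem sameSide_holds (hs : Layout m V p q s) (h18 : s.pt 18 = V 0) (x : ℕ) :
    (sameSide x).Holds s ↔ (0 < orient p q (s.pt x) ↔ 0 < orient p q (V 0)) := by
  simp only [sameSide, BExp.iff_holds, BExp.pos_holds, orientE_eval, hs.pt_zero, hs.pt_two, h18]

theorem ensures_fanProg (hs : Layout m V p q s) (hV : CyclicPolygon m V) (hp : p ∈ openBody V)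
    (hL : 2 * m + 2 ≤ 2 ^ L) :
    Ensures L fanProg s fun s' => Agree 5 18 s s' ∧ s'.pt 18 = V 0 ∧ ∃ c, 1 ≤ c ∧ c + 1 < m ∧
      s'.idx 5 = c ∧ s'.idx 6 = c + 1 ∧ orient (V 0) p (V c) < 0 ∧
      0 ≤ orient (V 0) p (V (c + 1)) := by
  have hm := hV.three_le
  have hag₀ : Agree 5 18 s (s.setI 5 ((IExp.lit 0).eval s)) := (Agree.refl s).setI le_rfl
  refine .seq_setI (.seq ((hs.of_agree hag₀ (by omega) (by omega)).ensures_loadVertex hV (i := 0)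
    (by simp [IExp.eval]) (by omega) (by omega)) fun s₁ ⟨hag, h18⟩ => ?_)
  have hag₁ := hag₀.trans hag (by omega) le_rfl
  have hs₁ := hs.of_agree hag₁ (by omega) (by omega)
  have hfirst : orient (V 0) p (V 1) < 0 := by
    rw [orient_swap_right]
    exact neg_neg_of_pos (hp 0)
  have hlast : 0 ≤ orient (V 0) p (V (m - 1)) := by
    have h := hp (m - 1)
    rw [side, Nat.sub_add_cancel hV.pos, ← zero_add m, hV.periodic, ← orient_rotate] at h
    simpa using h.le
  refine (Ensures.binarySearch (a := 20) (l₀ := 1) (h₀ := m - 1)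
    (fun l h _ => orient (V 0) p (V l) < 0 ∧ 0 ≤ orient (V 0) p (V h)) (fun _ _ hI => hI) rfl
    (by simp [IExp.eval, hs₁.size]) (by omega) (by omega) ⟨hfirst, hlast⟩ ?_).imp ?_
  · intro l mid h s₂ hl hlmid hmidh hh hag₂ hmid hI
    have hs₂ := hs₁.of_agree hag₂ (by omega) (by omega)
    refine (hs₂.ensures_loadVertex hV hmid (by omega) (by omega)).imp fun s₃ ⟨hag₃, hpt⟩ =>
      ⟨hag₃.mono (by omega) le_rfl, ?_⟩
    simp only [BExp.neg_holds, orientE_eval, hpt, (hs₂.of_agree hag₃ (by omega) (by omega)).pt_zero,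
      hag₃.pt (x := 18) (by omega), hag₂.pt (x := 18) (by omega), h18, not_lt]
    exact ⟨fun hneg => ⟨hneg, hI.2⟩, fun hpos => ⟨hI.1, hpos⟩⟩
  · rintro s₂ ⟨hag₂, c, hc, hcm, h5, h6, hneg, hpos⟩
    exact ⟨hag₁.trans hag₂ le_rfl (by omega), (hag₂.pt (by omega)).trans h18, c, hc, by omega, h5,
      h6, hneg, hpos⟩

theorem ensures_acrossProg (hs : Layout m V p q s) (hV : CyclicPolygon m V) (hp : p ∈ openBody V)
    (hpq : p ≠ q) (h18 : s.pt 18 = V 0) {c : ℕ} (hc : 1 ≤ c) (hcm : c + 1 < m) (h5 : s.idx 5 = c)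
    (h6 : s.idx 6 = c + 1) (hneg : orient (V 0) p (V c) < 0)
    (hpos : 0 ≤ orient (V 0) p (V (c + 1))) :
    Ensures L acrossProg s fun s' => Agree 4 20 s s' ∧ ∃ w, 0 < w ∧ w < m ∧ s'.idx 4 = w ∧
      ¬ (0 < orient p q (V w) ↔ 0 < orient p q (V 0)) := by
  refine .seq (hs.ensures_loadVertex hV h5 (by omega) (by omega)) fun s₁ ⟨hag₁, hpt₁⟩ => ?_
  have hs₁ := hs.of_agree hag₁ (by omega) (by omega)
  have h18₁ := (hag₁.pt (by omega)).trans h18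
  have htest₁ := hs₁.sameSide_holds h18₁ 20
  rw [hpt₁] at htest₁
  refine .ite (fun hb => .setI ⟨(hag₁.mono (by omega) le_rfl).setI le_rfl, c, hc, by omega, ?_,
    htest₁.not.1 hb⟩) fun hb => ?_
  · simp [IExp.eval, hag₁.idx 5, h5]
  refine .seq (hs₁.ensures_loadVertex hV ((hag₁.idx 6 (by omega)).trans h6) (by omega) (by omega))
    fun s₂ ⟨hag, hpt₂⟩ => ?_
  have hag₂ : Agree 4 20 s s₂ := (hag₁.trans hag le_rfl le_rfl).mono (by omega) le_rfl
  have hs₂ := hs₁.of_agree hag (by omega) (by omega)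
  have htest₂ := hs₂.sameSide_holds ((hag.pt (by omega)).trans h18₁) 20
  rw [hpt₂] at htest₂
  refine .ite (fun hb' => .setI ⟨hag₂.setI le_rfl, c + 1, by omega, hcm, ?_, htest₂.not.1 hb'⟩)
    fun hb' => .setI ⟨hag₂.setI le_rfl, m - 1, by omega, by omega, ?_, ?_⟩
  · simp [IExp.eval, hag.idx 6, hag₁.idx 6, h6]
  · simp [IExp.eval, hs₂.size]
  · exact ((hV.exists_vertex_across hp hpq hneg hpos).resolve_left
      fun h => hb (htest₁.not.2 h)).resolve_left fun h => hb' (htest₂.not.2 h)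

theorem ensures_changeSearch (hs : Layout m V p q s) (hV : CyclicPolygon m V)
    (hL : 2 * m + 2 ≤ 2 ^ L) {e e' : IExp} {b : BExp} {l h : ℕ} (P : Plane → Prop)
    (hb : ∀ s', Agree 5 20 s s' → (b.Holds s' ↔ P (s'.pt 20))) (he : e.eval s = l)
    (he' : e'.eval (s.setI 5 l) = h) (hlt : l < h) (hm : h ≤ m) (hl : P (V l)) (hh : ¬ P (V h)) :
    Ensures L (changeSearch e e' b) s fun s' => Agree 5 20 s s' ∧ ∃ j, l ≤ j ∧ j < h ∧
      s'.idx 5 = j ∧ P (V j) ∧ ¬ P (V (j + 1)) := by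
  refine (Ensures.binarySearch (a := 20) (l₀ := l) (h₀ := h) (fun l h _ => P (V l) ∧ ¬ P (V h))
    (fun _ _ hI => hI) he he' hlt (by omega) ⟨hl, hh⟩ ?_).imp ?_
  · intro l mid h s₁ _ _ hmidh hh hag hmid hI
    refine ((hs.of_agree hag (by omega) (by omega)).ensures_loadVertex hV hmid (by omega)
      (by omega)).imp fun s₂ ⟨hag', hpt⟩ => ⟨hag'.mono (by omega) le_rfl, ?_⟩
    rw [hb s₂ (hag.trans hag' (by omega) le_rfl), hpt]
    exact ⟨fun hP => ⟨hP, hI.2⟩, fun hP => ⟨hI.1, hP⟩⟩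
  · rintro s₁ ⟨hag, j, hlj, hjh, h5, -, hI⟩
    exact ⟨hag, j, hlj, hjh, h5, hI⟩

theorem ensures_changesProg (hs : Layout m V p q s) (hV : CyclicPolygon m V) (hp : p ∈ openBody V)
    (hpq : p ≠ q) (hL : 2 * m + 2 ≤ 2 ^ L) :
    Ensures L changesProg s fun s' => Agree 3 18 s s' ∧ s'.pt 18 = V 0 ∧
      ∃ t u, t < u ∧ u < m ∧ s'.idx 3 = t ∧ s'.idx 5 = u ∧
        (0 < orient p q (V t) ↔ 0 < orient p q (V 0)) ∧
        ¬ (0 < orient p q (V (t + 1)) ↔ 0 < orient p q (V 0)) ∧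
        ¬ (0 < orient p q (V u) ↔ 0 < orient p q (V 0)) ∧
        (0 < orient p q (V (u + 1)) ↔ 0 < orient p q (V 0)) := by
  refine .seq (hs.ensures_fanProg hV hp hL) fun s₁ ⟨hag₁, h18₁, c, hc, hcm, h5, h6, hneg, hpos⟩ =>
    .seq ((hs.of_agree hag₁ (by omega) (by omega)).ensures_acrossProg hV hp hpq h18₁ hc hcm h5 h6
      hneg hpos) fun s₂ ⟨hag, w, hw, hwm, h4, hacross⟩ => ?_
  have hag₂ : Agree 3 18 s s₂ :=
    (hag₁.mono (by omega) le_rfl).trans hag (by omega) (by omega)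
  have hs₂ := hs.of_agree hag₂ (by omega) (by omega)
  have h18₂ := (hag.pt (by omega)).trans h18₁
  refine .seq (hs₂.ensures_changeSearch hV hL
    (fun z => 0 < orient p q z ↔ 0 < orient p q (V 0)) (fun s' h =>
      (hs₂.of_agree h (by omega) (by omega)).sameSide_holds ((h.pt (by omega)).trans h18₂) 20)
    rfl (by simpa [IExp.eval] using h4) hw hwm.le Iff.rfl hacross)
    fun s₃ ⟨hag, t, _, htw, h5, ht, ht'⟩ => .seq_setI ?_
  set s₄ := s₃.setI 3 ((IExp.var 5).eval s₃)
  have hag' : Agree 3 20 s₂ s₄ := (hag.mono (by omega) le_rfl).setI le_rfl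
  have hs₄ := hs₂.of_agree hag' (by omega) (by omega)
  have h18₄ := (hag'.pt (by omega)).trans h18₂
  have h4₄ : s₄.idx 4 = w := (hag.idx 4 (by omega)).trans h4
  refine (hs₄.ensures_changeSearch hV hL (e := .var 4) (e' := .var 0) (b := .not (sameSide 20))
    (fun z => ¬ (0 < orient p q z ↔ 0 < orient p q (V 0))) (fun s' h =>
      ((hs₄.of_agree h (by omega) (by omega)).sameSide_holds
        ((h.pt (by omega)).trans h18₄) 20).not)
    h4₄ hs₄.size hwm le_rfl hacross (not_not.2 ?_)).imp
    fun s₅ ⟨hag₅, u, hwu, hum, h5₅, hu, hu'⟩ =>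
      ⟨(hag₂.trans hag' le_rfl (by omega)).trans hag₅ (by omega) (by omega),
        (hag₅.pt (by omega)).trans h18₄, t, u, by omega, hum, (hag₅.idx 3 (by omega)).trans h5,
        h5₅, ht, ht', hu, not_not.1 hu'⟩
  rw [← zero_add m, hV.periodic]

theorem ensures_crossProg (hs : Layout m V p q s) (hV : CyclicPolygon m V) (hp : p ∈ openBody V)
    (hq : q ∈ openBody V) (hpq : p ≠ q) (hL : 2 * m + 2 ≤ 2 ^ L) :
    Ensures L crossProg s fun s' => Agree 1 18 s s' ∧ ∃ f b, CrossedLayout m V p q f b s' := by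
  refine .seq (hs.ensures_changesProg hV hp hpq hL)
    fun s₁ ⟨hag, h18, t, u, htu, hum, h3, h5, ht, ht', hu, hu'⟩ => ?_
  have hs₁ := hs.of_agree hag (by omega) (by omega)
  have hcross := hV.crossing_of_changes htu (by omega) ht ht' hu hu'
  have hag₁ : Agree 1 18 s s₁ := hag.mono (by omega) le_rfl
  have htest : (BExp.pos (orientE 0 2 18)).Holds s₁ ↔ 0 < orient p q (V 0) := by
    simp only [BExp.pos_holds, orientE_eval, hs₁.pt_zero, hs₁.pt_two, h18]
  refine .ite (fun hb => .seq_setI (.setI ?_)) fun hb => .seq_setI (.setI ?_)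
  · have hag₂ := (hag₁.setI (i := 1) (n := s₁.idx 5) le_rfl).setI (i := 2)
      (n := s₁.idx 3 + s₁.idx 0) (by omega)
    exact ⟨hag₂, u, t + m, hs.of_agree hag₂ le_rfl (by omega), hV, hp, hq, hpq,
      hcross.1 (htest.1 hb), hum, h5, congrArg₂ _ h3 hs₁.size⟩
  · have hag₂ := (hag₁.setI (i := 1) (n := s₁.idx 3) le_rfl).setI (i := 2)
      (n := s₁.idx 5) (by omega)
    exact ⟨hag₂, t, u, hs.of_agree hag₂ le_rfl (by omega), hV, hp, hq, hpq,
      hcross.2 (htest.not.1 hb), by omega, h3, h5⟩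

theorem ensures_limitProg (hs : Layout m V p q s) (hV : CyclicPolygon m V) (hp : p ∈ openBody V)
    (hq : q ∈ openBody V) (hpq : p ≠ q) (hL : 2 * m + 2 ≤ 2 ^ L) :
    Ensures L limitProg s fun s' => Agree 1 6 s s' ∧ (∃ f b, Crossing m V p q f b) ∧
      s'.pt 8 ∈ bisectorEnds (body V) p q ∧ 0 < orient p q (s'.pt 8) :=
  .seq (hs.ensures_crossProg hV hp hq hpq hL) fun _ ⟨hag₁, f, b, hs₁⟩ =>
    (hs₁.ensures_leftProg hL).imp fun _ ⟨hag₂, hlimit⟩ =>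
      ⟨(hag₁.mono le_rfl (by omega)).trans hag₂ (by omega) le_rfl, ⟨f, b, hs₁.crossing⟩, hlimit⟩

theorem ensures_swapProg (hs : Layout m V p q s) :
    Ensures L swapProg s fun s' => Layout m V q p s' ∧ s'.pt 4 = s.pt 8 := by
  refine .seq (P := fun s' => s' = s.setPt 4 (s.pt 8)) (.copyPt (by omega) rfl) fun _ h₁ =>
    .seq (P := fun s' => s' = (s.setPt 4 (s.pt 8)).setPt 8 p) (.copyPt (by omega) ?_) fun _ h₂ =>
    .seq (P := fun s' => s' = ((s.setPt 4 (s.pt 8)).setPt 8 p).setPt 0 q)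
      (.copyPt (by omega) ?_) fun _ h₃ => .copyPt (by omega) ?_
  · rw [h₁, State.setPt_pt_of_ne _ _ (by omega), hs.pt_zero]
  · rw [h₂, State.setPt_pt_of_ne _ _ (by omega), State.setPt_pt_of_ne _ _ (by omega), hs.pt_two]
  · rw [h₃, State.setPt_pt_of_ne (x := 0) _ _ (by omega), State.setPt_pt_self]
    refine ⟨⟨hs.size, hs.vertex, ?_, State.setPt_pt_self ..⟩, ?_⟩
    · rw [State.setPt_pt_of_ne _ _ (by omega), State.setPt_pt_self]
    · rw [State.setPt_pt_of_ne _ _ (by omega), State.setPt_pt_of_ne _ _ (by omega),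
        State.setPt_pt_of_ne _ _ (by omega), State.setPt_pt_self]

theorem ensures_mainProg (hs : Layout m V p q s) (hV : CyclicPolygon m V) (hp : p ∈ openBody V)
    (hq : q ∈ openBody V) (hpq : p ≠ q) (hL : 2 * m + 2 ≤ 2 ^ L) :
    Ensures L mainProg s fun s' => (∃ f b, Crossing m V p q f b) ∧ (∃ f b, Crossing m V q p f b) ∧
      s'.pt 0 ∈ bisectorEnds (body V) p q ∧ 0 < orient p q (s'.pt 0) ∧
      s'.pt 2 ∈ bisectorEnds (body V) p q ∧ orient p q (s'.pt 2) < 0 := by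
  refine .seq (hs.ensures_limitProg hV hp hq hpq hL) fun s₁ ⟨hag, hc, hx, hx0⟩ =>
    .seq (hs.of_agree hag le_rfl (by omega)).ensures_swapProg fun s₂ ⟨hs₂, h4⟩ =>
    .seq (hs₂.ensures_limitProg hV hq hp hpq.symm hL) fun s₃ ⟨hag', hc', hy, hy0⟩ =>
    .seq (P := fun s' => s' = s₃.setPt 0 (s₃.pt 4)) (.copyPt (by omega) rfl) fun s₄ h₄ =>
    .copyPt (by omega) ⟨hc, hc', ?_⟩
  rw [bisectorEnds_swap] at hy
  rw [orient_swap] at hy0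
  rw [State.setPt_pt_self, State.setPt_pt_of_ne _ _ (by omega), h₄, State.setPt_pt_self,
    State.setPt_pt_of_ne _ _ (by omega), hag'.pt (by omega), h4]
  exact ⟨hx, hx0, hy, neg_pos.1 hy0⟩

end Layout

theorem mainProg_depth : mainProg.depth = 2 := rfl

end HilbertPlane

namespace HilbertPlane

theorem HoldsInput.layout {m : ℕ} {s : RealRAM.State} {v : Fin m → Plane} {p q : Plane}
    (hs : HoldsInput s v p q) (hm : 0 < m) : Layout m (cyclicExtension hm v) p q s := by
  obtain ⟨hsize, hp0, hp1, hq0, hq1, hvertex⟩ := hs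
  refine ⟨hsize, fun k hk => ?_, plane_ext hp0 hp1, plane_ext hq0 hq1⟩
  rw [cyclicExtension_of_lt hm v hk]
  exact hvertex ⟨k, hk⟩

theorem two_mul_add_two_le_two_pow_log (m : ℕ) : 2 * m + 2 ≤ 2 ^ (Nat.log 2 m + 2) := by
  have h := Nat.lt_pow_succ_log_self one_lt_two m
  rw [pow_succ]
  omega

theorem natLog_two_le_two_mul_log (m : ℕ) : (Nat.log 2 m : ℝ) ≤ 2 * Real.log m := by
  have hlogb : (Nat.log 2 m : ℝ) ≤ Real.log m / Real.log 2 := Real.natLog_le_logb m 2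
  refine hlogb.trans ?_
  rw [div_le_iff₀ (Real.log_pos one_lt_two)]
  nlinarith [Real.log_two_gt_d9, Real.log_natCast_nonneg m]

theorem one_le_log_of_three_le {x : ℝ} (hx : 3 ≤ x) : 1 ≤ Real.log x := by
  rw [Real.le_log_iff_exp_le (by linarith)]
  linarith [Real.exp_one_lt_d9]

theorem mainProg_bound_le {m : ℕ} (hm : 3 ≤ m) :
    (mainProg.bound (Nat.log 2 m + 2) : ℝ) ≤ 25 * mainProg.bound 1 * Real.log m ^ 2 := by
  have hlog : 1 ≤ Real.log m := one_le_log_of_three_le (by exact_mod_cast hm)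
  have hbound := RealRAM.Prog.bound_le (Nat.log 2 m + 2) mainProg
  rw [mainProg_depth] at hbound
  calc (mainProg.bound (Nat.log 2 m + 2) : ℝ)
      ≤ mainProg.bound 1 * (Nat.log 2 m + 2 + 1) ^ 2 := by exact_mod_cast hbound
    _ ≤ mainProg.bound 1 * (5 * Real.log m) ^ 2 := by
      gcongr
      linarith [natLog_two_le_two_mul_log m]
    _ = 25 * mainProg.bound 1 * Real.log m ^ 2 := by ring

end HilbertPlane

theorem mainTheorem11 :
    ∃ (prog : RealRAM.Prog) (C : ℝ),
      ∀ (m : ℕ) (v : Fin m → HilbertPlane.Plane) (p q : HilbertPlane.Plane),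
        HilbertPlane.IsConvexPolygon v →
        p ∈ interior (HilbertPlane.region v) →
        q ∈ interior (HilbertPlane.region v) →
        p ≠ q →
        ∀ s : RealRAM.State, HilbertPlane.HoldsInput s v p q →
          ∃ (t : ℕ) (s' : RealRAM.State) (x y : HilbertPlane.Plane),
            RealRAM.Exec prog s t s' ∧
            (t : ℝ) ≤ C * Real.log m ^ 2 ∧
            HilbertPlane.HoldsOutput s' x y ∧
            x ∈ HilbertPlane.bisectorEnds (HilbertPlane.region v) p q ∧
            0 < HilbertPlane.orient p q x ∧
            y ∈ HilbertPlane.bisectorEnds (HilbertPlane.region v) p q ∧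
            HilbertPlane.orient p q y < 0 ∧
            ((∀ i j : Fin m, i ≠ j →
                ¬ HilbertPlane.Concurrent line[ℝ, p, q]
                  (HilbertPlane.sideLine v i) (HilbertPlane.sideLine v j)) →
              HilbertPlane.bisectorEnds (HilbertPlane.region v) p q = {x, y}) := by
  refine ⟨HilbertPlane.mainProg, 25 * HilbertPlane.mainProg.bound 1,
    fun m v p q hv hp hq hpq s hs => ?_⟩
  have hm : 0 < m := by linarith [hv.1]
  have hV := hv.cyclicPolygon hm
  rw [hv.region_eq hm] at hp hq ⊢
  rw [hV.interior_body] at hp hq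
  obtain ⟨t, s', hexec, ht, ⟨f, b, hc⟩, hc', hx, hsx, hy, hsy⟩ :=
    (hs.layout hm).ensures_mainProg hV hp hq hpq (HilbertPlane.two_mul_add_two_le_two_pow_log m)
  have htime : (t : ℝ) ≤ 25 * HilbertPlane.mainProg.bound 1 * Real.log m ^ 2 :=
    (Nat.cast_le.2 ht).trans (HilbertPlane.mainProg_bound_le hv.1)
  exact ⟨t, s', s'.pt 0, s'.pt 2, hexec, htime, ⟨rfl, rfl, rfl, rfl⟩, hx, hsx, hy, hsy,
    fun hgen => hV.bisectorEnds_eq_pair hc hc' hp hq hpq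
      (HilbertPlane.side_ratio_injective hv hm hpq hq hgen) hx hy hsx hsy⟩
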